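/- **Setting.** Let $0<\gamma\le 1$ and let $\beta\ge 0$ be measurable on $[0,\frac{\pi}{2}]$, with $\beta(\theta)\le C_\beta\cos\theta\sin\theta$ for some constant $C_\beta$ and $\int_0^{\pi/2}\beta\,d\theta>0$. Set $B(|V|,\theta)=|V|^\gamma\beta(\theta)$ (power-law potential with angular cut-off) and $w(\zeta)=\pi^{-3/2}e^{-|\zeta|^2}$ on $\mathbb R^3$. For functions $F,G$ on $\mathbb R^3$ let $$Q(F,G)(\xi)=\tfrac12\int_{\mathbb R^3}\int_0^{2\pi}\int_0^{\pi/2}\big(F'G_*'+G'F_*'-FG_*-GF_*\big)\,B(|V|,\theta)\,d\theta\,d\epsilon\,d\xi_*,$$ where $V=\xi_*-\xi$, the unit vector $a$ has polar angle $\theta$ and azimuth $\epsilon$ about the axis $V$ (so $a\cdot V=|V|\cos\theta$), a star denotes evaluation at $\xi_*$, a prime evaluation at $\xi'=\xi+(a\cdot V)a$, and $'$ with $*$ evaluation at $\xi_*'=\xi_*-(a\cdot V)a$. Let $$L(g)=2w^{-1/2}Q(w,w^{1/2}g),\qquad \nu(\zeta)=\int_{\mathbb R^3}\int_0^{2\pi}\int_0^{\pi/2}w(\zeta_*)\,B(|\zeta_*-\zeta|,\theta)\,d\theta\,d\epsilon\,d\zeta_*,\qquad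 \|g\|_*=\Big(\int_{\mathbb R^3}g^2\,\nu\,d\zeta\Big)^{1/2},$$ and let $L_*$ be the space of $g$ with $\|g\|_*<\infty$. For a multi-index $\alpha=(\alpha_1,\alpha_2,\alpha_3)$ of nonnegative integers put $$\phi_\alpha(\zeta)=\pi^{-3/4}\zeta_1^{\alpha_1}\zeta_2^{\alpha_2}\zeta_3^{\alpha_3}e^{-|\zeta|^2/2},\qquad A_\alpha=(2\alpha_1)^{\frac{\alpha_1}{2}}(2\alpha_2)^{\frac{\alpha_2}{2}}(2\alpha_3)^{\frac{\alpha_3}{2}}e^{-\frac{\alpha_1+\alpha_2+\alpha_3}{2}}\quad(0^0=1).$$ Let $\mathbb R^{3\pm}=\{\zeta\in\mathbb R^3:\pm\zeta_1>0\}$. For $l>0$, $1<p\le\infty$ and a function $f(x,\zeta)$ on $[0,l]\times\mathbb R^3$ put $$\langle f\rangle'=1+\sup_{0\le x\le l}\|f(x,\cdot)\|_*+\|f(0,\cdot)\|_{L^\infty(\mathbb R^{3+})}+\|f(l,\cdot)\|_{L^\infty(\mathbb R^{3-})}+\|\nabla f(0,\cdot)\|_{L^p(\mathbb R^{3+})}\in[1,\infty],$$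 where $\nabla f(0,\cdot)$ is the weak gradient of $f(0,\cdot)$ on $\mathbb R^{3+}$. **Lemma.** There is $x_0>0$, depending only on $\gamma$ and $\beta$, and for every $p$ with $1<p\le\infty$ there is a constant $C$, depending only on $\gamma$, $\beta$ and $p$, such that the following holds for all $l>0$ and all $f$ with $f(0,\cdot)\in L_*$ and $\nabla f(0,\cdot)\in L^p(\mathbb R^{3+})$. 1. For almost every $(\zeta_2,\zeta_3)\in\mathbb R^2$ the limit $$L(f)(0,0^+,\zeta_2,\zeta_3):=\lim_{\zeta_1\to0^+}L(f)(0,\zeta_1,\zeta_2,\zeta_3)$$ exists; it is understood as an essential limit (null sets of $\zeta_1$ are disregarded), because $f(0,\cdot)$ is determined only almost everywhere. 2. For every $\alpha$ and every $0<x\le x_0$ the two integrals below converge absolutely, and $$\bigg|\int_{\zeta_1>0}\phi_\alpha(\zeta)\,\frac{1}{|\zeta_1|}\,e^{-\frac{\nu(\zeta)}{|\zeta_1|}x}\,L(f)(0,\zeta)\,d\zeta+\ln x\iint_{\mathbb R^2}\phi_\alpha(0,\zeta_2,\zeta_3)\,L(f)(0,0^+,\zeta_2,\zeta_3)\,d\zeta_2\,d\zeta_3\bigg|\le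 C\,A_\alpha\,\langle f\rangle'.$$ -/

import Mathlib

open MeasureTheory Filter Topology Set
open scoped ENNReal NNReal

namespace CutoffBoltzmann

/-- Velocity space `ℝ³`; the coordinates `ζ₁, ζ₂, ζ₃` are `ζ 0, ζ 1, ζ 2`. -/
abbrev Vel : Type := EuclideanSpace ℝ (Fin 3)

/-- The half space `ζ₁ > 0`. -/
def halfPos : Set Vel := {ζ | 0 < ζ 0}

/-- The half space `ζ₁ < 0`. -/
def halfNeg : Set Vel := {ζ | ζ 0 < 0}

/-! ### The collision operator -/

/-- Power-law potential with angular cut-off: the cross-section is `B(|V|, θ) = |V| ^ γ * β θ` with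
`0 < γ ≤ 1`, `β ≥ 0` and `β θ ≤ C cos θ sin θ` for `0 ≤ θ ≤ π / 2`, and it does not vanish
identically. -/
structure IsCutoffPowerLaw (γ : ℝ) (β : ℝ → ℝ) : Prop where
  gamma_pos : 0 < γ
  gamma_le_one : γ ≤ 1
  measurable : Measurable β
  nonneg : ∀ θ ∈ Icc (0 : ℝ) (Real.pi / 2), 0 ≤ β θ
  le_cos_mul_sin : ∃ C : ℝ, ∀ θ ∈ Icc (0 : ℝ) (Real.pi / 2), β θ ≤ C * (Real.cos θ * Real.sin θ)
  nontrivial : 0 < ∫ θ in Icc (0 : ℝ) (Real.pi / 2), β θ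

/-- The cross-section `B(|V|, θ) = |V| ^ γ * β θ`, as a function of `r = |V|` and `θ`. -/
noncomputable def crossSection (γ : ℝ) (β : ℝ → ℝ) (r θ : ℝ) : ℝ := r ^ γ * β θ

/-- A unit vector orthogonal to `V`. -/
noncomputable def frame₁ (V : Vel) : Vel :=
  if V 0 ^ 2 + V 1 ^ 2 = 0 then !₂[1, 0, 0]
  else (√(V 0 ^ 2 + V 1 ^ 2))⁻¹ • !₂[-V 1, V 0, 0]

/-- The cross product of `V / |V|` and `frame₁ V`: for `V ≠ 0` the vectors `V / |V|`, `frame₁ V`,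
`frame₂ V` form an orthonormal basis. -/
noncomputable def frame₂ (V : Vel) : Vel :=
  ‖V‖⁻¹ • !₂[V 1 * frame₁ V 2 - V 2 * frame₁ V 1, V 2 * frame₁ V 0 - V 0 * frame₁ V 2,
    V 0 * frame₁ V 1 - V 1 * frame₁ V 0]

/-- The unit vector `α` with polar angle `θ` and azimuth `ε` about the axis `V`, so that
`α · V = |V| cos θ` (for `V ≠ 0`). For `0 ≤ θ ≤ π / 2` and `0 ≤ ε ≤ 2π` it runs over the hemisphere
`α · V ≥ 0`. -/
noncomputable def collisionDir (V : Vel) (θ ε : ℝ) : Vel :=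
  Real.cos θ • (‖V‖⁻¹ • V) + Real.sin θ • (Real.cos ε • frame₁ V + Real.sin ε • frame₂ V)

/-- The post-collisional velocity `ξ' = ξ + (α · V) α`, where `V = ξ_* - ξ`. -/
noncomputable def postVel (ξ ξs : Vel) (θ ε : ℝ) : Vel :=
  ξ + (inner ℝ (collisionDir (ξs - ξ) θ ε) (ξs - ξ)) • collisionDir (ξs - ξ) θ ε

/-- The post-collisional velocity `ξ_*' = ξ_* - (α · V) α`, where `V = ξ_* - ξ`. -/
noncomputable def postVelStar (ξ ξs : Vel) (θ ε : ℝ) : Vel :=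
  ξs - (inner ℝ (collisionDir (ξs - ξ) θ ε) (ξs - ξ)) • collisionDir (ξs - ξ) θ ε

/-- The domain of integration for `(ξ_*, θ, ε)`. -/
def collisionDomain : Set (Vel × ℝ × ℝ) :=
  univ ×ˢ (Icc (0 : ℝ) (Real.pi / 2) ×ˢ Icc (0 : ℝ) (2 * Real.pi))

/-- The symmetric bilinear collision operator
`Q(F, G)(ξ) = ½ ∫∫∫ (F' G_*' + G' F_*' - F G_* - G F_*) B(|V|, θ) dθ dε dξ_*`,
whose diagonal is the quadratic operator `Q(F, F) = ∫∫∫ (F' F_*' - F F_*) B dθ dε dξ_*`. -/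
noncomputable def collisionQ (γ : ℝ) (β : ℝ → ℝ) (F G : Vel → ℝ) (ξ : Vel) : ℝ :=
  (1 / 2) * ∫ c in collisionDomain,
    (F (postVel ξ c.1 c.2.1 c.2.2) * G (postVelStar ξ c.1 c.2.1 c.2.2)
      + G (postVel ξ c.1 c.2.1 c.2.2) * F (postVelStar ξ c.1 c.2.1 c.2.2)
      - F ξ * G c.1 - G ξ * F c.1) * crossSection γ β ‖c.1 - ξ‖ c.2.1

/-- The standard Maxwellian `w(ζ) = π ^ (-3/2) exp (-|ζ|²)`. -/
noncomputable def maxwellian (ζ : Vel) : ℝ := (√Real.pi ^ 3)⁻¹ * Real.exp (-‖ζ‖ ^ 2)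

/-- The linearized collision operator `L(f) = 2 w^(-1/2) Q(w, w^(1/2) f)`. -/
noncomputable def linCollision (γ : ℝ) (β : ℝ → ℝ) (f : Vel → ℝ) (ζ : Vel) : ℝ :=
  2 * (√(maxwellian ζ))⁻¹ *
    collisionQ γ β maxwellian (fun η => √(maxwellian η) * f η) ζ

/-- The collision frequency `ν(ζ) = ∫∫∫ w(ζ_*) B(|ζ_* - ζ|, θ) dθ dε dζ_*`; the term of `L(f)(ζ)`
in which `f` is evaluated at `ζ` is `-ν(ζ) f(ζ)`. -/
noncomputable def collisionFreq (γ : ℝ) (β : ℝ → ℝ) (ζ : Vel) : ℝ :=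
  ∫ c in collisionDomain, maxwellian c.1 * crossSection γ β ‖c.1 - ζ‖ c.2.1

/-! ### Norms -/

/-- `‖g‖_* = (∫ g² ν dζ)^(1/2)`, with values in `[0, ∞]`. -/
noncomputable def starNorm (γ : ℝ) (β : ℝ → ℝ) (g : Vel → ℝ) : ℝ≥0∞ :=
  (∫⁻ ζ, ENNReal.ofReal (g ζ ^ 2 * collisionFreq γ β ζ)) ^ (1 / 2 : ℝ)

/-- Membership in `L_*`. -/
def MemLstar (γ : ℝ) (β : ℝ → ℝ) (g : Vel → ℝ) : Prop :=
  AEStronglyMeasurable g volume ∧ starNorm γ β g < ⊤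

/-- `G` is the weak gradient of `g` on the open set `U`. -/
def IsWeakGradientOn (U : Set Vel) (g : Vel → ℝ) (G : Vel → Vel) : Prop :=
  LocallyIntegrableOn g U ∧ LocallyIntegrableOn G U ∧
    ∀ φ : Vel → ℝ, ContDiff ℝ ((⊤ : ℕ∞) : WithTop ℕ∞) φ → HasCompactSupport φ → tsupport φ ⊆ U → ∀ i : Fin 3,
      ∫ ζ in U, g ζ * fderiv ℝ φ ζ (EuclideanSpace.single i 1) = -∫ ζ in U, G ζ i * φ ζ

/-- `⟨f⟩' = 1 + |||f||| + ‖f(0,·)‖_{L^∞(ζ₁>0)} + ‖f(l,·)‖_{L^∞(ζ₁<0)} + ‖∇f(0,·)‖_{L^p(ζ₁>0)}` with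
`|||f||| = sup_{0 ≤ x ≤ l} ‖f(x,·)‖_*`, where `G` stands for the weak gradient `∇f(0,·)`. -/
noncomputable def bracket' (γ : ℝ) (β : ℝ → ℝ) (p : ℝ≥0∞) (l : ℝ) (f : ℝ → Vel → ℝ)
    (G : Vel → Vel) : ℝ≥0∞ :=
  1 + (⨆ x ∈ Icc 0 l, starNorm γ β (f x)) + eLpNorm (f 0) ⊤ (volume.restrict halfPos)
    + eLpNorm (f l) ⊤ (volume.restrict halfNeg) + eLpNorm G p (volume.restrict halfPos)

/-! ### Moments and the boundary value -/

/-- `φ_α(ζ) = π^(-3/4) ζ₁^α₁ ζ₂^α₂ ζ₃^α₃ exp (-|ζ|²/2)`. -/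
noncomputable def momentWeight (α : Fin 3 → ℕ) (ζ : Vel) : ℝ :=
  Real.pi ^ (-(3 / 4) : ℝ) * (∏ i, ζ i ^ α i) * Real.exp (-‖ζ‖ ^ 2 / 2)

/-- `A_α = ∏ᵢ (2αᵢ)^(αᵢ/2) * exp (-(α₁+α₂+α₃)/2)`, with `0 ^ 0 = 1`. -/
noncomputable def momentConst (α : Fin 3 → ℕ) : ℝ :=
  (∏ i, (2 * (α i : ℝ)) ^ ((α i : ℝ) / 2)) * Real.exp (-(∑ i, (α i : ℝ)) / 2)

/-- The filter of the essential limit `t → 0⁺`: null sets of `t` are disregarded, as befits functions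
that are determined only almost everywhere. -/
noncomputable def essZeroRight : Filter ℝ := 𝓝[>] (0 : ℝ) ⊓ ae volume

/-- `h(0⁺, ζ₂, ζ₃) = lim_{ζ₁ → 0⁺} h(ζ₁, ζ₂, ζ₃)`, the boundary value of `h` at `ζ₁ = 0⁺`. -/
noncomputable def boundaryValue (h : Vel → ℝ) (q : ℝ × ℝ) : ℝ :=
  limUnder essZeroRight (fun t : ℝ => h !₂[t, q.1, q.2])

end CutoffBoltzmann

namespace CutoffBoltzmann

/-! Write t for the first velocity coordinate and q for the other two. Behind the statement stands
the expansion ∫₀¹ g(t) t⁻¹ e^{-νx/t} dt = -g(0) ln x + O(1), valid for every g with a Hölder modulus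
at 0: the exponential cuts t⁻¹ off near t = x. The kernel differs from 1_{x<t<1}/t by at most a
multiple of `cutMajorant x t`, whose integral over (0,1) is bounded uniformly in x, and g(t) - g(0)
= O(t^δ) is integrable against dt/t. `exists_log_singularity_le` is this argument with Gaussian
weights in q. If `α 0 ≠ 0`, the power of t removes the singularity and the boundary integral
vanishes, so no logarithm occurs (`exists_moment_estimate`). The number A_α is the maximum of |ζ^α|
e^{-|ζ|²/4}: half of the Gaussian in φ_α pays for the monomial, the other half for the growth of ν
and of L(f).

What remains is to show that L(f) has a boundary value at t = 0⁺ at a Hölder rate, with weighted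
bounds by the norms of f (`exists_collision_trace`). By `linCollision_eq`, L(f) = K f - ν f, and the
three ingredients are regular in t for different reasons.

The frequency ν is γ-Hölder, because |·|^γ is. The function f has a trace because ∂₁f is in L^p with
p > 1: on almost every line f(t) - f(0⁺) = ∫₀ᵗ ∂₁f, which is at most t^a ∫ s^{-a} |∂₁f|, and
Hölder's inequality controls the last integral (with a Gaussian weight in q) once a times the
conjugate exponent is below 1 (`exists_lintegral_traceMajorant_le`). The integral operator K gains
regularity from its kernel alone: K f is δ-Hölder in the direction of the first axis for every f in
L² (`exists_integralOp_bounds`), and L² is controlled by ‖·‖_* since ν is bounded below.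

The gain part of K needs most of the work. With V = ξ_* - ξ and the transferred velocity v = (a·V)a
one has ξ' = ξ + v. Exchanging the directions of V and v turns integration over (V, θ, ε) into
integration over (v, θ, ε) with Jacobian cos⁻³θ (`lintegral_collision_swap`), so f(ξ + v) appears
against an explicit Gaussian kernel. For the Hölder estimate ξ moves by t e₁ and v by -t e₁, which
leaves the argument of f fixed; the transverse frame at v is chosen so that this motion changes V by
O(t (1 + tan θ)). The Gaussian supplies negative powers of |V| = |v|/cos θ, hence positive powers of
cos θ; together with the factor cos θ from the cut-off they reduce cos⁻³θ to the integrable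
cos^{δ-1}θ, at the price of |v|^{-(1+2δ)}, which is square integrable near 0. The term with f(ξ_*')
is the same operator with β(π/2 - θ), and the cut-off bound is symmetric under this reflection. -/

/-- The coordinates `(ζ₁, (ζ₂, ζ₃))` on velocity space. -/
noncomputable def velCoord : Vel ≃ᵐ ℝ × ℝ × ℝ :=
  (MeasurableEquiv.toLp 2 (Fin 3 → ℝ)).symm.trans
    ((MeasurableEquiv.piFinSuccAbove (fun _ => ℝ) 0).trans
      (MeasurableEquiv.prodCongr (MeasurableEquiv.refl ℝ) MeasurableEquiv.finTwoArrow))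

theorem velCoord_apply (ζ : Vel) : velCoord ζ = (ζ 0, ζ 1, ζ 2) := rfl

theorem velCoord_symm_apply (p : ℝ × ℝ × ℝ) : velCoord.symm p = !₂[p.1, p.2.1, p.2.2] := by
  rw [MeasurableEquiv.symm_apply_eq, velCoord_apply]
  simp

theorem measurePreserving_velCoord : MeasurePreserving velCoord := by
  have h1 := (EuclideanSpace.volume_preserving_symm_measurableEquiv_toLp (Fin 3))
  have h2 := volume_preserving_piFinSuccAbove (fun _ : Fin 3 => ℝ) 0
  have h3 := (MeasurePreserving.id (volume : Measure ℝ)).prod (volume_preserving_finTwoArrow ℝ)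
  exact h3.comp (h2.comp h1)

theorem lintegral_velCoord (F : Vel → ℝ≥0∞) :
    ∫⁻ ζ, F ζ = ∫⁻ p : ℝ × ℝ × ℝ, F !₂[p.1, p.2.1, p.2.2] := by
  rw [← measurePreserving_velCoord.symm.lintegral_comp_emb velCoord.symm.measurableEmbedding]
  simp [velCoord_symm_apply]

theorem measurable_vel_mk : Measurable (fun p : ℝ × ℝ × ℝ => (!₂[p.1, p.2.1, p.2.2] : Vel)) := by
  have h : (fun p : ℝ × ℝ × ℝ => (!₂[p.1, p.2.1, p.2.2] : Vel)) = velCoord.symm :=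
    funext fun p => (velCoord_symm_apply p).symm
  rw [h]
  exact velCoord.symm.measurable

/-! ### Spherical coordinates and the surface measure of the unit sphere -/

/-- The direction with polar angle `θ` and azimuth `ε` in the frame `(a, b, c)`. -/
noncomputable def frameDir (a b c : Vel) (θ ε : ℝ) : Vel :=
  Real.cos θ • a + Real.sin θ • (Real.cos ε • b + Real.sin ε • c)

theorem lintegral_polar (F : ℝ × ℝ → ℝ≥0∞) (hF : Measurable F) :
    ∫⁻ p, F p = ∫⁻ ε in Ioo (-Real.pi) Real.pi, ∫⁻ r in Ioi (0 : ℝ),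
      ENNReal.ofReal r * F (r * Real.cos ε, r * Real.sin ε) := by
  rw [← lintegral_comp_polarCoord_symm, polarCoord_target, Measure.volume_eq_prod,
    ← Measure.prod_restrict, lintegral_prod_symm]
  · simp
  · simp only [polarCoord_symm_apply, smul_eq_mul]
    fun_prop

/-- Integration over `ℝ³` in spherical coordinates. -/
theorem lintegral_spherical (F : ℝ × ℝ × ℝ → ℝ≥0∞) (hF : Measurable F) :
    ∫⁻ p, F p = ∫⁻ θ in Ioo 0 Real.pi, ∫⁻ ε in Ioo (-Real.pi) Real.pi, ∫⁻ r in Ioi (0 : ℝ),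
      ENNReal.ofReal (r ^ 2 * Real.sin θ) * F (r * Real.cos θ,
        r * Real.sin θ * Real.cos ε, r * Real.sin θ * Real.sin ε) := by
  -- Polar coordinates are used twice: in the last two variables, which gives the distance ρ from
  -- the axis, and then in the half plane of the pairs (z, ρ). The indicator extends the half plane
  -- ρ > 0 to the full plane.
  have hswap : ∫⁻ p, F p = ∫⁻ ε in Ioo (-Real.pi) Real.pi, ∫⁻ z : ℝ × ℝ,
      (Ioi (0 : ℝ)).indicator (fun ρ => ENNReal.ofReal ρ *
        F (z.1, ρ * Real.cos ε, ρ * Real.sin ε)) z.2 := by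
    rw [Measure.volume_eq_prod, lintegral_prod _ hF.aemeasurable]
    simp_rw [fun t => lintegral_polar (fun y => F (t, y)) (by fun_prop)]
    rw [lintegral_lintegral_swap]
    · refine lintegral_congr fun ε => ?_
      rw [Measure.volume_eq_prod, lintegral_prod]
      · refine lintegral_congr fun t => ?_
        exact (lintegral_indicator measurableSet_Ioi _).symm
      · refine Measurable.aemeasurable ?_
        simp only [indicator]
        refine Measurable.ite (measurableSet_Ioi.preimage measurable_snd) ?_ measurable_const
        fun_prop
    · refine Measurable.aemeasurable ?_
      refine Measurable.lintegral_prod_right' (f := fun x : (ℝ × ℝ) × ℝ => ENNReal.ofReal x.2 *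
        F (x.1.1, x.2 * Real.cos x.1.2, x.2 * Real.sin x.1.2)) ?_
      fun_prop
  have key := lintegral_lintegral_swap (μ := volume.restrict (Ioo (-Real.pi) Real.pi))
    (ν := volume.restrict (Ioo 0 Real.pi)) (f := fun ε θ => ∫⁻ r in Ioi (0 : ℝ),
      ENNReal.ofReal (r ^ 2 * Real.sin θ) * F (r * Real.cos θ,
        r * Real.sin θ * Real.cos ε, r * Real.sin θ * Real.sin ε)) (by
    refine Measurable.aemeasurable ?_
    refine Measurable.lintegral_prod_right' (f := fun x : (ℝ × ℝ) × ℝ => ENNReal.ofReal (x.2 ^ 2 *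
      Real.sin x.1.2) * F (x.2 * Real.cos x.1.2, x.2 * Real.sin x.1.2 * Real.cos x.1.1,
        x.2 * Real.sin x.1.2 * Real.sin x.1.1)) ?_
    fun_prop)
  rw [hswap, ← key]
  refine lintegral_congr fun ε => ?_
  rw [lintegral_polar]
  rotate_left
  · simp only [indicator]
    refine Measurable.ite (measurableSet_Ioi.preimage measurable_snd) ?_ measurable_const
    fun_prop
  rw [← lintegral_indicator measurableSet_Ioo, ← lintegral_indicator measurableSet_Ioo]
  refine lintegral_congr fun θ => ?_
  by_cases hθ : θ ∈ Ioo 0 Real.pi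
  · have h2 : θ ∈ Ioo (-Real.pi) Real.pi := ⟨by linarith [hθ.1, Real.pi_pos], hθ.2⟩
    have hs := Real.sin_pos_of_mem_Ioo hθ
    rw [indicator_of_mem hθ, indicator_of_mem h2]
    refine setLIntegral_congr_fun measurableSet_Ioi fun r hr => ?_
    have hr : 0 < r := hr
    have : r * Real.sin θ ∈ Ioi (0 : ℝ) := mul_pos hr hs
    simp only
    rw [indicator_of_mem this, ← mul_assoc, ← ENNReal.ofReal_mul hr.le]
    congr 2
    ring
  -- The remaining angles of the plane have r sin θ ≤ 0 and are killed by the indicator.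
  · rw [indicator_of_notMem hθ]
    by_cases h2 : θ ∈ Ioo (-Real.pi) Real.pi
    · rw [indicator_of_mem h2, ← lintegral_zero (μ := volume.restrict (Ioi (0 : ℝ)))]
      refine setLIntegral_congr_fun measurableSet_Ioi fun r hr => ?_
      have hs : Real.sin θ ≤ 0 := by
        refine Real.sin_nonpos_of_nonpos_of_neg_pi_le ?_ h2.1.le
        by_contra! h
        exact hθ ⟨h, h2.2⟩
      have : r * Real.sin θ ∉ Ioi (0 : ℝ) := by
        have hr : 0 < r := hr
        simp only [mem_Ioi, not_lt]
        exact mul_nonpos_of_nonneg_of_nonpos hr.le hs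
      simp only
      rw [indicator_of_notMem this, mul_zero]
    · rw [indicator_of_notMem h2]

theorem measurable_frameDir (a b c : Vel) :
    Measurable (fun p : ℝ × ℝ => frameDir a b c p.1 p.2) := by
  unfold frameDir
  fun_prop

/-- Integration over `ℝ³` in spherical coordinates attached to an orthonormal basis. -/
theorem lintegral_frameDir (e : OrthonormalBasis (Fin 3) ℝ Vel) (F : Vel → ℝ≥0∞)
    (hF : Measurable F) :
    ∫⁻ ζ, F ζ = ∫⁻ θ in Ioo 0 Real.pi, ∫⁻ ε in Ioo (-Real.pi) Real.pi, ∫⁻ r in Ioi (0 : ℝ),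
      ENNReal.ofReal (r ^ 2 * Real.sin θ) * F (r • frameDir (e 0) (e 1) (e 2) θ ε) := by
  rw [← e.measurePreserving_repr_symm.lintegral_comp hF, lintegral_velCoord, lintegral_spherical]
  · refine lintegral_congr fun θ => lintegral_congr fun ε => lintegral_congr fun r => ?_
    congr 2
    rw [← e.sum_repr_symm]
    simp [Fin.sum_univ_three, frameDir, smul_smul, add_assoc, mul_assoc]
  · have := measurable_vel_mk
    have := e.repr.symm.continuous.measurable
    fun_prop

/-- The surface measure of the unit sphere, as a measure on `Vel`. -/
noncomputable def sphereMeasure : Measure Vel :=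
  Measure.map (fun p : ℝ × ℝ => frameDir (EuclideanSpace.basisFun (Fin 3) ℝ 0)
    (EuclideanSpace.basisFun (Fin 3) ℝ 1) (EuclideanSpace.basisFun (Fin 3) ℝ 2) p.1 p.2)
    (((volume.restrict (Ioo 0 Real.pi)).prod
      (volume.restrict (Ioo (-Real.pi) Real.pi))).withDensity
        (fun p => ENNReal.ofReal (Real.sin p.1)))

instance : SFinite sphereMeasure := by
  unfold sphereMeasure
  infer_instance

theorem norm_frameDir {a b c : Vel} (h : Orthonormal ℝ ![a, b, c]) (θ ε : ℝ) :
    ‖frameDir a b c θ ε‖ = 1 := by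
  have ha : inner ℝ a a = (1 : ℝ) := by have := h.1 0; simp at this; simp [this]
  have hb : inner ℝ b b = (1 : ℝ) := by have := h.1 1; simp at this; simp [this]
  have hc : inner ℝ c c = (1 : ℝ) := by have := h.1 2; simp at this; simp [this]
  have hab : inner ℝ a b = (0 : ℝ) := h.2 (i := 0) (j := 1) (by decide)
  have hac : inner ℝ a c = (0 : ℝ) := h.2 (i := 0) (j := 2) (by decide)
  have hbc : inner ℝ b c = (0 : ℝ) := h.2 (i := 1) (j := 2) (by decide)
  have hba : inner ℝ b a = (0 : ℝ) := by rw [real_inner_comm, hab]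
  have hca : inner ℝ c a = (0 : ℝ) := by rw [real_inner_comm, hac]
  have hcb : inner ℝ c b = (0 : ℝ) := by rw [real_inner_comm, hbc]
  have hsq : ‖frameDir a b c θ ε‖ ^ 2 = 1 := by
    rw [← real_inner_self_eq_norm_sq]
    simp only [frameDir, inner_add_left, inner_add_right, inner_smul_left, inner_smul_right,
      ha, hb, hc, hab, hac, hbc, hba, hca, hcb]
    simp
    have h1 := Real.sin_sq_add_cos_sq θ
    have h2 := Real.sin_sq_add_cos_sq ε
    linear_combination h1 + Real.sin θ ^ 2 * h2
  nlinarith [norm_nonneg (frameDir a b c θ ε)]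

theorem inner_frameDir {a b c : Vel} (h : Orthonormal ℝ ![a, b, c]) (θ ε : ℝ) :
    inner ℝ (frameDir a b c θ ε) a = Real.cos θ := by
  have ha : inner ℝ a a = (1 : ℝ) := by have := h.1 0; simp at this; simp [this]
  have hba : inner ℝ b a = (0 : ℝ) := h.2 (i := 1) (j := 0) (by decide)
  have hca : inner ℝ c a = (0 : ℝ) := h.2 (i := 2) (j := 0) (by decide)
  simp only [frameDir, inner_add_left, inner_smul_left, ha, hba, hca]
  simp

theorem orthonormal_cons_basis (e : OrthonormalBasis (Fin 3) ℝ Vel) :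
    Orthonormal ℝ ![e 0, e 1, e 2] := by
  have : ![e 0, e 1, e 2] = e := by
    ext i; fin_cases i <;> rfl
  rw [this]
  exact e.orthonormal

theorem exists_orthonormalBasis {a b c : Vel} (h : Orthonormal ℝ ![a, b, c]) :
    ∃ e : OrthonormalBasis (Fin 3) ℝ Vel, e 0 = a ∧ e 1 = b ∧ e 2 = c := by
  have hcard : Fintype.card (Fin 3) = Module.finrank ℝ Vel := by simp
  refine ⟨(basisOfOrthonormalOfCardEqFinrank h hcard).toOrthonormalBasis (by simpa using h), ?_⟩
  simp

theorem lintegral_sphereMeasure_basisFun (F : Vel → ℝ≥0∞) (hF : Measurable F) :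
    ∫⁻ σ, F σ ∂sphereMeasure = ∫⁻ θ in Ioo 0 Real.pi, ∫⁻ ε in Ioo (-Real.pi) Real.pi,
      ENNReal.ofReal (Real.sin θ) * F (frameDir (EuclideanSpace.basisFun (Fin 3) ℝ 0)
    (EuclideanSpace.basisFun (Fin 3) ℝ 1) (EuclideanSpace.basisFun (Fin 3) ℝ 2) θ ε) := by
  have hm := measurable_frameDir (EuclideanSpace.basisFun (Fin 3) ℝ 0)
    (EuclideanSpace.basisFun (Fin 3) ℝ 1) (EuclideanSpace.basisFun (Fin 3) ℝ 2)
  rw [sphereMeasure, lintegral_map hF hm, lintegral_withDensity_eq_lintegral_mul _ (by fun_prop)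
    (by fun_prop), lintegral_prod _ (by fun_prop)]
  simp

/-- The test function used to isolate the angular part of an integral over `ℝ³`. -/
theorem lintegral_angular (e : OrthonormalBasis (Fin 3) ℝ Vel) (F : Vel → ℝ≥0∞)
    (hF : Measurable F) :
    ∫⁻ ζ, ({y : Vel | ‖y‖ < 1}.indicator
      (fun y => ENNReal.ofReal ((‖y‖ ^ 2)⁻¹) * F (‖y‖⁻¹ • y))) ζ =
    ∫⁻ θ in Ioo 0 Real.pi, ∫⁻ ε in Ioo (-Real.pi) Real.pi,
      ENNReal.ofReal (Real.sin θ) * F (frameDir (e 0) (e 1) (e 2) θ ε) := by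
  rw [lintegral_frameDir e]
  · refine setLIntegral_congr_fun measurableSet_Ioo fun θ hθ => lintegral_congr fun ε => ?_
    have h1 : ∀ r ∈ Ioi (0 : ℝ), ENNReal.ofReal (r ^ 2 * Real.sin θ) *
        ({y : Vel | ‖y‖ < 1}.indicator (fun y => ENNReal.ofReal ((‖y‖ ^ 2)⁻¹) * F (‖y‖⁻¹ • y)))
          (r • frameDir (e 0) (e 1) (e 2) θ ε) =
        (Iio (1 : ℝ)).indicator (fun _ => ENNReal.ofReal (Real.sin θ) *
          F (frameDir (e 0) (e 1) (e 2) θ ε)) r := by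
      intro r hr
      have hr : 0 < r := hr
      have hn : ‖r • frameDir (e 0) (e 1) (e 2) θ ε‖ = r := by
        rw [norm_smul, norm_frameDir (orthonormal_cons_basis e), mul_one, Real.norm_of_nonneg hr.le]
      by_cases h : r < 1
      · rw [indicator_of_mem (by simpa [hn] using h), indicator_of_mem (by simpa using h)]
        simp only [hn, smul_smul, inv_mul_cancel₀ hr.ne', one_smul]
        rw [← mul_assoc, ← ENNReal.ofReal_mul (by
          have := Real.sin_pos_of_mem_Ioo hθ
          positivity)]
        congr 2
        field_simp
      · rw [indicator_of_notMem (by simpa [hn] using h), indicator_of_notMem (by simpa using h),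
          mul_zero]
    rw [setLIntegral_congr_fun measurableSet_Ioi h1, setLIntegral_indicator measurableSet_Iio]
    have : Iio (1 : ℝ) ∩ Ioi 0 = Ioo 0 1 := by ext; simp [and_comm]
    rw [this]
    simp
  · refine Measurable.indicator ?_ (measurableSet_lt (by fun_prop) (by fun_prop))
    fun_prop

/-- Rotation invariance. The measure is defined through the standard basis, but `lintegral_angular`
identifies the integral in any orthonormal basis with a Lebesgue integral over the unit ball in
which no basis occurs. -/
theorem lintegral_sphereMeasure (e : OrthonormalBasis (Fin 3) ℝ Vel) (F : Vel → ℝ≥0∞)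
    (hF : Measurable F) :
    ∫⁻ σ, F σ ∂sphereMeasure = ∫⁻ θ in Ioo 0 Real.pi, ∫⁻ ε in Ioo (-Real.pi) Real.pi,
      ENNReal.ofReal (Real.sin θ) * F (frameDir (e 0) (e 1) (e 2) θ ε) := by
  rw [← lintegral_angular e F hF, lintegral_angular (EuclideanSpace.basisFun (Fin 3) ℝ) F hF,
    lintegral_sphereMeasure_basisFun F hF]

theorem ae_norm_sphereMeasure : ∀ᵐ σ ∂sphereMeasure, ‖σ‖ = 1 := by
  have hm := measurable_frameDir (EuclideanSpace.basisFun (Fin 3) ℝ 0)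
    (EuclideanSpace.basisFun (Fin 3) ℝ 1) (EuclideanSpace.basisFun (Fin 3) ℝ 2)
  rw [sphereMeasure, ae_map_iff hm.aemeasurable (measurableSet_eq_fun (by fun_prop) (by fun_prop))]
  exact Eventually.of_forall fun p => norm_frameDir (orthonormal_cons_basis _) _ _

/-- Polar coordinates in `ℝ³`. -/
theorem lintegral_sphere_radius (F : Vel → ℝ≥0∞) (hF : Measurable F) :
    ∫⁻ ζ, F ζ = ∫⁻ σ, (∫⁻ r in Ioi (0 : ℝ), ENNReal.ofReal (r ^ 2) * F (r • σ))
      ∂sphereMeasure := by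
  rw [lintegral_frameDir (EuclideanSpace.basisFun (Fin 3) ℝ) F hF,
    lintegral_sphereMeasure_basisFun]
  · refine setLIntegral_congr_fun measurableSet_Ioo fun θ hθ => lintegral_congr fun ε => ?_
    rw [← lintegral_const_mul _ (by fun_prop)]
    refine lintegral_congr fun r => ?_
    rw [← mul_assoc, ← ENNReal.ofReal_mul (Real.sin_pos_of_mem_Ioo hθ).le, mul_comm (r ^ 2)]
  · refine Measurable.lintegral_prod_right' (f := fun x : Vel × ℝ => ENNReal.ofReal (x.2 ^ 2) *
      F (x.2 • x.1)) ?_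
    fun_prop

/-! ### Exchanging the relative and the transferred velocity -/

/-- The angular density on the sphere corresponding to a density in the polar angle,
as a function of the cosine. -/
noncomputable def cosDensity (b : ℝ → ℝ≥0∞) (c : ℝ) : ℝ≥0∞ :=
  (Ioi (0 : ℝ)).indicator (fun c => b (Real.arccos c) * (ENNReal.ofReal √(1 - c ^ 2))⁻¹) c

theorem measurable_cosDensity {b : ℝ → ℝ≥0∞} (hb : Measurable b) : Measurable (cosDensity b) := by
  unfold cosDensity
  refine Measurable.indicator ?_ measurableSet_Ioi
  have := Real.measurable_arccos
  fun_prop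

/-- Surface measure is sin θ dθ dε, so b(θ) dθ dε has density b(θ)/sin θ on the hemisphere around
`a₀`, a function of the cosine alone. In this form the density is symmetric in the two directions,
which permits their exchange, and the transverse vectors no longer matter. -/
theorem lintegral_cosDensity {b : ℝ → ℝ≥0∞} (hb : Measurable b) {a₀ a₁ a₂ : Vel}
    (he : Orthonormal ℝ ![a₀, a₁, a₂]) (F : Vel → ℝ≥0∞) (hF : Measurable F) :
    ∫⁻ σ, cosDensity b (inner ℝ σ a₀) * F σ ∂sphereMeasure =
      ∫⁻ θ in Ioo 0 (Real.pi / 2), ∫⁻ ε in Ioo (-Real.pi) Real.pi,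
        b θ * F (frameDir a₀ a₁ a₂ θ ε) := by
  obtain ⟨e, rfl, rfl, rfl⟩ := exists_orthonormalBasis he
  have hcd := measurable_cosDensity hb
  rw [lintegral_sphereMeasure e _ (by fun_prop), ← lintegral_indicator measurableSet_Ioo,
    ← lintegral_indicator measurableSet_Ioo]
  refine lintegral_congr fun θ => ?_
  simp_rw [inner_frameDir he]
  by_cases h1 : θ ∈ Ioo 0 (Real.pi / 2)
  · have h2 : θ ∈ Ioo 0 Real.pi := ⟨h1.1, by linarith [h1.2, Real.pi_pos]⟩
    rw [indicator_of_mem h1, indicator_of_mem h2]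
    refine lintegral_congr fun ε => ?_
    have hc : 0 < Real.cos θ := Real.cos_pos_of_mem_Ioo ⟨by linarith [h1.1, Real.pi_pos], h1.2⟩
    have hs := Real.sin_pos_of_mem_Ioo h2
    rw [cosDensity, indicator_of_mem (by simpa using hc), Real.arccos_cos h1.1.le h2.2.le,
      ← Real.sin_sq, Real.sqrt_sq hs.le]
    have h0 : ENNReal.ofReal (Real.sin θ) ≠ 0 := by simpa using hs
    rw [mul_comm (b θ), mul_assoc, ← mul_assoc, ENNReal.mul_inv_cancel h0 ENNReal.ofReal_ne_top,
      one_mul]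
  · rw [indicator_of_notMem h1]
    by_cases h2 : θ ∈ Ioo 0 Real.pi
    · rw [indicator_of_mem h2]
      have hc : Real.cos θ ≤ 0 := by
        refine Real.cos_nonpos_of_pi_div_two_le_of_le ?_ (by linarith [h2.2, Real.pi_pos])
        by_contra! h
        exact h1 ⟨h2.1, h⟩
      simp [cosDensity, hc]
    · rw [indicator_of_notMem h2]

theorem lintegral_Ioi_scale {c : ℝ} (hc : 0 < c) (F : ℝ → ℝ≥0∞) (hF : Measurable F) :
    ∫⁻ r in Ioi (0 : ℝ), F r = ENNReal.ofReal c⁻¹ * ∫⁻ s in Ioi (0 : ℝ), F (s / c) := by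
  rw [← lintegral_indicator measurableSet_Ioi, ← lintegral_indicator measurableSet_Ioi]
  have hG : Measurable ((Ioi (0 : ℝ)).indicator F) := hF.indicator measurableSet_Ioi
  conv_lhs => rw [← Real.smul_map_volume_mul_left (inv_ne_zero hc.ne')]
  rw [lintegral_smul_measure, lintegral_map hG (by fun_prop), abs_of_pos (inv_pos.2 hc),
    smul_eq_mul]
  congr 1
  refine lintegral_congr fun s => ?_
  have hci : 0 < c⁻¹ := inv_pos.2 hc
  by_cases h : 0 < s
  · rw [indicator_of_mem (show s ∈ Ioi 0 from h),
      indicator_of_mem (show c⁻¹ * s ∈ Ioi 0 from mul_pos hci h)]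
    congr 1; ring
  · rw [indicator_of_notMem (show s ∉ Ioi 0 from h), indicator_of_notMem]
    simp only [mem_Ioi, not_lt] at h ⊢
    exact mul_nonpos_of_nonneg_of_nonpos hci.le h

/-- The change of variables from the relative velocity `V` to the transferred velocity `v`, where
`v` has length `|V| cos θ` and makes the angle `θ` with `V`. -/
theorem lintegral_collision_swap {b : ℝ → ℝ≥0∞} (hb : Measurable b) {f₁ f₂ g₁ g₂ : Vel → Vel}
    (hf : ∀ᵐ V : Vel, Orthonormal ℝ ![‖V‖⁻¹ • V, f₁ V, f₂ V])
    (hg : ∀ᵐ V : Vel, Orthonormal ℝ ![‖V‖⁻¹ • V, g₁ V, g₂ V])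
    (H : Vel × Vel → ℝ≥0∞) (hH : Measurable H) :
    ∫⁻ V : Vel, ∫⁻ θ in Ioo 0 (Real.pi / 2), ∫⁻ ε in Ioo (-Real.pi) Real.pi,
      b θ * H (V, (‖V‖ * Real.cos θ) • frameDir (‖V‖⁻¹ • V) (f₁ V) (f₂ V) θ ε) =
    ∫⁻ v : Vel, ∫⁻ θ in Ioo 0 (Real.pi / 2), ∫⁻ ε in Ioo (-Real.pi) Real.pi,
      b θ * (ENNReal.ofReal ((Real.cos θ ^ 3)⁻¹) *
        H ((‖v‖ / Real.cos θ) • frameDir (‖v‖⁻¹ • v) (g₁ v) (g₂ v) θ ε, v)) := by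
  have hcd := measurable_cosDensity hb
  have h1 : ∀ᵐ V : Vel, ∫⁻ θ in Ioo 0 (Real.pi / 2), ∫⁻ ε in Ioo (-Real.pi) Real.pi,
      b θ * H (V, (‖V‖ * Real.cos θ) • frameDir (‖V‖⁻¹ • V) (f₁ V) (f₂ V) θ ε) =
      ∫⁻ σ, cosDensity b (inner ℝ σ (‖V‖⁻¹ • V)) *
        H (V, (‖V‖ * inner ℝ σ (‖V‖⁻¹ • V)) • σ) ∂sphereMeasure := by
    filter_upwards [hf] with V hV
    rw [lintegral_cosDensity hb hV (fun σ => H (V, (‖V‖ * inner ℝ σ (‖V‖⁻¹ • V)) • σ))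
      (by fun_prop)]
    simp_rw [inner_frameDir hV]
  have h2 : ∀ᵐ v : Vel, ∫⁻ θ in Ioo 0 (Real.pi / 2), ∫⁻ ε in Ioo (-Real.pi) Real.pi,
      b θ * (ENNReal.ofReal ((Real.cos θ ^ 3)⁻¹) *
        H ((‖v‖ / Real.cos θ) • frameDir (‖v‖⁻¹ • v) (g₁ v) (g₂ v) θ ε, v)) =
      ∫⁻ ω, cosDensity b (inner ℝ ω (‖v‖⁻¹ • v)) *
        (ENNReal.ofReal ((inner ℝ ω (‖v‖⁻¹ • v) ^ 3)⁻¹) *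
          H ((‖v‖ / inner ℝ ω (‖v‖⁻¹ • v)) • ω, v)) ∂sphereMeasure := by
    filter_upwards [hg] with v hv
    rw [lintegral_cosDensity hb hv (fun ω => ENNReal.ofReal ((inner ℝ ω (‖v‖⁻¹ • v) ^ 3)⁻¹) *
          H ((‖v‖ / inner ℝ ω (‖v‖⁻¹ • v)) • ω, v)) (by fun_prop)]
    simp_rw [inner_frameDir hv]
  have hnorm : ∀ r ∈ Ioi (0 : ℝ), ∀ ω : Vel, ‖ω‖ = 1 → ‖r • ω‖ = r ∧ ‖r • ω‖⁻¹ • (r • ω) = ω := by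
    intro r hr ω hω
    have hr : 0 < r := hr
    have : ‖r • ω‖ = r := by rw [norm_smul, hω, mul_one, Real.norm_of_nonneg hr.le]
    refine ⟨this, ?_⟩
    rw [this, smul_smul, inv_mul_cancel₀ hr.ne', one_smul]
  rw [lintegral_congr_ae h1, lintegral_congr_ae h2, lintegral_sphere_radius, lintegral_sphere_radius]
  rotate_left
  · refine Measurable.lintegral_prod_right' (f := fun x : Vel × Vel =>
      cosDensity b (inner ℝ x.2 (‖x.1‖⁻¹ • x.1)) *
        (ENNReal.ofReal ((inner ℝ x.2 (‖x.1‖⁻¹ • x.1) ^ 3)⁻¹) *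
          H ((‖x.1‖ / inner ℝ x.2 (‖x.1‖⁻¹ • x.1)) • x.2, x.1))) ?_
    fun_prop
  · refine Measurable.lintegral_prod_right' (f := fun x : Vel × Vel =>
      cosDensity b (inner ℝ x.2 (‖x.1‖⁻¹ • x.1)) *
        H (x.1, (‖x.1‖ * inner ℝ x.2 (‖x.1‖⁻¹ • x.1)) • x.2)) ?_
    fun_prop
  have h3 : ∀ᵐ ω ∂sphereMeasure, ∫⁻ r in Ioi (0 : ℝ), ENNReal.ofReal (r ^ 2) *
      ∫⁻ σ, cosDensity b (inner ℝ σ (‖r • ω‖⁻¹ • (r • ω))) *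
        H (r • ω, (‖r • ω‖ * inner ℝ σ (‖r • ω‖⁻¹ • (r • ω))) • σ) ∂sphereMeasure =
      ∫⁻ σ, cosDensity b (inner ℝ σ ω) * (∫⁻ r in Ioi (0 : ℝ), ENNReal.ofReal (r ^ 2) *
        H (r • ω, (r * inner ℝ σ ω) • σ)) ∂sphereMeasure := by
    filter_upwards [ae_norm_sphereMeasure] with ω hω
    have : ∀ r ∈ Ioi (0 : ℝ), ENNReal.ofReal (r ^ 2) *
      ∫⁻ σ, cosDensity b (inner ℝ σ (‖r • ω‖⁻¹ • (r • ω))) *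
        H (r • ω, (‖r • ω‖ * inner ℝ σ (‖r • ω‖⁻¹ • (r • ω))) • σ) ∂sphereMeasure =
      ∫⁻ σ, cosDensity b (inner ℝ σ ω) * (ENNReal.ofReal (r ^ 2) *
        H (r • ω, (r * inner ℝ σ ω) • σ)) ∂sphereMeasure := by
      intro r hr
      rw [(hnorm r hr ω hω).2, (hnorm r hr ω hω).1, ← lintegral_const_mul _ (by fun_prop)]
      refine lintegral_congr fun σ => ?_
      ring
    rw [setLIntegral_congr_fun measurableSet_Ioi this, lintegral_lintegral_swap]
    · refine lintegral_congr fun σ => ?_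
      rw [lintegral_const_mul _ (by fun_prop)]
    · simp only [Function.uncurry_def]
      fun_prop
  have h4 : ∀ᵐ σ ∂sphereMeasure, ∫⁻ s in Ioi (0 : ℝ), ENNReal.ofReal (s ^ 2) *
      ∫⁻ ω, cosDensity b (inner ℝ ω (‖s • σ‖⁻¹ • (s • σ))) *
        (ENNReal.ofReal ((inner ℝ ω (‖s • σ‖⁻¹ • (s • σ)) ^ 3)⁻¹) *
          H ((‖s • σ‖ / inner ℝ ω (‖s • σ‖⁻¹ • (s • σ))) • ω, s • σ)) ∂sphereMeasure =
      ∫⁻ ω, cosDensity b (inner ℝ ω σ) * (∫⁻ s in Ioi (0 : ℝ), ENNReal.ofReal (s ^ 2) *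
        (ENNReal.ofReal ((inner ℝ ω σ ^ 3)⁻¹) *
          H ((s / inner ℝ ω σ) • ω, s • σ))) ∂sphereMeasure := by
    filter_upwards [ae_norm_sphereMeasure] with σ hσ
    have : ∀ s ∈ Ioi (0 : ℝ), ENNReal.ofReal (s ^ 2) *
      ∫⁻ ω, cosDensity b (inner ℝ ω (‖s • σ‖⁻¹ • (s • σ))) *
        (ENNReal.ofReal ((inner ℝ ω (‖s • σ‖⁻¹ • (s • σ)) ^ 3)⁻¹) *
          H ((‖s • σ‖ / inner ℝ ω (‖s • σ‖⁻¹ • (s • σ))) • ω, s • σ)) ∂sphereMeasure =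
      ∫⁻ ω, cosDensity b (inner ℝ ω σ) * (ENNReal.ofReal (s ^ 2) *
        (ENNReal.ofReal ((inner ℝ ω σ ^ 3)⁻¹) *
          H ((s / inner ℝ ω σ) • ω, s • σ))) ∂sphereMeasure := by
      intro s hs
      rw [(hnorm s hs σ hσ).2, (hnorm s hs σ hσ).1, ← lintegral_const_mul _ (by fun_prop)]
      refine lintegral_congr fun ω => ?_
      ring
    rw [setLIntegral_congr_fun measurableSet_Ioi this, lintegral_lintegral_swap]
    · refine lintegral_congr fun ω => ?_
      rw [lintegral_const_mul _ (by fun_prop)]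
    · simp only [Function.uncurry_def]
      fun_prop
  -- Both sides are now integrals over the directions ω of V and σ of v, with a density in the inner
  -- product of ω and σ. For fixed directions only the radius changes: |V| = s/c with c = cos θ, so
  -- r² dr becomes s² ds / c³, which is the Jacobian in the statement.
  rw [lintegral_congr_ae h3, lintegral_congr_ae h4, lintegral_lintegral_swap]
  · refine lintegral_congr fun σ => lintegral_congr fun ω => ?_
    rw [real_inner_comm ω σ]
    by_cases hc : 0 < inner ℝ ω σ
    · congr 1
      rw [lintegral_Ioi_scale hc _ (by fun_prop), ← lintegral_const_mul _ (by fun_prop)]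
      refine setLIntegral_congr_fun measurableSet_Ioi fun s hs => ?_
      rw [div_mul_cancel₀ _ hc.ne', ← mul_assoc, ← mul_assoc, ← ENNReal.ofReal_mul (by positivity),
        ← ENNReal.ofReal_mul (by positivity)]
      congr 2
      field_simp
    · simp [cosDensity, hc]
  · refine Measurable.aemeasurable ?_
    simp only [Function.uncurry_def]
    refine Measurable.mul (by fun_prop) ?_
    refine Measurable.lintegral_prod_right' (f := fun x : (Vel × Vel) × ℝ =>
      ENNReal.ofReal (x.2 ^ 2) * H (x.2 • x.1.1, (x.2 * inner ℝ x.1.2 x.1.1) • x.1.2)) ?_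
    fun_prop

/-! ### Elementary inequalities -/

/-- The derivative is bounded by 1, because 2|x| ≤ 1 + x² ≤ e^{x²}. -/
theorem abs_exp_neg_sq_sub_le (a b : ℝ) :
    |Real.exp (-a ^ 2) - Real.exp (-b ^ 2)| ≤ |a - b| := by
  have h := Convex.norm_image_sub_le_of_norm_hasDerivWithin_le (f := fun x : ℝ => Real.exp (-x ^ 2))
    (f' := fun x => Real.exp (-x ^ 2) * (-(2 * x))) (s := univ) (x := b) (y := a) (C := 1)
    (fun x _ => by
      have : HasDerivAt (fun x : ℝ => -x ^ 2) (-(2 * x)) x := by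
        have h := (hasDerivAt_pow 2 x).fun_neg
        simpa using h
      exact this.exp.hasDerivWithinAt) (fun x _ => by
      rw [norm_mul, Real.norm_of_nonneg (Real.exp_pos _).le, Real.norm_eq_abs, abs_neg, abs_mul,
        abs_two, Real.exp_neg, inv_mul_le_iff₀ (Real.exp_pos _), mul_one]
      have h1 := Real.add_one_le_exp (x ^ 2)
      nlinarith [sq_nonneg (|x| - 1), sq_abs x]) convex_univ (mem_univ _) (mem_univ _)
  simpa using h

/-- Interpolation: x = x^δ x^{1-δ}. For M ≤ 1 and δ ≤ 1/4 the exponent 1 - δ may be lowered to 3/4,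
which keeps the rate of Gaussian decay independent of δ. -/
theorem le_rpow_mul_rpow_of_le {x D M δ : ℝ} (hx : 0 ≤ x) (hD : x ≤ D) (hM : x ≤ M) (hM1 : M ≤ 1)
    (hδ : 0 ≤ δ) (hδ4 : δ ≤ 1 / 4) : x ≤ D ^ δ * M ^ (3 / 4 : ℝ) := by
  rcases hx.eq_or_lt with rfl | hx
  · have := Real.rpow_nonneg hD δ
    have := Real.rpow_nonneg hM (3 / 4)
    positivity
  · have h1 : x = x ^ δ * x ^ (1 - δ) := by rw [← Real.rpow_add hx]; simp
    have h2 : x ^ (1 - δ) ≤ M ^ (3 / 4 : ℝ) :=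
      (Real.rpow_le_rpow hx.le hM (by linarith)).trans
        (Real.rpow_le_rpow_of_exponent_ge (hx.trans_le hM) hM1 (by linarith))
    have h3 : 0 ≤ D := hx.le.trans hD
    calc x = x ^ δ * x ^ (1 - δ) := h1
      _ ≤ _ := by gcongr

/-- Subadditivity of the power γ ≤ 1 bounds the difference by (r - s)^γ, and this splits into the
powers δ and γ - δ of r - s. -/
theorem rpow_sub_rpow_le {r s γ δ t : ℝ} (hs : 0 ≤ s) (hsr : s ≤ r) (ht : r - s ≤ t)
    (hδ : 0 < δ) (hδγ : δ ≤ γ) (hγ : γ ≤ 1) : r ^ γ - s ^ γ ≤ t ^ δ * r ^ (γ - δ) := by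
  have h1 : r ^ γ ≤ (r - s) ^ γ + s ^ γ := by
    have := Real.rpow_add_le_add_rpow (sub_nonneg.2 hsr) hs (hδ.le.trans hδγ) hγ
    simpa using this
  rcases hsr.eq_or_lt with rfl | hlt
  · have := Real.rpow_nonneg (by simpa using ht : 0 ≤ t) δ
    have := Real.rpow_nonneg hs (γ - δ)
    simp; positivity
  · have hp : 0 < r - s := sub_pos.2 hlt
    have h2 : (r - s) ^ γ = (r - s) ^ δ * (r - s) ^ (γ - δ) := by
      rw [← Real.rpow_add hp]; congr 1; ring
    have h3 : (r - s) ^ δ * (r - s) ^ (γ - δ) ≤ t ^ δ * r ^ (γ - δ) := by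
      have : 0 ≤ γ - δ := by linarith
      have : 0 ≤ t := hp.le.trans ht
      gcongr
      linarith
    linarith

theorem exists_rpow_mul_exp_le (a : ℝ) (ha : 0 ≤ a) {κ : ℝ} (hκ : 0 < κ) :
    ∃ C : ℝ, 0 < C ∧ ∀ R : ℝ, 0 ≤ R → R ^ a * Real.exp (-(κ * R ^ 2)) ≤ C := by
  obtain ⟨n, hn⟩ := exists_nat_ge a
  -- The constant comes from y^n / n! ≤ e^y at y = κ(1 + R²); the summand 1 makes the base at least
  -- 1, so that the real exponent can be raised to an integer.
  refine ⟨(κ⁻¹) ^ n * n.factorial * Real.exp κ, by positivity, fun R hR => ?_⟩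
  have h1 : R ^ a ≤ (1 + R ^ 2) ^ n := by
    have h0 : R ≤ 1 + R ^ 2 := by nlinarith [sq_nonneg (R - 1)]
    calc R ^ a ≤ (1 + R ^ 2) ^ a := Real.rpow_le_rpow hR h0 ha
      _ ≤ (1 + R ^ 2) ^ (n : ℝ) := Real.rpow_le_rpow_of_exponent_le (by nlinarith) hn
      _ = _ := Real.rpow_natCast _ _
  have h2 := Real.pow_div_factorial_le_exp (κ * (1 + R ^ 2)) (by positivity) n
  rw [div_le_iff₀ (by positivity), mul_pow] at h2
  have h3 : (1 + R ^ 2) ^ n ≤ (κ⁻¹) ^ n * n.factorial * Real.exp (κ * (1 + R ^ 2)) := by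
    rw [inv_pow, mul_assoc, inv_mul_eq_div, le_div_iff₀ (by positivity)]
    linarith
  calc R ^ a * Real.exp (-(κ * R ^ 2))
      ≤ ((κ⁻¹) ^ n * n.factorial * Real.exp (κ * (1 + R ^ 2))) * Real.exp (-(κ * R ^ 2)) := by
        gcongr; exact h1.trans h3
    _ = _ := by
        rw [mul_assoc, ← Real.exp_add]
        congr 2; ring

/-! ### The transferred velocity as a variable -/

/-- The unit vector orthogonal to `v` and to the first coordinate axis. -/
noncomputable def axisFrame₁ (v : Vel) : Vel := (√(v 1 ^ 2 + v 2 ^ 2))⁻¹ • !₂[0, -v 2, v 1]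

/-- The cross product of `v` and `axisFrame₁ v`. -/
noncomputable def axisNormal (v : Vel) : Vel :=
  !₂[√(v 1 ^ 2 + v 2 ^ 2), -(v 0 * v 1 * (√(v 1 ^ 2 + v 2 ^ 2))⁻¹),
    -(v 0 * v 2 * (√(v 1 ^ 2 + v 2 ^ 2))⁻¹)]

/-- The relative velocity `V` whose component along `v` is `v` and which makes the angle `θ` with
`v`; `ε` is the azimuth. -/
noncomputable def relVel (v : Vel) (θ ε : ℝ) : Vel :=
  v + Real.tan θ • ((‖v‖ * Real.cos ε) • axisFrame₁ v + Real.sin ε • axisNormal v)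

theorem norm_sq_vel (v : Vel) : ‖v‖ ^ 2 = v 0 ^ 2 + v 1 ^ 2 + v 2 ^ 2 := by
  rw [EuclideanSpace.norm_sq_eq]
  simp [Fin.sum_univ_three]

theorem inner_vel (v w : Vel) : inner ℝ v w = v 0 * w 0 + v 1 * w 1 + v 2 * w 2 := by
  rw [PiLp.inner_apply]
  simp [Fin.sum_univ_three]
  ring

theorem orthonormal_of_coords {a b c : Vel} (haa : inner ℝ a a = (1 : ℝ))
    (hbb : inner ℝ b b = (1 : ℝ)) (hcc : inner ℝ c c = (1 : ℝ)) (hab : inner ℝ a b = (0 : ℝ))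
    (hac : inner ℝ a c = (0 : ℝ)) (hbc : inner ℝ b c = (0 : ℝ)) : Orthonormal ℝ ![a, b, c] := by
  rw [orthonormal_iff_ite]
  have hba : inner ℝ b a = (0 : ℝ) := by rw [real_inner_comm, hab]
  have hca : inner ℝ c a = (0 : ℝ) := by rw [real_inner_comm, hac]
  have hcb : inner ℝ c b = (0 : ℝ) := by rw [real_inner_comm, hbc]
  intro i j
  fin_cases i <;> fin_cases j <;> first | simpa using haa | simpa using hbb | simpa using hcc | simpa

theorem ae_axis_ne_zero : ∀ᵐ v : Vel, 0 < v 1 ^ 2 + v 2 ^ 2 := by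
  have h : ∀ᵐ y : ℝ × ℝ × ℝ, y.2.1 ≠ 0 := by
    have h1 : ∀ᵐ a : ℝ, a ≠ 0 := by simp [ae_iff]
    have h2 : ∀ᵐ a : ℝ × ℝ, a.1 ≠ 0 :=
      Measure.quasiMeasurePreserving_fst.ae h1
    exact Measure.quasiMeasurePreserving_snd.ae h2
  have := measurePreserving_velCoord.quasiMeasurePreserving.ae h
  filter_upwards [this] with v hv
  simp only [velCoord_apply] at hv
  positivity

theorem orthonormal_axisFrame {v : Vel} (hv : 0 < v 1 ^ 2 + v 2 ^ 2) :
    Orthonormal ℝ ![‖v‖⁻¹ • v, axisFrame₁ v, ‖v‖⁻¹ • axisNormal v] := by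
  have hn := norm_sq_vel v
  have hρ : √(v 1 ^ 2 + v 2 ^ 2) ^ 2 = v 1 ^ 2 + v 2 ^ 2 := Real.sq_sqrt hv.le
  have hρ0 : 0 < √(v 1 ^ 2 + v 2 ^ 2) := Real.sqrt_pos.2 hv
  have hn0 : 0 < ‖v‖ := by
    rw [norm_pos_iff]; rintro rfl; simp at hv
  refine orthonormal_of_coords ?_ ?_ ?_ ?_ ?_ ?_
  all_goals
    simp only [inner_smul_left, inner_smul_right, inner_vel, axisFrame₁, axisNormal]
    simp
  all_goals
    set ρ := √(v 1 ^ 2 + v 2 ^ 2)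
    set n := ‖v‖
    try field_simp
  · linear_combination -hn
  · linear_combination -hρ
  · linear_combination -ρ ^ 2 * hn + (ρ ^ 2 - v 0 ^ 2) * hρ
  · right; right; ring
  · right; linear_combination v 0 * hρ
  · right; right; ring

theorem norm_axisFrame₁_le (v : Vel) : ‖axisFrame₁ v‖ ≤ 1 := by
  have h : ‖axisFrame₁ v‖ ^ 2 ≤ 1 := by
    rw [norm_sq_vel]
    simp [axisFrame₁, mul_pow]
    rw [Real.sq_sqrt (by positivity), ← mul_add, add_comm (v 2 ^ 2)]
    exact inv_mul_le_one
  nlinarith [norm_nonneg (axisFrame₁ v)]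

/-- For fixed `v 1`, `v 2` the vector is affine in `v 0` with slope of norm at most 1. Hence it is
Lipschitz along the first axis, uniformly in the distance of `v` from that axis. -/
theorem norm_axisNormal_sub_le (v : Vel) (t : ℝ) :
    ‖axisNormal (v - t • EuclideanSpace.single 0 1) - axisNormal v‖ ≤ |t| := by
  have h : ‖axisNormal (v - t • EuclideanSpace.single 0 1) - axisNormal v‖ ^ 2 ≤ |t| ^ 2 := by
    rw [norm_sq_vel, sq_abs]
    simp [axisNormal]
    have h1 : (√(v 1 ^ 2 + v 2 ^ 2))⁻¹ ^ 2 * (v 1 ^ 2 + v 2 ^ 2) ≤ 1 := by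
      rw [inv_pow, Real.sq_sqrt (by positivity)]
      exact inv_mul_le_one
    nlinarith [mul_le_mul_of_nonneg_left h1 (sq_nonneg t)]
  exact (le_abs_self _).trans (abs_le_of_sq_le_sq h (abs_nonneg t))

/-- The vector does not involve `v 0`. This invariance is the reason for a frame adapted to the
first axis. -/
theorem axisFrame₁_sub (v : Vel) (t : ℝ) :
    axisFrame₁ (v - t • EuclideanSpace.single 0 1) = axisFrame₁ v := by
  simp [axisFrame₁]

theorem relVel_eq {v : Vel} (hv : 0 < v 1 ^ 2 + v 2 ^ 2) {θ : ℝ} (hθ : 0 < Real.cos θ) (ε : ℝ) :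
    (‖v‖ / Real.cos θ) • frameDir (‖v‖⁻¹ • v) (axisFrame₁ v) (‖v‖⁻¹ • axisNormal v) θ ε =
      relVel v θ ε := by
  have hn0 : ‖v‖ ≠ 0 := by
    rw [norm_ne_zero_iff]; rintro rfl; simp at hv
  simp only [frameDir, relVel, smul_add, smul_smul, Real.tan_eq_sin_div_cos]
  congr 1
  · rw [show ‖v‖ / Real.cos θ * (Real.cos θ * ‖v‖⁻¹) = 1 by field_simp, one_smul]
  · congr 2 <;> field_simp

theorem norm_relVel {v : Vel} (hv : 0 < v 1 ^ 2 + v 2 ^ 2) {θ : ℝ} (hθ : 0 < Real.cos θ) (ε : ℝ) :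
    ‖relVel v θ ε‖ = ‖v‖ / Real.cos θ := by
  rw [← relVel_eq hv hθ, norm_smul, norm_frameDir (orthonormal_axisFrame hv), mul_one,
    Real.norm_of_nonneg (by positivity)]

/-- Of the part of V orthogonal to v, only ‖v‖ and `axisNormal v` vary. Each moves by at most t and
is multiplied by tan θ. -/
theorem norm_relVel_sub_le (v : Vel) {t θ : ℝ} (ht : 0 ≤ t) (hθ : 0 ≤ Real.tan θ) (ε : ℝ) :
    ‖(relVel (v - t • EuclideanSpace.single 0 1) θ ε - (v - t • EuclideanSpace.single 0 1)) -
      (relVel v θ ε - v)‖ ≤ 2 * t * Real.tan θ := by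
  set v' := v - t • (EuclideanSpace.single 0 1 : Vel) with hv'
  have h1 : (relVel v' θ ε - v') - (relVel v θ ε - v) = Real.tan θ •
      (((‖v'‖ - ‖v‖) * Real.cos ε) • axisFrame₁ v +
        Real.sin ε • (axisNormal v' - axisNormal v)) := by
    simp only [relVel, add_sub_cancel_left]
    rw [hv', axisFrame₁_sub, ← smul_sub]
    congr 1
    module
  have h2 : |‖v'‖ - ‖v‖| ≤ t := by
    refine (abs_norm_sub_norm_le _ _).trans ?_
    simp [hv', norm_smul, abs_of_nonneg ht]
  have h3 := norm_axisNormal_sub_le v t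
  rw [abs_of_nonneg ht, ← hv'] at h3
  have h4 := norm_axisFrame₁_le v
  have h5 := Real.abs_cos_le_one ε
  have h6 := Real.abs_sin_le_one ε
  rw [h1, norm_smul, Real.norm_of_nonneg hθ]
  have h7 : ‖((‖v'‖ - ‖v‖) * Real.cos ε) • axisFrame₁ v +
        Real.sin ε • (axisNormal v' - axisNormal v)‖ ≤ t * 1 * 1 + 1 * t := by
    refine (norm_add_le _ _).trans ?_
    rw [norm_smul, norm_smul, norm_mul, Real.norm_eq_abs, Real.norm_eq_abs, Real.norm_eq_abs]
    gcongr
  nlinarith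

/-! ### Pointwise bounds for the gain kernel -/

/-- The Gaussian `(w(ξ + V - v) w(ξ + V)) ^ (1/2)`, without the normalizing constant. -/
noncomputable def gainGauss (ξ V v : Vel) : ℝ :=
  Real.exp (-(‖ξ + V - (1 / 2 : ℝ) • v‖ ^ 2 + (‖v‖ / 2) ^ 2))

/-- The weight with which `f(ξ + v)` enters the gain term. -/
noncomputable def gainWeight (γ : ℝ) (ξ V v : Vel) : ℝ :=
  ‖V‖ ^ γ * ((√Real.pi ^ 3)⁻¹ * gainGauss ξ V v)

/-- The density of the gain term in the variables `(v, θ, ε)`. -/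
noncomputable def gainKernel (γ : ℝ) (B : ℝ → ℝ) (ξ v : Vel) (θ ε : ℝ) : ℝ :=
  B θ * ((Real.cos θ ^ 3)⁻¹ * gainWeight γ ξ (relVel v θ ε) v)

/-- The majorant of the gain kernel in the variable `v`. -/
noncomputable def gainMajorant (δ : ℝ) (v : Vel) : ℝ :=
  ‖v‖ ^ (-(1 + 2 * δ)) * Real.exp (-(‖v‖ ^ 2 / 8))

theorem gainGauss_pos (ξ V v : Vel) : 0 < gainGauss ξ V v := Real.exp_pos _

theorem gainGauss_le_one (ξ V v : Vel) : gainGauss ξ V v ≤ 1 := by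
  rw [gainGauss, Real.exp_le_one_iff]
  have := sq_nonneg ‖ξ + V - (1 / 2 : ℝ) • v‖
  have := sq_nonneg (‖v‖ / 2)
  linarith

/-- With A = ξ + V - v/2 one has V = A + v/2 - ξ, so |V|² ≤ 3(|A|² + |v/2|² + |ξ|²). A sixteenth of
the exponent |A|² + |v/2|², together with |ξ|²/16, therefore gives |V|²/48, and the remaining 11/16
of |v|²/4 still exceed |v|²/8. The loss e^{|ξ|²/16} is harmless against the weights used at the end.
-/
theorem gainGauss_rpow_le (ξ V v : Vel) :
    gainGauss ξ V v ^ (3 / 4 : ℝ) ≤ Real.exp (-(1 / 48 * ‖V‖ ^ 2)) *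
      (Real.exp (‖ξ‖ ^ 2 / 16) * Real.exp (-(‖v‖ ^ 2 / 8))) := by
  rw [gainGauss, ← Real.exp_mul, ← Real.exp_add, ← Real.exp_add, Real.exp_le_exp]
  set A := ξ + V - (1 / 2 : ℝ) • v with hA
  have h1 : V = A + (1 / 2 : ℝ) • v - ξ := by rw [hA]; module
  have h2 : ‖V‖ ≤ ‖A‖ + ‖v‖ / 2 + ‖ξ‖ := by
    calc ‖V‖ = ‖A + (1 / 2 : ℝ) • v - ξ‖ := congrArg norm h1
      _ ≤ ‖A‖ + ‖(1 / 2 : ℝ) • v‖ + ‖ξ‖ := (norm_sub_le _ _).trans (by gcongr; exact norm_add_le _ _)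
      _ = _ := by rw [norm_smul]; norm_num; ring
  have h3 : ‖V‖ ^ 2 ≤ (‖A‖ + ‖v‖ / 2 + ‖ξ‖) ^ 2 := by gcongr
  nlinarith [sq_nonneg (‖A‖ - ‖v‖ / 2), sq_nonneg (‖A‖ - ‖ξ‖), sq_nonneg (‖v‖ / 2 - ‖ξ‖),
    sq_nonneg ‖A‖]

/-- The Lipschitz bound by D is interpolated with the trivial bound by the larger of the two values.
A Hölder power of D is thus gained while three quarters of the Gaussian decay survive. -/
theorem abs_gainGauss_sub_le {ξ V v ξ' V' v' : Vel} {D δ : ℝ} (hδ : 0 ≤ δ) (hδ4 : δ ≤ 1 / 4)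
    (hD : ‖(ξ' + V' - (1 / 2 : ℝ) • v') - (ξ + V - (1 / 2 : ℝ) • v)‖ + ‖v' - v‖ / 2 ≤ D) :
    |gainGauss ξ' V' v' - gainGauss ξ V v| ≤
      D ^ δ * (gainGauss ξ V v ^ (3 / 4 : ℝ) + gainGauss ξ' V' v' ^ (3 / 4 : ℝ)) := by
  have hG := gainGauss_pos ξ V v
  have hG' := gainGauss_pos ξ' V' v'
  have hG1 := gainGauss_le_one ξ V v
  have hG1' := gainGauss_le_one ξ' V' v'
  have h1 : |gainGauss ξ' V' v' - gainGauss ξ V v| ≤ D := by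
    simp only [gainGauss, neg_add, Real.exp_add]
    set A := ξ + V - (1 / 2 : ℝ) • v
    set A' := ξ' + V' - (1 / 2 : ℝ) • v'
    have e1 := abs_exp_neg_sq_sub_le ‖A'‖ ‖A‖
    have e2 := abs_exp_neg_sq_sub_le (‖v'‖ / 2) (‖v‖ / 2)
    have e3 := abs_norm_sub_norm_le A' A
    have e4 := abs_norm_sub_norm_le v' v
    have e5 : |‖v'‖ / 2 - ‖v‖ / 2| ≤ ‖v' - v‖ / 2 := by
      rw [← sub_div, abs_div, abs_two]; gcongr
    have b1 : |Real.exp (-(‖v'‖ / 2) ^ 2)| ≤ 1 := by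
      rw [abs_of_pos (Real.exp_pos _), Real.exp_le_one_iff]; nlinarith [sq_nonneg (‖v'‖ / 2)]
    have b2 : |Real.exp (-‖A‖ ^ 2)| ≤ 1 := by
      rw [abs_of_pos (Real.exp_pos _), Real.exp_le_one_iff]; nlinarith [sq_nonneg ‖A‖]
    have : Real.exp (-‖A'‖ ^ 2) * Real.exp (-(‖v'‖ / 2) ^ 2) -
        Real.exp (-‖A‖ ^ 2) * Real.exp (-(‖v‖ / 2) ^ 2) =
        (Real.exp (-‖A'‖ ^ 2) - Real.exp (-‖A‖ ^ 2)) * Real.exp (-(‖v'‖ / 2) ^ 2) +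
        Real.exp (-‖A‖ ^ 2) * (Real.exp (-(‖v'‖ / 2) ^ 2) - Real.exp (-(‖v‖ / 2) ^ 2)) := by ring
    rw [this]
    refine (abs_add_le _ _).trans ?_
    rw [abs_mul, abs_mul]
    calc _ ≤ ‖A' - A‖ * 1 + 1 * (‖v' - v‖ / 2) := by
          gcongr
          · exact e1.trans e3
          · exact e2.trans e5
      _ ≤ D := by linarith
  have h2 : |gainGauss ξ' V' v' - gainGauss ξ V v| ≤ max (gainGauss ξ V v) (gainGauss ξ' V' v') := by
    rw [abs_le]
    have := le_max_left (gainGauss ξ V v) (gainGauss ξ' V' v')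
    have := le_max_right (gainGauss ξ V v) (gainGauss ξ' V' v')
    constructor <;> linarith
  refine (le_rpow_mul_rpow_of_le (abs_nonneg _) h1 h2 (max_le hG1 hG1') hδ hδ4).trans ?_
  have hD0 : 0 ≤ D := (abs_nonneg _).trans h1
  gcongr
  have p1 := Real.rpow_nonneg hG.le (3 / 4)
  have p2 := Real.rpow_nonneg hG'.le (3 / 4)
  rcases max_choice (gainGauss ξ V v) (gainGauss ξ' V' v') with h | h <;> rw [h] <;> linarith

/-- The bound for the Hölder quotient of the weight. -/
noncomputable def holderBound (γ δ : ℝ) (ξ V v : Vel) : ℝ :=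
  ‖V‖ ^ γ * ‖v‖ ^ (-δ) * (1 + 3 * ‖V‖ ^ δ) * gainGauss ξ V v ^ (3 / 4 : ℝ)

theorem one_add_two_mul_tan_le {θ : ℝ} (hc : 0 < Real.cos θ) :
    1 + 2 * Real.tan θ ≤ 3 / Real.cos θ := by
  rw [Real.tan_eq_sin_div_cos, le_div_iff₀ hc]
  have : (1 + 2 * (Real.sin θ / Real.cos θ)) * Real.cos θ = Real.cos θ + 2 * Real.sin θ := by
    field_simp
  rw [this]
  linarith [Real.cos_le_one θ, Real.sin_le_one θ]

/-- The scalar core of the Hölder estimate, with r, r' the lengths of the transferred velocities, c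
= cos θ and g, g' the Gaussians. The difference splits as (r^γ - r'^γ) g + r'^γ (g - g'). The first
summand gives t^δ r^{γ-δ}; in the second, T^δ ≤ 3 c^{-δ} is the cost of the factor tan θ. -/
theorem abs_weight_sub_le_aux {γ δ t c r r' g g' T : ℝ} (hc : 0 < c) (hr : 0 < r) (hr' : 0 < r')
    (hle : r' ≤ r) (ht : 0 ≤ t) (hsub : r - r' ≤ t) (hδ : 0 < δ) (hδ1 : δ ≤ 1) (hδγ : δ ≤ γ)
    (hγ : γ ≤ 1)
    (hg : 0 ≤ g) (hg1 : g ≤ 1) (hg' : 0 ≤ g') (hT : 0 ≤ T) (hTc : T ≤ 3 / c)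
    (h : |g - g'| ≤ (t * T) ^ δ * (g ^ (3 / 4 : ℝ) + g' ^ (3 / 4 : ℝ))) :
    |(r / c) ^ γ * g - (r' / c) ^ γ * g'| ≤
      t ^ δ * ((r / c) ^ γ * r ^ (-δ) * (1 + 3 * (r / c) ^ δ) * g ^ (3 / 4 : ℝ) +
        (r' / c) ^ γ * r' ^ (-δ) * (1 + 3 * (r' / c) ^ δ) * g' ^ (3 / 4 : ℝ)) := by
  have hγ0 : 0 < γ := hδ.trans_le hδγ
  set G := g ^ (3 / 4 : ℝ)
  set G' := g' ^ (3 / 4 : ℝ)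
  have hG : 0 ≤ G := Real.rpow_nonneg hg _
  have hG' : 0 ≤ G' := Real.rpow_nonneg hg' _
  have hgG : g ≤ G := by
    have := Real.rpow_le_rpow_of_exponent_ge' hg hg1 (by norm_num) (by norm_num : (3 / 4 : ℝ) ≤ 1)
    simpa using this
  have hT3 : T ^ δ ≤ 3 * c ^ (-δ) := by
    calc T ^ δ ≤ (3 / c) ^ δ := Real.rpow_le_rpow hT hTc hδ.le
      _ = 3 ^ δ * c ^ (-δ) := by
        rw [Real.div_rpow (by norm_num) hc.le, Real.rpow_neg hc.le, div_eq_mul_inv]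
      _ ≤ 3 * c ^ (-δ) := by
        gcongr
        have := Real.rpow_le_rpow_of_exponent_le (by norm_num : (1 : ℝ) ≤ 3) hδ1
        simpa using this
  have hexp : ∀ x : ℝ, 0 < x → (x / c) ^ γ * x ^ (-δ) * (1 + 3 * (x / c) ^ δ) =
      c ^ (-γ) * (x ^ (γ - δ) + x ^ γ * (3 * c ^ (-δ))) := by
    intro x hx
    rw [Real.div_rpow hx.le hc.le, Real.div_rpow hx.le hc.le, Real.rpow_neg hc.le,
      Real.rpow_neg hc.le, Real.rpow_neg hx.le, Real.rpow_sub hx]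
    have := (Real.rpow_pos_of_pos hx δ).ne'
    have := (Real.rpow_pos_of_pos hc δ).ne'
    have := (Real.rpow_pos_of_pos hc γ).ne'
    field_simp
  rw [hexp r hr, hexp r' hr', Real.div_rpow hr.le hc.le, Real.div_rpow hr'.le hc.le]
  have h1 : r ^ γ - r' ^ γ ≤ t ^ δ * r ^ (γ - δ) := rpow_sub_rpow_le hr'.le hle hsub hδ hδγ hγ
  have h0 : r' ^ γ ≤ r ^ γ := Real.rpow_le_rpow hr'.le hle hγ0.le
  have hA : |r ^ γ * g - r' ^ γ * g'| ≤ t ^ δ * r ^ (γ - δ) * G +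
      t ^ δ * (3 * c ^ (-δ)) * (r ^ γ * G + r' ^ γ * G') := by
    have e : r ^ γ * g - r' ^ γ * g' = (r ^ γ - r' ^ γ) * g + r' ^ γ * (g - g') := by ring
    have hr0 := Real.rpow_nonneg hr'.le γ
    rw [Real.mul_rpow ht hT] at h
    have hp : 0 ≤ t ^ δ := Real.rpow_nonneg ht δ
    have hTT : 0 ≤ T ^ δ := Real.rpow_nonneg hT δ
    have hcc : 0 ≤ c ^ (-δ) := Real.rpow_nonneg hc.le _
    have hrr : 0 ≤ r ^ (γ - δ) := Real.rpow_nonneg hr.le _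
    rw [e]
    calc |(r ^ γ - r' ^ γ) * g + r' ^ γ * (g - g')|
        ≤ (r ^ γ - r' ^ γ) * g + r' ^ γ * |g - g'| := by
          refine (abs_add_le _ _).trans ?_
          rw [abs_mul, abs_mul, abs_of_nonneg (sub_nonneg.2 h0), abs_of_nonneg hg,
            abs_of_nonneg hr0]
      _ ≤ (t ^ δ * r ^ (γ - δ)) * G + r' ^ γ * (t ^ δ * (3 * c ^ (-δ)) * (G + G')) := by
          gcongr
          refine h.trans ?_
          gcongr
      _ = t ^ δ * r ^ (γ - δ) * G + t ^ δ * (3 * c ^ (-δ)) * (r' ^ γ * G + r' ^ γ * G') := by ring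
      _ ≤ _ := by gcongr
  have hcγ : 0 ≤ c ^ (-γ) := Real.rpow_nonneg hc.le _
  have hfin : r ^ γ / c ^ γ * g - r' ^ γ / c ^ γ * g' = c ^ (-γ) * (r ^ γ * g - r' ^ γ * g') := by
    rw [Real.rpow_neg hc.le]; ring
  rw [hfin, abs_mul, abs_of_nonneg hcγ]
  -- The estimate does not produce this term. Adding it makes the majorant symmetric in the primed
  -- and unprimed quantities, so that the lemma serves for either order of the two lengths.
  have hextra : 0 ≤ c ^ (-γ) * (t ^ δ * (r' ^ (γ - δ) * G')) := by
    have := Real.rpow_nonneg ht δ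
    have := Real.rpow_nonneg hr'.le (γ - δ)
    positivity
  calc c ^ (-γ) * |r ^ γ * g - r' ^ γ * g'| ≤ c ^ (-γ) * (t ^ δ * r ^ (γ - δ) * G +
      t ^ δ * (3 * c ^ (-δ)) * (r ^ γ * G + r' ^ γ * G')) := by gcongr
    _ ≤ _ := by linarith

/-- The shifts of ξ and v are opposite, so ξ + v, the argument of f in the gain term, does not move.
The centre ξ + V - v/2 of the Gaussian is displaced by t/2 from the shifts and by at most 2t tan θ
from the change of frame. -/
theorem abs_weight_sub_le {γ δ t : ℝ} (hδ : 0 < δ) (hδ4 : δ ≤ 1 / 4) (hδγ : δ ≤ γ) (hγ : γ ≤ 1)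
    (ht : 0 ≤ t) {v : Vel} (hv : 0 < v 1 ^ 2 + v 2 ^ 2) {θ : ℝ} (hc : 0 < Real.cos θ)
    (htan : 0 ≤ Real.tan θ) (ε : ℝ) (ξ : Vel) :
    |‖relVel (v - t • EuclideanSpace.single 0 1) θ ε‖ ^ γ *
        gainGauss (ξ + t • EuclideanSpace.single 0 1)
          (relVel (v - t • EuclideanSpace.single 0 1) θ ε) (v - t • EuclideanSpace.single 0 1) -
      ‖relVel v θ ε‖ ^ γ * gainGauss ξ (relVel v θ ε) v| ≤
      t ^ δ * (holderBound γ δ ξ (relVel v θ ε) v +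
        holderBound γ δ (ξ + t • EuclideanSpace.single 0 1)
          (relVel (v - t • EuclideanSpace.single 0 1) θ ε)
          (v - t • EuclideanSpace.single 0 1)) := by
  set e : Vel := EuclideanSpace.single 0 1 with he
  set v' := v - t • e with hv'
  have hv1 : 0 < v' 1 ^ 2 + v' 2 ^ 2 := by simpa [hv', he] using hv
  have hn : ∀ u : Vel, 0 < u 1 ^ 2 + u 2 ^ 2 → 0 < ‖u‖ := by
    intro u hu
    rw [norm_pos_iff]; rintro rfl; simp at hu
  have he1 : ‖e‖ = 1 := by simp [he]
  have hvv : ‖v' - v‖ = t := by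
    rw [hv', sub_sub_cancel_left, norm_neg, norm_smul, he1, mul_one, Real.norm_of_nonneg ht]
  have hD : ‖(ξ + t • e + relVel v' θ ε - (1 / 2 : ℝ) • v') -
      (ξ + relVel v θ ε - (1 / 2 : ℝ) • v)‖ + ‖v' - v‖ / 2 ≤ t * (1 + 2 * Real.tan θ) := by
    have h1 : (ξ + t • e + relVel v' θ ε - (1 / 2 : ℝ) • v') -
      (ξ + relVel v θ ε - (1 / 2 : ℝ) • v) =
        (t / 2) • e + ((relVel v' θ ε - v') - (relVel v θ ε - v)) := by
      have : v = v' + t • e := by rw [hv']; abel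
      rw [this]; module
    have h2 := norm_relVel_sub_le v ht htan ε
    rw [h1, hvv]
    have h3 : ‖(t / 2) • e‖ = t / 2 := by
      rw [norm_smul, he1, mul_one, Real.norm_of_nonneg (by positivity)]
    have h4 := norm_add_le ((t / 2) • e) ((relVel v' θ ε - v') - (relVel v θ ε - v))
    have h5 : ‖relVel v' θ ε - v' - (relVel v θ ε - v)‖ ≤ 2 * t * Real.tan θ := h2
    linarith
  have hgg := abs_gainGauss_sub_le hδ.le hδ4 hD
  have hT := one_add_two_mul_tan_le hc
  have hT0 : 0 ≤ 1 + 2 * Real.tan θ := by positivity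
  simp only [holderBound, norm_relVel hv hc, norm_relVel hv1 hc]
  rcases le_total ‖v'‖ ‖v‖ with h | h
  · rw [abs_sub_comm]
    refine abs_weight_sub_le_aux hc (hn v hv) (hn v' hv1) h ht ?_ hδ (by linarith) hδγ hγ
      (gainGauss_pos _ _ _).le (gainGauss_le_one _ _ _) (gainGauss_pos _ _ _).le hT0 hT ?_
    · exact (norm_sub_norm_le v v').trans (by rw [norm_sub_rev v v', hvv])
    · rw [abs_sub_comm]
      exact hgg
  · rw [add_comm (_ * _ * _ * _)]
    refine abs_weight_sub_le_aux hc (hn v' hv1) (hn v hv) h ht ?_ hδ (by linarith) hδγ hγ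
      (gainGauss_pos _ _ _).le (gainGauss_le_one _ _ _) (gainGauss_pos _ _ _).le hT0 hT ?_
    · exact (norm_sub_norm_le v' v).trans hvv.le
    · rw [add_comm (gainGauss _ _ _ ^ _)]
      exact hgg

/-- Since R = |V| equals r / cos θ with r = |v|, the Gaussian in R may be traded for R^{-(1+δ)} =
r^{-(1+δ)} (cos θ)^{1+δ}. The last factor cos θ on the left stands for the one supplied by the
cut-off; the powers of the cosine add up to -3 + (1 + δ) + 1 = δ - 1, those of r to -(1 + 2δ). -/
theorem exists_holderBound_le {γ δ : ℝ} (hδ : 0 < δ) (hγ : 0 < γ) :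
    ∃ C : ℝ, 0 < C ∧ ∀ v : Vel, 0 < v 1 ^ 2 + v 2 ^ 2 → ∀ θ, 0 < Real.cos θ → ∀ (ε : ℝ) (ξ : Vel),
      (Real.cos θ ^ 3)⁻¹ * holderBound γ δ ξ (relVel v θ ε) v * Real.cos θ ≤
        C * Real.cos θ ^ (δ - 1) * (Real.exp (‖ξ‖ ^ 2 / 16) * gainMajorant δ v) := by
  obtain ⟨C₁, hC₁, h₁⟩ := exists_rpow_mul_exp_le (γ + (1 + δ)) (by linarith)
    (κ := 1 / 48) (by norm_num)
  obtain ⟨C₂, hC₂, h₂⟩ := exists_rpow_mul_exp_le (γ + (1 + δ) + δ) (by linarith)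
    (κ := 1 / 48) (by norm_num)
  refine ⟨C₁ + 3 * C₂, by positivity, fun v hv θ hc ε ξ => ?_⟩
  have hr : 0 < ‖v‖ := by
    rw [norm_pos_iff]; rintro rfl; simp at hv
  have hR : ‖relVel v θ ε‖ = ‖v‖ / Real.cos θ := norm_relVel hv hc ε
  set R := ‖relVel v θ ε‖ with hRdef
  have hR0 : 0 < R := by rw [hR]; positivity
  set r := ‖v‖
  set c := Real.cos θ
  have hE := gainGauss_rpow_le ξ (relVel v θ ε) v
  rw [← hRdef] at hE
  have hS : R ^ γ * (1 + 3 * R ^ δ) * Real.exp (-(1 / 48 * R ^ 2)) ≤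
      (C₁ + 3 * C₂) * R ^ (-(1 + δ)) := by
    rw [Real.rpow_neg hR0.le, ← div_eq_mul_inv, le_div_iff₀ (by positivity)]
    have k1 := h₁ R hR0.le
    have k2 := h₂ R hR0.le
    rw [Real.rpow_add hR0, Real.rpow_add hR0] at k2
    rw [Real.rpow_add hR0] at k1
    linarith
  have hRr : R ^ (-(1 + δ)) = r ^ (-(1 + δ)) * c ^ (1 + δ) := by
    rw [hR, Real.div_rpow hr.le hc.le, Real.rpow_neg hc.le, div_inv_eq_mul]
  have hcc : (c ^ 3)⁻¹ * c ^ (1 + δ) * c = c ^ (δ - 1) := by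
    rw [Real.rpow_add hc, Real.rpow_sub hc, Real.rpow_one]
    field_simp
  have hrr : r ^ (-(1 + δ)) * r ^ (-δ) = r ^ (-(1 + 2 * δ)) := by
    rw [← Real.rpow_add hr]; congr 1; ring
  have hprod : holderBound γ δ ξ (relVel v θ ε) v ≤ (C₁ + 3 * C₂) * R ^ (-(1 + δ)) * r ^ (-δ) *
      (Real.exp (‖ξ‖ ^ 2 / 16) * Real.exp (-(r ^ 2 / 8))) := by
    calc holderBound γ δ ξ (relVel v θ ε) v
        ≤ R ^ γ * r ^ (-δ) * (1 + 3 * R ^ δ) * (Real.exp (-(1 / 48 * R ^ 2)) *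
          (Real.exp (‖ξ‖ ^ 2 / 16) * Real.exp (-(r ^ 2 / 8)))) := by
          rw [holderBound]; gcongr
      _ = (R ^ γ * (1 + 3 * R ^ δ) * Real.exp (-(1 / 48 * R ^ 2))) * r ^ (-δ) *
          (Real.exp (‖ξ‖ ^ 2 / 16) * Real.exp (-(r ^ 2 / 8))) := by ring
      _ ≤ _ := by gcongr
  calc (c ^ 3)⁻¹ * holderBound γ δ ξ (relVel v θ ε) v * c
      ≤ (c ^ 3)⁻¹ * ((C₁ + 3 * C₂) * R ^ (-(1 + δ)) * r ^ (-δ) *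
      (Real.exp (‖ξ‖ ^ 2 / 16) * Real.exp (-(r ^ 2 / 8)))) * c := by gcongr
    _ = (C₁ + 3 * C₂) * ((c ^ 3)⁻¹ * c ^ (1 + δ) * c) * (Real.exp (‖ξ‖ ^ 2 / 16) *
        ((r ^ (-(1 + δ)) * r ^ (-δ)) * Real.exp (-(r ^ 2 / 8)))) := by rw [hRr]; ring
    _ = _ := by rw [hcc, hrr, gainMajorant]

/-- As for the Hölder bound, but without r^{-δ} at hand: the Gaussian is traded for R^{-(1+2δ)} so
that the same majorant results. -/
theorem exists_weight_le {γ δ : ℝ} (hδ : 0 < δ) (hγ : 0 < γ) :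
    ∃ C : ℝ, 0 < C ∧ ∀ v : Vel, 0 < v 1 ^ 2 + v 2 ^ 2 → ∀ θ, 0 < Real.cos θ → ∀ (ε : ℝ) (ξ : Vel),
      (Real.cos θ ^ 3)⁻¹ * (‖relVel v θ ε‖ ^ γ * gainGauss ξ (relVel v θ ε) v) * Real.cos θ ≤
        C * Real.cos θ ^ (δ - 1) * (Real.exp (‖ξ‖ ^ 2 / 16) * gainMajorant δ v) := by
  obtain ⟨C₁, hC₁, h₁⟩ := exists_rpow_mul_exp_le (γ + (1 + 2 * δ)) (by linarith)
    (κ := 1 / 48) (by norm_num)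
  refine ⟨C₁, by positivity, fun v hv θ hc ε ξ => ?_⟩
  have hr : 0 < ‖v‖ := by
    rw [norm_pos_iff]; rintro rfl; simp at hv
  have hR : ‖relVel v θ ε‖ = ‖v‖ / Real.cos θ := norm_relVel hv hc ε
  set R := ‖relVel v θ ε‖ with hRdef
  have hR0 : 0 < R := by rw [hR]; positivity
  set r := ‖v‖
  set c := Real.cos θ
  have hE := gainGauss_rpow_le ξ (relVel v θ ε) v
  rw [← hRdef] at hE
  have hg := gainGauss_pos ξ (relVel v θ ε) v
  have hgG : gainGauss ξ (relVel v θ ε) v ≤ gainGauss ξ (relVel v θ ε) v ^ (3 / 4 : ℝ) := by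
    have := Real.rpow_le_rpow_of_exponent_ge' hg.le (gainGauss_le_one ξ (relVel v θ ε) v)
      (by norm_num) (by norm_num : (3 / 4 : ℝ) ≤ 1)
    simpa using this
  have hS : R ^ γ * Real.exp (-(1 / 48 * R ^ 2)) ≤ C₁ * R ^ (-(1 + 2 * δ)) := by
    rw [Real.rpow_neg hR0.le, ← div_eq_mul_inv, le_div_iff₀ (by positivity)]
    have k1 := h₁ R hR0.le
    rw [Real.rpow_add hR0] at k1
    linarith
  have hRr : R ^ (-(1 + 2 * δ)) = r ^ (-(1 + 2 * δ)) * c ^ (1 + 2 * δ) := by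
    rw [hR, Real.div_rpow hr.le hc.le, Real.rpow_neg hc.le, div_inv_eq_mul]
  have hcc : (c ^ 3)⁻¹ * c ^ (1 + 2 * δ) * c ≤ c ^ (δ - 1) := by
    have : (c ^ 3)⁻¹ * c ^ (1 + 2 * δ) * c = c ^ (2 * δ - 1) := by
      rw [Real.rpow_add hc, Real.rpow_sub hc, Real.rpow_one]
      field_simp
    rw [this]
    exact Real.rpow_le_rpow_of_exponent_ge hc (Real.cos_le_one θ) (by linarith)
  have hM : 0 ≤ Real.exp (‖ξ‖ ^ 2 / 16) * gainMajorant δ v := by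
    rw [gainMajorant]; positivity
  calc (c ^ 3)⁻¹ * (R ^ γ * gainGauss ξ (relVel v θ ε) v) * c
      ≤ (c ^ 3)⁻¹ * (R ^ γ * (Real.exp (-(1 / 48 * R ^ 2)) *
          (Real.exp (‖ξ‖ ^ 2 / 16) * Real.exp (-(r ^ 2 / 8))))) * c := by
        gcongr; exact hgG.trans hE
    _ = (c ^ 3)⁻¹ * ((R ^ γ * Real.exp (-(1 / 48 * R ^ 2))) *
          (Real.exp (‖ξ‖ ^ 2 / 16) * Real.exp (-(r ^ 2 / 8)))) * c := by ring
    _ ≤ (c ^ 3)⁻¹ * ((C₁ * R ^ (-(1 + 2 * δ))) *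
          (Real.exp (‖ξ‖ ^ 2 / 16) * Real.exp (-(r ^ 2 / 8)))) * c := by gcongr
    _ = C₁ * ((c ^ 3)⁻¹ * c ^ (1 + 2 * δ) * c) * (Real.exp (‖ξ‖ ^ 2 / 16) * gainMajorant δ v) := by
        rw [hRr, gainMajorant]; ring
    _ ≤ _ := by gcongr

/-! ### Integration over the angles -/

/-- Lebesgue measure for the angles `(θ, ε)`. -/
noncomputable def angMeasure : Measure (ℝ × ℝ) :=
  (volume.restrict (Ioo 0 (Real.pi / 2))).prod (volume.restrict (Ioo (-Real.pi) Real.pi))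

instance : IsFiniteMeasure angMeasure := by
  unfold angMeasure
  infer_instance

theorem ae_angMeasure : ∀ᵐ z ∂angMeasure, z.1 ∈ Ioo 0 (Real.pi / 2) := by
  have : ∀ᵐ θ ∂(volume.restrict (Ioo 0 (Real.pi / 2))), θ ∈ Ioo 0 (Real.pi / 2) :=
    ae_restrict_mem measurableSet_Ioo
  exact Measure.quasiMeasurePreserving_fst.ae this

theorem cos_pos_of_mem {θ : ℝ} (h : θ ∈ Ioo 0 (Real.pi / 2)) : 0 < Real.cos θ :=
  Real.cos_pos_of_mem_Ioo ⟨by linarith [h.1, Real.pi_pos], h.2⟩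

theorem sin_pos_of_mem {θ : ℝ} (h : θ ∈ Ioo 0 (Real.pi / 2)) : 0 < Real.sin θ :=
  Real.sin_pos_of_mem_Ioo ⟨h.1, by linarith [h.2, Real.pi_pos]⟩

/-- The antiderivative -(cos θ)^δ/δ is continuous up to π/2 because δ > 0, and a nonnegative
derivative of such a function is integrable. -/
theorem integrable_sin_mul_cos_rpow {δ : ℝ} (hδ : 0 < δ) :
    Integrable (fun z : ℝ × ℝ => Real.sin z.1 * Real.cos z.1 ^ (δ - 1)) angMeasure := by
  have h1 : IntegrableOn (fun θ => Real.sin θ * Real.cos θ ^ (δ - 1)) (Ioo 0 (Real.pi / 2)) := by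
    have := intervalIntegral.integrableOn_deriv_of_nonneg (a := 0) (b := Real.pi / 2)
      (g := fun θ => -(Real.cos θ ^ δ / δ)) (g' := fun θ => Real.sin θ * Real.cos θ ^ (δ - 1))
      (by
        have : Continuous fun θ : ℝ => Real.cos θ ^ δ :=
          Real.continuous_cos.rpow_const fun _ => Or.inr hδ.le
        exact (this.div_const δ).fun_neg.continuousOn)
      (fun θ hθ => by
        have h := ((Real.hasDerivAt_cos θ).rpow_const (p := δ)
          (Or.inl (cos_pos_of_mem hθ).ne')).div_const δ |>.fun_neg
        have hne := hδ.ne'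
        exact h.congr_deriv (by field_simp))
      (fun θ hθ => mul_nonneg (sin_pos_of_mem hθ).le (Real.rpow_nonneg (cos_pos_of_mem hθ).le _))
    exact this.mono_set Ioo_subset_Ioc_self
  exact Integrable.comp_fst h1 _

theorem measurable_axisFrame₁ : Measurable axisFrame₁ := by
  have h : axisFrame₁ = fun v : Vel => (√(v 1 ^ 2 + v 2 ^ 2))⁻¹ •
      ((fun p : ℝ × ℝ × ℝ => (!₂[p.1, p.2.1, p.2.2] : Vel)) (0, -v 2, v 1)) := rfl
  rw [h]
  have := measurable_vel_mk
  fun_prop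

theorem measurable_axisNormal : Measurable axisNormal := by
  have h : axisNormal = fun v : Vel => ((fun p : ℝ × ℝ × ℝ => (!₂[p.1, p.2.1, p.2.2] : Vel))
    (√(v 1 ^ 2 + v 2 ^ 2), -(v 0 * v 1 * (√(v 1 ^ 2 + v 2 ^ 2))⁻¹),
    -(v 0 * v 2 * (√(v 1 ^ 2 + v 2 ^ 2))⁻¹))) := rfl
  rw [h]
  have := measurable_vel_mk
  fun_prop

theorem measurable_relVel : Measurable fun z : Vel × ℝ × ℝ => relVel z.1 z.2.1 z.2.2 := by
  have h1 := measurable_axisFrame₁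
  have h2 := measurable_axisNormal
  have h3 : Measurable Real.tan := by
    have : Real.tan = fun x => Real.sin x / Real.cos x := funext Real.tan_eq_sin_div_cos
    rw [this]; fun_prop
  unfold relVel
  fun_prop

theorem measurable_gainWeight (γ : ℝ) {α : Type*} [MeasurableSpace α] {ξ V v : α → Vel}
    (hξ : Measurable ξ) (hV : Measurable V) (hv : Measurable v) :
    Measurable fun z => gainWeight γ (ξ z) (V z) (v z) := by
  unfold gainWeight gainGauss
  fun_prop

theorem measurable_gainKernel (γ : ℝ) {B : ℝ → ℝ} (hB : Measurable B) {α : Type*}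
    [MeasurableSpace α] {ξ v : α → Vel} {θ ε : α → ℝ} (hξ : Measurable ξ) (hv : Measurable v)
    (hθ : Measurable θ) (hε : Measurable ε) :
    Measurable fun z => gainKernel γ B (ξ z) (v z) (θ z) (ε z) := by
  have h1 : Measurable fun z => relVel (v z) (θ z) (ε z) :=
    measurable_relVel.comp (hv.prodMk (hθ.prodMk hε))
  exact (hB.comp hθ).mul (((Real.measurable_cos.comp hθ).pow_const 3).inv.mul
    (measurable_gainWeight γ hξ h1 hv))

/-- A nonnegative angular density dominated by `cos θ sin θ` on `(0, π / 2)`. -/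
structure IsAngularDensity (B : ℝ → ℝ) : Prop where
  measurable : Measurable B
  nonneg : ∀ θ ∈ Ioo 0 (Real.pi / 2), 0 ≤ B θ
  le_cos_mul_sin : ∃ K : ℝ, 0 ≤ K ∧ ∀ θ ∈ Ioo 0 (Real.pi / 2), B θ ≤ K * (Real.cos θ * Real.sin θ)

theorem lintegral_enorm_le_of_le {F : ℝ × ℝ → ℝ} {δ c : ℝ} (hδ : 0 < δ)
    (h : ∀ θ ∈ Ioo 0 (Real.pi / 2), ∀ ε, |F (θ, ε)| ≤ (Real.sin θ * Real.cos θ ^ (δ - 1)) * c) :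
    ∫⁻ z, ‖F z‖ₑ ∂angMeasure ≤
      ENNReal.ofReal ((∫ z, Real.sin z.1 * Real.cos z.1 ^ (δ - 1) ∂angMeasure) * c) := by
  have hi := (integrable_sin_mul_cos_rpow hδ).mul_const c
  rw [← integral_mul_const, ofReal_integral_eq_lintegral_ofReal hi]
  · refine lintegral_mono_ae ?_
    filter_upwards [ae_angMeasure] with z hz
    rw [Real.enorm_eq_ofReal_abs]
    exact ENNReal.ofReal_le_ofReal (h z.1 hz z.2)
  · filter_upwards [ae_angMeasure] with z hz
    exact (abs_nonneg _).trans (h z.1 hz z.2)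

theorem exists_lintegral_gainKernel_le {γ δ : ℝ} {B : ℝ → ℝ} (hB : IsAngularDensity B)
    (hδ : 0 < δ) (hγ : 0 < γ) :
    ∃ C : ℝ, 0 < C ∧ ∀ v : Vel, 0 < v 1 ^ 2 + v 2 ^ 2 → ∀ ξ : Vel,
      ∫⁻ z, ‖gainKernel γ B ξ v z.1 z.2‖ₑ ∂angMeasure ≤
        ENNReal.ofReal (C * (Real.exp (‖ξ‖ ^ 2 / 16) * gainMajorant δ v)) := by
  obtain ⟨K, hK, hBK⟩ := hB.le_cos_mul_sin
  obtain ⟨C, hC, h⟩ := exists_weight_le hδ hγ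
  set I := ∫ z, Real.sin z.1 * Real.cos z.1 ^ (δ - 1) ∂angMeasure
  have hI : 0 ≤ I := integral_nonneg_of_ae (by
    filter_upwards [ae_angMeasure] with z hz
    exact mul_nonneg (sin_pos_of_mem hz).le (Real.rpow_nonneg (cos_pos_of_mem hz).le _))
  set P := (√Real.pi ^ 3)⁻¹ with hP
  have hP0 : 0 < P := by positivity
  -- The summand 1 makes the constant positive even if K vanishes.
  refine ⟨I * (K * P * C) + 1, by positivity, fun v hv ξ => ?_⟩
  refine (lintegral_enorm_le_of_le (c := K * P * C * (Real.exp (‖ξ‖ ^ 2 / 16) * gainMajorant δ v))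
    hδ fun θ hθ ε => ?_).trans (ENNReal.ofReal_le_ofReal ?_)
  · have hc := cos_pos_of_mem hθ
    have hs := sin_pos_of_mem hθ
    have hw : 0 ≤ ‖relVel v θ ε‖ ^ γ * gainGauss ξ (relVel v θ ε) v :=
      mul_nonneg (Real.rpow_nonneg (norm_nonneg _) _) (gainGauss_pos _ _ _).le
    have hb := hB.nonneg θ hθ
    have he : gainKernel γ B ξ v θ ε = B θ * (P * ((Real.cos θ ^ 3)⁻¹ *
        (‖relVel v θ ε‖ ^ γ * gainGauss ξ (relVel v θ ε) v))) := by
      rw [gainKernel, gainWeight]; ring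
    simp only
    rw [he, abs_of_nonneg (by positivity)]
    calc _ ≤ (K * (Real.cos θ * Real.sin θ)) * (P * ((Real.cos θ ^ 3)⁻¹ *
        (‖relVel v θ ε‖ ^ γ * gainGauss ξ (relVel v θ ε) v))) := by
          gcongr; exact hBK θ hθ
      _ = K * P * Real.sin θ * ((Real.cos θ ^ 3)⁻¹ *
        (‖relVel v θ ε‖ ^ γ * gainGauss ξ (relVel v θ ε) v) * Real.cos θ) := by ring
      _ ≤ K * P * Real.sin θ * (C * Real.cos θ ^ (δ - 1) *
          (Real.exp (‖ξ‖ ^ 2 / 16) * gainMajorant δ v)) := by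
          gcongr ?_ * ?_
          exact h v hv θ hc ε ξ
      _ = _ := by ring
  · have : 0 ≤ Real.exp (‖ξ‖ ^ 2 / 16) * gainMajorant δ v := by rw [gainMajorant]; positivity
    nlinarith

theorem exists_lintegral_gainKernel_sub_le {γ δ : ℝ} {B : ℝ → ℝ} (hB : IsAngularDensity B)
    (hδ : 0 < δ) (hδ4 : δ ≤ 1 / 4) (hδγ : δ ≤ γ) (hγ : γ ≤ 1) :
    ∃ C : ℝ, 0 < C ∧ ∀ v : Vel, 0 < v 1 ^ 2 + v 2 ^ 2 → ∀ (ξ : Vel) (t : ℝ), 0 ≤ t →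
      ∫⁻ z, ‖gainKernel γ B (ξ + t • EuclideanSpace.single 0 1)
          (v - t • EuclideanSpace.single 0 1) z.1 z.2 - gainKernel γ B ξ v z.1 z.2‖ₑ ∂angMeasure ≤
        ENNReal.ofReal (C * (t ^ δ * (Real.exp (‖ξ‖ ^ 2 / 16) * gainMajorant δ v +
          Real.exp (‖ξ + t • EuclideanSpace.single 0 1‖ ^ 2 / 16) *
            gainMajorant δ (v - t • EuclideanSpace.single 0 1)))) := by
  obtain ⟨K, hK, hBK⟩ := hB.le_cos_mul_sin
  obtain ⟨C, hC, h⟩ := exists_holderBound_le hδ (hδ.trans_le hδγ)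
  set I := ∫ z, Real.sin z.1 * Real.cos z.1 ^ (δ - 1) ∂angMeasure
  have hI : 0 ≤ I := integral_nonneg_of_ae (by
    filter_upwards [ae_angMeasure] with z hz
    exact mul_nonneg (sin_pos_of_mem hz).le (Real.rpow_nonneg (cos_pos_of_mem hz).le _))
  set P := (√Real.pi ^ 3)⁻¹ with hP
  have hP0 : 0 < P := by positivity
  refine ⟨I * (K * P * C) + 1, by positivity, fun v hv ξ t ht => ?_⟩
  set e : Vel := EuclideanSpace.single 0 1 with he
  set M := Real.exp (‖ξ‖ ^ 2 / 16) * gainMajorant δ v +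
    Real.exp (‖ξ + t • e‖ ^ 2 / 16) * gainMajorant δ (v - t • e) with hM
  have hM0 : 0 ≤ M := by simp only [hM, gainMajorant]; positivity
  have ht0 : 0 ≤ t ^ δ := Real.rpow_nonneg ht δ
  have hv1 : 0 < (v - t • e) 1 ^ 2 + (v - t • e) 2 ^ 2 := by simpa [he] using hv
  refine (lintegral_enorm_le_of_le (c := K * P * C * (t ^ δ * M))
    hδ fun θ hθ ε => ?_).trans (ENNReal.ofReal_le_ofReal ?_)
  · have hc := cos_pos_of_mem hθ
    have hs := sin_pos_of_mem hθ
    have hb := hB.nonneg θ hθ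
    have hd := abs_weight_sub_le hδ hδ4 hδγ hγ ht hv hc
      (by rw [Real.tan_eq_sin_div_cos]; positivity) ε ξ
    have h1 := h v hv θ hc ε ξ
    have h2 := h (v - t • e) hv1 θ hc ε (ξ + t • e)
    rw [← he] at hd
    set W' := ‖relVel (v - t • e) θ ε‖ ^ γ *
      gainGauss (ξ + t • e) (relVel (v - t • e) θ ε) (v - t • e)
    set W := ‖relVel v θ ε‖ ^ γ * gainGauss ξ (relVel v θ ε) v
    set Q := holderBound γ δ ξ (relVel v θ ε) v
    set Q' := holderBound γ δ (ξ + t • e) (relVel (v - t • e) θ ε) (v - t • e)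
    have heq : gainKernel γ B (ξ + t • e) (v - t • e) θ ε - gainKernel γ B ξ v θ ε =
        B θ * (P * ((Real.cos θ ^ 3)⁻¹ * (W' - W))) := by
      simp only [gainKernel, gainWeight, W, W']; ring
    simp only
    rw [heq, abs_mul, abs_mul, abs_mul, abs_of_nonneg hb, abs_of_pos hP0,
      abs_of_pos (by positivity : 0 < (Real.cos θ ^ 3)⁻¹)]
    calc _ ≤ (K * (Real.cos θ * Real.sin θ)) * (P * ((Real.cos θ ^ 3)⁻¹ *
        (t ^ δ * (Q + Q')))) := by
          gcongr; exact hBK θ hθ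
      _ = K * P * Real.sin θ * t ^ δ * ((Real.cos θ ^ 3)⁻¹ * Q * Real.cos θ +
          (Real.cos θ ^ 3)⁻¹ * Q' * Real.cos θ) := by ring
      _ ≤ K * P * Real.sin θ * t ^ δ * (C * Real.cos θ ^ (δ - 1) *
          (Real.exp (‖ξ‖ ^ 2 / 16) * gainMajorant δ v) + C * Real.cos θ ^ (δ - 1) *
          (Real.exp (‖ξ + t • e‖ ^ 2 / 16) * gainMajorant δ (v - t • e))) := by
          gcongr ?_ * ?_
          exact add_le_add h1 h2
      _ = _ := by rw [hM]; ring
  · have : 0 ≤ t ^ δ * M := by positivity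
    nlinarith

/-! ### The gain operator -/

theorem lintegral_enorm_mul_le {α : Type*} [MeasurableSpace α] {μ : Measure α} {f g : α → ℝ}
    (hf : AEStronglyMeasurable f μ) (hg : AEStronglyMeasurable g μ) (p q : ℝ≥0∞)
    [ENNReal.HolderConjugate p q] :
    ∫⁻ x, ‖f x‖ₑ * ‖g x‖ₑ ∂μ ≤ eLpNorm f p μ * eLpNorm g q μ := by
  have := eLpNorm_smul_le_mul_eLpNorm (p := p) (q := q) (r := 1) hg hf
  rw [eLpNorm_one_eq_lintegral_enorm] at this
  simpa [enorm_mul] using this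

/-- In polar coordinates the square behaves like r² r^{-2-4δ} = r^{-4δ} near 0, which is integrable
because δ ≤ 1/8. -/
theorem memLp_gainMajorant {δ : ℝ} (hδ : 0 < δ) (hδ8 : δ ≤ 1 / 8) :
    MemLp (gainMajorant δ) 2 (volume : Measure Vel) := by
  have hm : Measurable (gainMajorant δ) := by unfold gainMajorant; fun_prop
  rw [memLp_two_iff_integrable_sq hm.aestronglyMeasurable]
  have h1 : IntegrableOn (fun y : ℝ => y ^ (Module.finrank ℝ Vel - 1) •
      ((y ^ (-(1 + 2 * δ)) * Real.exp (-(y ^ 2 / 8))) ^ 2)) (Ioi 0) := by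
    have h2 := integrableOn_rpow_mul_exp_neg_mul_sq (b := 1 / 4) (by norm_num) (s := -(4 * δ))
      (by linarith)
    refine h2.congr_fun (fun y hy => ?_) measurableSet_Ioi
    have hy : 0 < y := hy
    simp only [finrank_euclideanSpace, Fintype.card_fin, smul_eq_mul, mul_pow]
    rw [← Real.exp_nat_mul, ← Real.rpow_natCast (y ^ _), ← Real.rpow_mul hy.le,
      ← Real.rpow_natCast y (3 - 1), ← mul_assoc, ← Real.rpow_add hy]
    congr 2
    · norm_num; ring
    · norm_num; ring
  exact (integrable_fun_norm_addHaar (volume : Measure Vel)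
    (f := fun y => (y ^ (-(1 + 2 * δ)) * Real.exp (-(y ^ 2 / 8))) ^ 2)).2 h1

/-- The gain operator `∫ f(ξ + v) k(ξ, v, θ, ε)`. -/
noncomputable def gainOp (γ : ℝ) (B : ℝ → ℝ) (f : Vel → ℝ) (ξ : Vel) : ℝ :=
  ∫ z : Vel × ℝ × ℝ, f (ξ + z.1) * gainKernel γ B ξ z.1 z.2.1 z.2.2 ∂(volume.prod angMeasure)

theorem measurable_gainOp_integrand {γ : ℝ} {B : ℝ → ℝ} (hB : Measurable B) {f : Vel → ℝ}
    (hf : Measurable f) : Measurable fun w : Vel × Vel × ℝ × ℝ =>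
      f (w.1 + w.2.1) * gainKernel γ B w.1 w.2.1 w.2.2.1 w.2.2.2 :=
  (hf.comp (by fun_prop)).mul (measurable_gainKernel γ hB (by fun_prop) (by fun_prop) (by fun_prop)
    (by fun_prop))

theorem stronglyMeasurable_gainOp {γ : ℝ} {B : ℝ → ℝ} (hB : Measurable B) {f : Vel → ℝ}
    (hf : Measurable f) : StronglyMeasurable (gainOp γ B f) :=
  (measurable_gainOp_integrand hB hf).stronglyMeasurable.integral_prod_right'

theorem eLpNorm_comp_add (f : Vel → ℝ) (hf : Measurable f) (ξ : Vel) (p : ℝ≥0∞) :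
    eLpNorm (fun v => f (ξ + v)) p volume = eLpNorm f p volume :=
  eLpNorm_comp_measurePreserving hf.aestronglyMeasurable (measurePreserving_add_left volume ξ)

theorem eLpNorm_comp_sub (f : Vel → ℝ) (hf : Measurable f) (ξ : Vel) (p : ℝ≥0∞) :
    eLpNorm (fun v => f (v - ξ)) p volume = eLpNorm f p volume :=
  eLpNorm_comp_measurePreserving hf.aestronglyMeasurable (measurePreserving_sub_right volume ξ)

/-- After integration over the angles the kernel is dominated by a fixed square-integrable function
of v, so Cauchy–Schwarz and translation invariance of the L² norm suffice. -/
theorem exists_lintegral_gainOp_le {γ δ : ℝ} {B : ℝ → ℝ} (hB : IsAngularDensity B)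
    (hδ : 0 < δ) (hδ8 : δ ≤ 1 / 8) (hγ : 0 < γ) :
    ∃ C : ℝ≥0, ∀ f : Vel → ℝ, Measurable f → ∀ ξ : Vel,
      ∫⁻ z : Vel × ℝ × ℝ, ‖f (ξ + z.1) * gainKernel γ B ξ z.1 z.2.1 z.2.2‖ₑ
        ∂(volume.prod angMeasure) ≤
        C * ENNReal.ofReal (Real.exp (‖ξ‖ ^ 2 / 16)) * eLpNorm f 2 volume := by
  obtain ⟨C, hC, h⟩ := exists_lintegral_gainKernel_le hB hδ hγ
  have hM := memLp_gainMajorant hδ hδ8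
  have hm : Measurable (gainMajorant δ) := by unfold gainMajorant; fun_prop
  refine ⟨Real.toNNReal C * (eLpNorm (gainMajorant δ) 2 volume).toNNReal, fun f hf ξ => ?_⟩
  have hk : Measurable fun w : Vel × ℝ × ℝ => gainKernel γ B ξ w.1 w.2.1 w.2.2 :=
    measurable_gainKernel γ hB.measurable (by fun_prop) (by fun_prop) (by fun_prop) (by fun_prop)
  rw [lintegral_prod _ (by fun_prop)]
  simp only [enorm_mul]
  have h1 : ∀ᵐ v : Vel, ∫⁻ z, ‖f (ξ + v)‖ₑ * ‖gainKernel γ B ξ v z.1 z.2‖ₑ ∂angMeasure ≤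
      ENNReal.ofReal (C * Real.exp (‖ξ‖ ^ 2 / 16)) * (‖f (ξ + v)‖ₑ * ‖gainMajorant δ v‖ₑ) := by
    filter_upwards [ae_axis_ne_zero] with v hv
    have hkv : Measurable fun w : ℝ × ℝ => gainKernel γ B ξ v w.1 w.2 :=
      hk.comp (measurable_const.prodMk measurable_id)
    have hpos : 0 ≤ gainMajorant δ v := by unfold gainMajorant; positivity
    rw [lintegral_const_mul _ (by fun_prop), Real.enorm_eq_ofReal hpos, mul_left_comm,
      ← ENNReal.ofReal_mul (by positivity)]
    gcongr
    rw [mul_assoc]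
    exact h v hv ξ
  refine (lintegral_mono_ae h1).trans ?_
  rw [lintegral_const_mul _ (by fun_prop)]
  have h2 := lintegral_enorm_mul_le (μ := (volume : Measure Vel)) (f := fun v => f (ξ + v))
    (g := gainMajorant δ) (hf.comp (measurable_const_add ξ)).aestronglyMeasurable hm.aestronglyMeasurable 2 2
  rw [eLpNorm_comp_add f hf] at h2
  calc _ ≤ ENNReal.ofReal (C * Real.exp (‖ξ‖ ^ 2 / 16)) *
        (eLpNorm f 2 volume * eLpNorm (gainMajorant δ) 2 volume) := by gcongr
    _ = _ := by
      rw [ENNReal.coe_mul, ENNReal.coe_toNNReal hM.2.ne, ENNReal.ofReal_mul hC.le]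
      simp only [ENNReal.ofReal]
      ring

/-- With the argument of f as integration variable, differences in ξ fall on the kernel alone. -/
theorem gainOp_eq_translate (γ : ℝ) (B : ℝ → ℝ) (f : Vel → ℝ) (ξ : Vel) :
    gainOp γ B f ξ = ∫ z : Vel × ℝ × ℝ, f z.1 * gainKernel γ B ξ (z.1 - ξ) z.2.1 z.2.2
      ∂(volume.prod angMeasure) := by
  have hmp : MeasurePreserving (fun z : Vel × ℝ × ℝ => (z.1 - ξ, z.2))
      ((volume : Measure Vel).prod angMeasure) ((volume : Measure Vel).prod angMeasure) :=
    (measurePreserving_sub_right volume ξ).prod (MeasurePreserving.id _)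
  have hme : MeasurableEmbedding (fun z : Vel × ℝ × ℝ => (z.1 - ξ, z.2)) :=
    ((MeasurableEquiv.subRight ξ).prodCongr (MeasurableEquiv.refl (ℝ × ℝ))).measurableEmbedding
  rw [gainOp, ← hmp.integral_comp hme]
  simp

/-- No regularity of f enters: the Hölder modulus is that of the kernel, and f is paired with the
two translated majorants by Cauchy–Schwarz. -/
theorem exists_gainOp_sub_le {γ δ : ℝ} {B : ℝ → ℝ} (hB : IsAngularDensity B)
    (hδ : 0 < δ) (hδ8 : δ ≤ 1 / 8) (hδγ : δ ≤ γ) (hγ : γ ≤ 1) :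
    ∃ C : ℝ≥0, ∀ f : Vel → ℝ, Measurable f → eLpNorm f 2 volume < ⊤ → ∀ (ξ : Vel) (t : ℝ), 0 ≤ t →
      ‖gainOp γ B f (ξ + t • EuclideanSpace.single 0 1) - gainOp γ B f ξ‖ₑ ≤
        C * ENNReal.ofReal (t ^ δ * (Real.exp (‖ξ‖ ^ 2 / 16) +
          Real.exp (‖ξ + t • EuclideanSpace.single 0 1‖ ^ 2 / 16))) * eLpNorm f 2 volume := by
  obtain ⟨C, hC, h⟩ := exists_lintegral_gainKernel_sub_le hB hδ (by linarith) hδγ hγ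
  obtain ⟨C₀, h₀⟩ := exists_lintegral_gainOp_le hB hδ hδ8 (hδ.trans_le hδγ)
  have hM := memLp_gainMajorant hδ hδ8
  have hm : Measurable (gainMajorant δ) := by unfold gainMajorant; fun_prop
  refine ⟨Real.toNNReal C * (eLpNorm (gainMajorant δ) 2 volume).toNNReal,
    fun f hf hf2 ξ t ht => ?_⟩
  set e : Vel := EuclideanSpace.single 0 1 with he
  have hint : ∀ ζ : Vel, Integrable (fun z : Vel × ℝ × ℝ =>
      f z.1 * gainKernel γ B ζ (z.1 - ζ) z.2.1 z.2.2) (volume.prod angMeasure) := by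
    intro ζ
    have hi : Integrable (fun z : Vel × ℝ × ℝ =>
        f (ζ + z.1) * gainKernel γ B ζ z.1 z.2.1 z.2.2) (volume.prod angMeasure) := by
      refine ⟨((measurable_gainOp_integrand hB.measurable hf).comp
        (measurable_const.prodMk measurable_id)).aestronglyMeasurable, (h₀ f hf ζ).trans_lt ?_⟩
      exact ENNReal.mul_lt_top (ENNReal.mul_lt_top ENNReal.coe_lt_top ENNReal.ofReal_lt_top) hf2
    have hmp : MeasurePreserving (fun z : Vel × ℝ × ℝ => (z.1 - ζ, z.2))
        ((volume : Measure Vel).prod angMeasure) ((volume : Measure Vel).prod angMeasure) :=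
      (measurePreserving_sub_right volume ζ).prod (MeasurePreserving.id _)
    have := hmp.integrable_comp_of_integrable hi
    simpa [Function.comp_def] using this
  rw [gainOp_eq_translate, gainOp_eq_translate, ← integral_sub (hint _) (hint _)]
  refine (enorm_integral_le_lintegral_enorm _).trans ?_
  have hk : ∀ ζ : Vel, Measurable fun w : Vel × ℝ × ℝ => gainKernel γ B ζ (w.1 - ζ) w.2.1 w.2.2 :=
    fun ζ => measurable_gainKernel γ hB.measurable (by fun_prop) (by fun_prop) (by fun_prop)
      (by fun_prop)
  have hk1 := hk ξ
  have hk2 := hk (ξ + t • e)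
  simp only [← mul_sub, enorm_mul]
  rw [lintegral_prod _ (by fun_prop)]
  have haxis : ∀ᵐ η : Vel, 0 < (η - ξ) 1 ^ 2 + (η - ξ) 2 ^ 2 :=
    (measurePreserving_sub_right volume ξ).quasiMeasurePreserving.ae ae_axis_ne_zero
  have h1 : ∀ᵐ η : Vel, ∫⁻ z, ‖f η‖ₑ * ‖gainKernel γ B (ξ + t • e) (η - (ξ + t • e)) z.1 z.2 -
        gainKernel γ B ξ (η - ξ) z.1 z.2‖ₑ ∂angMeasure ≤
      ENNReal.ofReal (C * t ^ δ) * (ENNReal.ofReal (Real.exp (‖ξ‖ ^ 2 / 16)) *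
        (‖f η‖ₑ * ‖gainMajorant δ (η - ξ)‖ₑ) +
        ENNReal.ofReal (Real.exp (‖ξ + t • e‖ ^ 2 / 16)) *
        (‖f η‖ₑ * ‖gainMajorant δ (η - (ξ + t • e))‖ₑ)) := by
    filter_upwards [haxis] with η hη
    have hkv1 : Measurable fun w : ℝ × ℝ => gainKernel γ B ξ (η - ξ) w.1 w.2 :=
      hk1.comp (measurable_const.prodMk measurable_id)
    have hkv2 : Measurable fun w : ℝ × ℝ =>
        gainKernel γ B (ξ + t • e) (η - (ξ + t • e)) w.1 w.2 :=
      hk2.comp (measurable_const.prodMk measurable_id)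
    have hpos : ∀ v, 0 ≤ gainMajorant δ v := fun v => by unfold gainMajorant; positivity
    have hb := h (η - ξ) hη ξ t ht
    rw [sub_sub] at hb
    rw [lintegral_const_mul _ (by fun_prop), Real.enorm_eq_ofReal (hpos _),
      Real.enorm_eq_ofReal (hpos _)]
    refine (mul_le_mul_right hb _).trans (le_of_eq ?_)
    rw [← mul_assoc C, ENNReal.ofReal_mul (by positivity),
          ENNReal.ofReal_add (mul_nonneg (Real.exp_pos _).le (hpos _))
            (mul_nonneg (Real.exp_pos _).le (hpos _)),
          ENNReal.ofReal_mul (Real.exp_pos _).le, ENNReal.ofReal_mul (Real.exp_pos _).le]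
    ring
  refine (lintegral_mono_ae h1).trans ?_
  have hms : ∀ ζ : Vel, Measurable fun η => gainMajorant δ (η - ζ) := fun ζ =>
    hm.comp (by fun_prop)
  have hms1 := hms ξ
  have hms2 := hms (ξ + t • e)
  rw [lintegral_const_mul _ (by fun_prop), lintegral_add_left (by fun_prop),
    lintegral_const_mul _ (by fun_prop), lintegral_const_mul _ (by fun_prop)]
  have h2 : ∀ ζ : Vel, ∫⁻ η, ‖f η‖ₑ * ‖gainMajorant δ (η - ζ)‖ₑ ≤
      eLpNorm f 2 volume * eLpNorm (gainMajorant δ) 2 volume := by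
    intro ζ
    have := lintegral_enorm_mul_le (μ := (volume : Measure Vel)) (f := f)
      (g := fun η => gainMajorant δ (η - ζ)) hf.aestronglyMeasurable
      (hms ζ).aestronglyMeasurable 2 2
    rwa [eLpNorm_comp_sub _ hm] at this
  calc _ ≤ ENNReal.ofReal (C * t ^ δ) * (ENNReal.ofReal (Real.exp (‖ξ‖ ^ 2 / 16)) *
        (eLpNorm f 2 volume * eLpNorm (gainMajorant δ) 2 volume) +
        ENNReal.ofReal (Real.exp (‖ξ + t • e‖ ^ 2 / 16)) *
        (eLpNorm f 2 volume * eLpNorm (gainMajorant δ) 2 volume)) := by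
        gcongr
        · exact h2 ξ
        · exact h2 (ξ + t • e)
    _ = _ := by
      rw [ENNReal.coe_mul, ENNReal.coe_toNNReal hM.2.ne, ENNReal.ofReal_mul hC.le,
        ENNReal.ofReal_mul (Real.rpow_nonneg ht δ),
        ENNReal.ofReal_add (Real.exp_pos _).le (Real.exp_pos _).le,
        show ((Real.toNNReal C : ℝ≥0) : ℝ≥0∞) = ENNReal.ofReal C from rfl]
      ring

/-! ### The frame of the collision operator -/

theorem norm_frame₁ (V : Vel) : inner ℝ (frame₁ V) (frame₁ V) = (1 : ℝ) ∧
    inner ℝ V (frame₁ V) = (0 : ℝ) ∨ V 0 ^ 2 + V 1 ^ 2 = 0 := by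
  by_cases h : V 0 ^ 2 + V 1 ^ 2 = 0
  · exact Or.inr h
  · left
    have h0 : 0 < V 0 ^ 2 + V 1 ^ 2 := lt_of_le_of_ne (by positivity) (Ne.symm h)
    have hρ : √(V 0 ^ 2 + V 1 ^ 2) ^ 2 = V 0 ^ 2 + V 1 ^ 2 := Real.sq_sqrt h0.le
    have hρ0 : 0 < √(V 0 ^ 2 + V 1 ^ 2) := Real.sqrt_pos.2 h0
    rw [frame₁, if_neg h]
    simp only [inner_smul_left, inner_smul_right, inner_vel]
    simp
    set ρ := √(V 0 ^ 2 + V 1 ^ 2)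
    constructor
    · field_simp
      linear_combination -hρ
    · right; ring

theorem orthonormal_frame {V : Vel} (hV : V 0 ^ 2 + V 1 ^ 2 ≠ 0) :
    Orthonormal ℝ ![‖V‖⁻¹ • V, frame₁ V, frame₂ V] := by
  obtain ⟨h1, h2⟩ := (norm_frame₁ V).resolve_right hV
  have hn := norm_sq_vel V
  have hn0 : ‖V‖ ≠ 0 := by
    rw [norm_ne_zero_iff]; rintro rfl; simp at hV
  rw [inner_vel] at h1 h2
  refine orthonormal_of_coords ?_ ?_ ?_ ?_ ?_ ?_
  all_goals
    simp only [frame₂, inner_smul_left, inner_smul_right, inner_vel]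
    try simp
  all_goals
    generalize frame₁ V 0 = a at *
    generalize frame₁ V 1 = b at *
    generalize frame₁ V 2 = c at *
    try field_simp
  · linear_combination -hn
  · linear_combination h1
  · linear_combination (V 0 ^ 2 + V 1 ^ 2 + V 2 ^ 2) * h1 - hn -
      (V 0 * a + V 1 * b + V 2 * c) * h2
  · right; linear_combination h2
  · right; ring
  · right; ring

theorem ae_frame : ∀ᵐ V : Vel, V 0 ^ 2 + V 1 ^ 2 ≠ 0 := by
  have h : ∀ᵐ y : ℝ × ℝ × ℝ, y.2.1 ≠ 0 := by
    have h1 : ∀ᵐ a : ℝ, a ≠ 0 := by simp [ae_iff]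
    have h2 : ∀ᵐ a : ℝ × ℝ, a.1 ≠ 0 :=
      Measure.quasiMeasurePreserving_fst.ae h1
    exact Measure.quasiMeasurePreserving_snd.ae h2
  filter_upwards [measurePreserving_velCoord.quasiMeasurePreserving.ae h] with v hv
  simp only [velCoord_apply] at hv
  positivity

theorem measurable_frame₁ : Measurable frame₁ := by
  unfold frame₁
  refine Measurable.ite (measurableSet_eq_fun (by fun_prop) (by fun_prop)) measurable_const ?_
  have h : Measurable fun V : Vel => (!₂[-V 1, V 0, 0] : Vel) :=
    measurable_vel_mk.comp (f := fun V : Vel => (-V 1, V 0, (0 : ℝ))) (by fun_prop)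
  fun_prop

theorem measurable_frame₂ : Measurable frame₂ := by
  have h1 := measurable_frame₁
  have h : Measurable fun V : Vel => (!₂[V 1 * frame₁ V 2 - V 2 * frame₁ V 1,
      V 2 * frame₁ V 0 - V 0 * frame₁ V 2, V 0 * frame₁ V 1 - V 1 * frame₁ V 0] : Vel) :=
    measurable_vel_mk.comp (f := fun V : Vel => (V 1 * frame₁ V 2 - V 2 * frame₁ V 1,
      V 2 * frame₁ V 0 - V 0 * frame₁ V 2, V 0 * frame₁ V 1 - V 1 * frame₁ V 0)) (by fun_prop)
  unfold frame₂
  fun_prop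

/-- Moving the azimuth from (0, 2π) to (-π, π) is a shift by π, which reverses both transverse
vectors. -/
theorem Orthonormal.neg_frame {a b c : Vel} (h : Orthonormal ℝ ![a, b, c]) :
    Orthonormal ℝ ![a, -b, -c] := by
  have ha : inner ℝ a a = (1 : ℝ) := by have := h.1 0; simp at this; simp [this]
  have hb : inner ℝ b b = (1 : ℝ) := by have := h.1 1; simp at this; simp [this]
  have hc : inner ℝ c c = (1 : ℝ) := by have := h.1 2; simp at this; simp [this]
  have hab : inner ℝ a b = (0 : ℝ) := h.2 (i := 0) (j := 1) (by decide)
  have hac : inner ℝ a c = (0 : ℝ) := h.2 (i := 0) (j := 2) (by decide)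
  have hbc : inner ℝ b c = (0 : ℝ) := h.2 (i := 1) (j := 2) (by decide)
  refine orthonormal_of_coords ha ?_ ?_ ?_ ?_ ?_
  · rw [inner_neg_neg, hb]
  · rw [inner_neg_neg, hc]
  · rw [inner_neg_right, hab, neg_zero]
  · rw [inner_neg_right, hac, neg_zero]
  · rw [inner_neg_neg, hbc]

/-! ### The change of variables for integrals -/

/-- The transferred velocity in the frame `(V / |V|, f₁ V, f₂ V)`. -/
noncomputable def transfer (f₁ f₂ : Vel → Vel) (V : Vel) (θ ε : ℝ) : Vel :=
  (‖V‖ * Real.cos θ) • frameDir (‖V‖⁻¹ • V) (f₁ V) (f₂ V) θ ε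

theorem measurable_transfer {f₁ f₂ : Vel → Vel} (h₁ : Measurable f₁) (h₂ : Measurable f₂) :
    Measurable fun z : Vel × ℝ × ℝ => transfer f₁ f₂ z.1 z.2.1 z.2.2 := by
  unfold transfer frameDir
  fun_prop

theorem lintegral_transfer {b : ℝ → ℝ≥0∞} (hb : Measurable b) {f₁ f₂ : Vel → Vel}
    (h₁ : Measurable f₁) (h₂ : Measurable f₂)
    (hf : ∀ᵐ V : Vel, Orthonormal ℝ ![‖V‖⁻¹ • V, f₁ V, f₂ V]) {H : Vel × Vel → ℝ≥0∞}
    (hH : Measurable H) :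
    ∫⁻ z : Vel × ℝ × ℝ, b z.2.1 * H (z.1, transfer f₁ f₂ z.1 z.2.1 z.2.2)
      ∂(volume.prod angMeasure) =
    ∫⁻ z : Vel × ℝ × ℝ, b z.2.1 * (ENNReal.ofReal ((Real.cos z.2.1 ^ 3)⁻¹) *
      H (relVel z.1 z.2.1 z.2.2, z.1)) ∂(volume.prod angMeasure) := by
  have hT := measurable_transfer h₁ h₂
  have hR := measurable_relVel
  have hm1 : Measurable fun z : Vel × ℝ × ℝ =>
      b z.2.1 * H (z.1, transfer f₁ f₂ z.1 z.2.1 z.2.2) :=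
    (hb.comp (by fun_prop)).mul (hH.comp (measurable_fst.prodMk hT))
  have hm2 : Measurable fun z : Vel × ℝ × ℝ => b z.2.1 *
      (ENNReal.ofReal ((Real.cos z.2.1 ^ 3)⁻¹) * H (relVel z.1 z.2.1 z.2.2, z.1)) :=
    (hb.comp (by fun_prop)).mul ((by fun_prop : Measurable fun z : Vel × ℝ × ℝ =>
      ENNReal.ofReal ((Real.cos z.2.1 ^ 3)⁻¹)).mul (hH.comp (hR.prodMk measurable_fst)))
  rw [lintegral_prod _ hm1.aemeasurable, lintegral_prod _ hm2.aemeasurable]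
  have e1 : ∀ V : Vel, ∫⁻ y, b y.1 * H (V, transfer f₁ f₂ V y.1 y.2) ∂angMeasure =
      ∫⁻ θ in Ioo 0 (Real.pi / 2), ∫⁻ ε in Ioo (-Real.pi) Real.pi,
      b θ * H (V, (‖V‖ * Real.cos θ) • frameDir (‖V‖⁻¹ • V) (f₁ V) (f₂ V) θ ε) := by
    intro V
    rw [angMeasure, lintegral_prod]
    · rfl
    · exact (hm1.comp (measurable_const.prodMk measurable_id)).aemeasurable
  have e2 : ∀ᵐ v : Vel, ∫⁻ y, b y.1 *
      (ENNReal.ofReal ((Real.cos y.1 ^ 3)⁻¹) * H (relVel v y.1 y.2, v)) ∂angMeasure =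
      ∫⁻ θ in Ioo 0 (Real.pi / 2), ∫⁻ ε in Ioo (-Real.pi) Real.pi,
      b θ * (ENNReal.ofReal ((Real.cos θ ^ 3)⁻¹) *
        H ((‖v‖ / Real.cos θ) • frameDir (‖v‖⁻¹ • v) (axisFrame₁ v) (‖v‖⁻¹ • axisNormal v) θ ε,
          v)) := by
    filter_upwards [ae_axis_ne_zero] with v hv
    rw [angMeasure, lintegral_prod]
    · refine setLIntegral_congr_fun measurableSet_Ioo fun θ hθ => ?_
      simp only [relVel_eq hv (cos_pos_of_mem hθ)]
    · exact (hm2.comp (measurable_const.prodMk measurable_id)).aemeasurable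
  simp only [e1]
  rw [lintegral_congr_ae e2]
  exact lintegral_collision_swap hb hf (by
    filter_upwards [ae_axis_ne_zero] with v hv
    exact orthonormal_axisFrame hv) H hH

/-- The transferred velocity does not charge null sets. -/
theorem quasiMeasurePreserving_transfer {f₁ f₂ : Vel → Vel}
    (h₁ : Measurable f₁) (h₂ : Measurable f₂)
    (hf : ∀ᵐ V : Vel, Orthonormal ℝ ![‖V‖⁻¹ • V, f₁ V, f₂ V]) :
    Measure.QuasiMeasurePreserving (fun z : Vel × ℝ × ℝ => transfer f₁ f₂ z.1 z.2.1 z.2.2)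
      (volume.prod angMeasure) volume := by
  have hT := measurable_transfer h₁ h₂
  refine ⟨hT, Measure.AbsolutelyContinuous.mk fun s hs h0 => ?_⟩
  have hi : Measurable (s.indicator (1 : Vel → ℝ≥0∞)) := measurable_one.indicator hs
  rw [← lintegral_indicator_one hs, lintegral_map hi hT]
  have := lintegral_transfer (b := fun _ => 1) measurable_const h₁ h₂ hf
    (H := fun p => s.indicator 1 p.2) (hi.comp measurable_snd)
  simp only [one_mul] at this
  rw [this]
  have hz : ∀ᵐ v : Vel, s.indicator (1 : Vel → ℝ≥0∞) v = 0 := by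
    filter_upwards [measure_eq_zero_iff_ae_notMem.1 h0] with v hv
    simp [hv]
  have hz' : ∀ᵐ z : Vel × ℝ × ℝ ∂(volume.prod angMeasure), s.indicator (1 : Vel → ℝ≥0∞) z.1 = 0 :=
    Measure.quasiMeasurePreserving_fst.ae hz
  rw [lintegral_eq_zero_iff' (by fun_prop)]
  filter_upwards [hz'] with z hz
  simp [hz]

/-- The change of variables as an equality of measures: it then applies to signed integrands and
transports integrability as well. -/
theorem map_transfer_eq {b : ℝ → ℝ≥0∞} (hb : Measurable b) {f₁ f₂ : Vel → Vel}
    (h₁ : Measurable f₁) (h₂ : Measurable f₂)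
    (hf : ∀ᵐ V : Vel, Orthonormal ℝ ![‖V‖⁻¹ • V, f₁ V, f₂ V]) :
    Measure.map (fun z : Vel × ℝ × ℝ => (z.1, transfer f₁ f₂ z.1 z.2.1 z.2.2))
      ((volume.prod angMeasure).withDensity fun z => b z.2.1) =
    Measure.map (fun z : Vel × ℝ × ℝ => (relVel z.1 z.2.1 z.2.2, z.1))
      ((volume.prod angMeasure).withDensity fun z =>
        b z.2.1 * ENNReal.ofReal ((Real.cos z.2.1 ^ 3)⁻¹)) := by
  have hT := measurable_fst.prodMk (measurable_transfer h₁ h₂)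
  have hR := measurable_relVel.prodMk (measurable_fst (α := Vel) (β := ℝ × ℝ))
  have hb1 : Measurable fun z : Vel × ℝ × ℝ => b z.2.1 := hb.comp (by fun_prop)
  have hb2 : Measurable fun z : Vel × ℝ × ℝ =>
      b z.2.1 * ENNReal.ofReal ((Real.cos z.2.1 ^ 3)⁻¹) := by fun_prop
  refine Measure.ext fun s hs => ?_
  have hi : Measurable (s.indicator (1 : Vel × Vel → ℝ≥0∞)) := measurable_one.indicator hs
  have hiT : Measurable fun z : Vel × ℝ × ℝ => s.indicator (1 : Vel × Vel → ℝ≥0∞)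
      (z.1, transfer f₁ f₂ z.1 z.2.1 z.2.2) := hi.comp hT
  have hiR : Measurable fun z : Vel × ℝ × ℝ => s.indicator (1 : Vel × Vel → ℝ≥0∞)
      (relVel z.1 z.2.1 z.2.2, z.1) := hi.comp hR
  rw [← lintegral_indicator_one hs, lintegral_map hi hT, ← lintegral_indicator_one hs,
    lintegral_map hi hR, lintegral_withDensity_eq_lintegral_mul _ hb1 hiT,
    lintegral_withDensity_eq_lintegral_mul _ hb2 hiR]
  simpa [mul_assoc] using lintegral_transfer hb h₁ h₂ hf hi

theorem integral_transfer {B : ℝ → ℝ} (hB : IsAngularDensity B) {f₁ f₂ : Vel → Vel}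
    (h₁ : Measurable f₁) (h₂ : Measurable f₂)
    (hf : ∀ᵐ V : Vel, Orthonormal ℝ ![‖V‖⁻¹ • V, f₁ V, f₂ V]) {H : Vel × Vel → ℝ}
    (hH : Measurable H) (hint : Integrable (fun z : Vel × ℝ × ℝ => B z.2.1 *
      ((Real.cos z.2.1 ^ 3)⁻¹ * H (relVel z.1 z.2.1 z.2.2, z.1))) (volume.prod angMeasure)) :
    Integrable (fun z : Vel × ℝ × ℝ => B z.2.1 * H (z.1, transfer f₁ f₂ z.1 z.2.1 z.2.2))
      (volume.prod angMeasure) ∧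
    ∫ z : Vel × ℝ × ℝ, B z.2.1 * H (z.1, transfer f₁ f₂ z.1 z.2.1 z.2.2)
      ∂(volume.prod angMeasure) =
    ∫ z : Vel × ℝ × ℝ, B z.2.1 * ((Real.cos z.2.1 ^ 3)⁻¹ * H (relVel z.1 z.2.1 z.2.2, z.1))
      ∂(volume.prod angMeasure) := by
  have hT := measurable_fst.prodMk (measurable_transfer h₁ h₂)
  have hR := measurable_relVel.prodMk (measurable_fst (α := Vel) (β := ℝ × ℝ))
  have hBm := hB.measurable
  have hbm : Measurable fun θ => ENNReal.ofReal (B θ) := by fun_prop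
  have hmap := map_transfer_eq hbm h₁ h₂ hf
  have hae : ∀ᵐ z : Vel × ℝ × ℝ ∂(volume.prod angMeasure), z.2.1 ∈ Ioo 0 (Real.pi / 2) :=
    Measure.quasiMeasurePreserving_snd.ae ae_angMeasure
  set μ := (volume : Measure Vel).prod angMeasure
  have hd1 : Measurable fun z : Vel × ℝ × ℝ => ENNReal.ofReal (B z.2.1) := by fun_prop
  have hd2 : Measurable fun z : Vel × ℝ × ℝ => ENNReal.ofReal (B z.2.1) *
      ENNReal.ofReal ((Real.cos z.2.1 ^ 3)⁻¹) := by fun_prop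
  have heq2 : ∀ᵐ z ∂μ, (ENNReal.ofReal (B z.2.1) * ENNReal.ofReal ((Real.cos z.2.1 ^ 3)⁻¹)).toReal •
      H (relVel z.1 z.2.1 z.2.2, z.1) =
      B z.2.1 * ((Real.cos z.2.1 ^ 3)⁻¹ * H (relVel z.1 z.2.1 z.2.2, z.1)) := by
    filter_upwards [hae] with z hz
    have := cos_pos_of_mem hz
    rw [ENNReal.toReal_mul, ENNReal.toReal_ofReal (hB.nonneg _ hz),
      ENNReal.toReal_ofReal (by positivity), smul_eq_mul, mul_assoc]
  have heq1 : ∀ᵐ z ∂μ, (ENNReal.ofReal (B z.2.1)).toReal •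
      H (z.1, transfer f₁ f₂ z.1 z.2.1 z.2.2) =
      B z.2.1 * H (z.1, transfer f₁ f₂ z.1 z.2.1 z.2.2) := by
    filter_upwards [hae] with z hz
    rw [ENNReal.toReal_ofReal (hB.nonneg _ hz), smul_eq_mul]
  have hfin1 : ∀ᵐ z ∂μ, ENNReal.ofReal (B z.2.1) < ⊤ := by simp
  have hfin2 : ∀ᵐ z ∂μ, ENNReal.ofReal (B z.2.1) *
      ENNReal.ofReal ((Real.cos z.2.1 ^ 3)⁻¹) < ⊤ := by simp [ENNReal.mul_lt_top]
  have i2 : Integrable H (Measure.map (fun z : Vel × ℝ × ℝ => (relVel z.1 z.2.1 z.2.2, z.1))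
      (μ.withDensity fun z => ENNReal.ofReal (B z.2.1) *
        ENNReal.ofReal ((Real.cos z.2.1 ^ 3)⁻¹))) := by
    rw [integrable_map_measure hH.aestronglyMeasurable hR.aemeasurable,
      integrable_withDensity_iff_integrable_smul' hd2 hfin2]
    exact hint.congr (heq2.mono fun z hz => hz.symm)
  constructor
  · have i1 := i2
    rw [← hmap, integrable_map_measure hH.aestronglyMeasurable hT.aemeasurable,
      integrable_withDensity_iff_integrable_smul' hd1 hfin1] at i1
    exact i1.congr heq1
  · have h := congrArg (fun m => ∫ p, H p ∂m) hmap
    rw [integral_map hT.aemeasurable hH.aestronglyMeasurable,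
      integral_map hR.aemeasurable hH.aestronglyMeasurable,
      integral_withDensity_eq_integral_toReal_smul hd1 hfin1,
      integral_withDensity_eq_integral_toReal_smul hd2 hfin2, integral_congr_ae heq1,
      integral_congr_ae heq2] at h
    exact h

/-! ### The linearized collision operator in terms of the gain operator -/

theorem ae_orthonormal_frame :
    ∀ᵐ V : Vel, Orthonormal ℝ ![‖V‖⁻¹ • V, frame₁ V, frame₂ V] := by
  filter_upwards [ae_frame] with V hV
  exact orthonormal_frame hV

theorem ae_orthonormal_neg_frame :
    ∀ᵐ V : Vel, Orthonormal ℝ ![‖V‖⁻¹ • V, -frame₁ V, -frame₂ V] := by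
  filter_upwards [ae_frame] with V hV
  exact Orthonormal.neg_frame (orthonormal_frame hV)

theorem restrict_collisionDomain : (volume : Measure (Vel × ℝ × ℝ)).restrict collisionDomain =
    (volume : Measure Vel).prod ((volume.restrict (Ioo 0 (Real.pi / 2))).prod
      (volume.restrict (Ioo 0 (2 * Real.pi)))) := by
  rw [collisionDomain, Measure.volume_eq_prod, ← Measure.prod_restrict, Measure.restrict_univ,
    Measure.volume_eq_prod, ← Measure.prod_restrict, Measure.restrict_congr_set Ioo_ae_eq_Icc,
    Measure.restrict_congr_set (Ioo_ae_eq_Icc (a := (0 : ℝ)) (b := 2 * Real.pi))]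

theorem measurePreserving_angle_reflect : MeasurePreserving (fun θ : ℝ => Real.pi / 2 - θ)
    (volume.restrict (Ioo 0 (Real.pi / 2))) (volume.restrict (Ioo 0 (Real.pi / 2))) := by
  have := (Measure.measurePreserving_sub_left (volume : Measure ℝ) (Real.pi / 2)).restrict_preimage
    (s := Ioo 0 (Real.pi / 2)) measurableSet_Ioo
  have hs : (fun θ : ℝ => Real.pi / 2 - θ) ⁻¹' Ioo 0 (Real.pi / 2) = Ioo 0 (Real.pi / 2) := by
    ext θ; simp only [mem_preimage, mem_Ioo]; constructor <;> rintro ⟨h1, h2⟩ <;>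
      constructor <;> linarith
  rwa [hs] at this

theorem measurePreserving_azimuth_shift : MeasurePreserving (fun ε : ℝ => ε + Real.pi)
    (volume.restrict (Ioo (-Real.pi) Real.pi)) (volume.restrict (Ioo 0 (2 * Real.pi))) := by
  have := (measurePreserving_add_right (volume : Measure ℝ) Real.pi).restrict_preimage
    (s := Ioo 0 (2 * Real.pi)) measurableSet_Ioo
  have hs : (fun ε : ℝ => ε + Real.pi) ⁻¹' Ioo 0 (2 * Real.pi) = Ioo (-Real.pi) Real.pi := by
    ext θ; simp only [mem_preimage, mem_Ioo]; constructor <;> rintro ⟨h1, h2⟩ <;>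
      constructor <;> linarith
  rwa [hs] at this

theorem measurePreserving_collision (ξ : Vel) :
    MeasurePreserving (fun z : Vel × ℝ × ℝ => (ξ + z.1, z.2.1, z.2.2 + Real.pi))
      (volume.prod angMeasure) (volume.restrict collisionDomain) := by
  rw [restrict_collisionDomain]
  exact (measurePreserving_add_left volume ξ).prod
    ((MeasurePreserving.id _).prod measurePreserving_azimuth_shift)

theorem measurePreserving_collision_reflect (ξ : Vel) :
    MeasurePreserving (fun z : Vel × ℝ × ℝ => (ξ + z.1, Real.pi / 2 - z.2.1, z.2.2 + Real.pi))
      (volume.prod angMeasure) (volume.restrict collisionDomain) := by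
  rw [restrict_collisionDomain]
  exact (measurePreserving_add_left volume ξ).prod
    (measurePreserving_angle_reflect.prod measurePreserving_azimuth_shift)

theorem measurable_collisionDir {α : Type*} [MeasurableSpace α] {V : α → Vel} {θ ε : α → ℝ}
    (hV : Measurable V) (hθ : Measurable θ) (hε : Measurable ε) :
    Measurable fun z => collisionDir (V z) (θ z) (ε z) := by
  have h1 := measurable_frame₁
  have h2 := measurable_frame₂
  unfold collisionDir
  fun_prop

theorem measurable_postVel {α : Type*} [MeasurableSpace α] {ξ ξs : α → Vel} {θ ε : α → ℝ}
    (hξ : Measurable ξ) (hξs : Measurable ξs) (hθ : Measurable θ) (hε : Measurable ε) :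
    Measurable fun z => postVel (ξ z) (ξs z) (θ z) (ε z) := by
  have h : Measurable fun z => collisionDir (ξs z - ξ z) (θ z) (ε z) :=
    measurable_collisionDir (hξs.sub hξ) hθ hε
  unfold postVel
  fun_prop

theorem measurable_postVelStar {α : Type*} [MeasurableSpace α] {ξ ξs : α → Vel} {θ ε : α → ℝ}
    (hξ : Measurable ξ) (hξs : Measurable ξs) (hθ : Measurable θ) (hε : Measurable ε) :
    Measurable fun z => postVelStar (ξ z) (ξs z) (θ z) (ε z) := by
  have h : Measurable fun z => collisionDir (ξs z - ξ z) (θ z) (ε z) :=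
    measurable_collisionDir (hξs.sub hξ) hθ hε
  unfold postVelStar
  fun_prop

theorem inner_collisionDir {V : Vel} (hV : V 0 ^ 2 + V 1 ^ 2 ≠ 0) (θ ε : ℝ) :
    inner ℝ (collisionDir V θ ε) V = ‖V‖ * Real.cos θ := by
  have h := inner_frameDir (orthonormal_frame hV) θ ε
  have hn0 : ‖V‖ ≠ 0 := by
    rw [norm_ne_zero_iff]; rintro rfl; simp at hV
  rw [inner_smul_right, inv_mul_eq_iff_eq_mul₀ hn0] at h
  exact h

theorem postVel_eq {V : Vel} (hV : V 0 ^ 2 + V 1 ^ 2 ≠ 0) (ξ : Vel) (θ ε : ℝ) :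
    postVel ξ (ξ + V) θ (ε + Real.pi) =
      ξ + transfer (fun V => -frame₁ V) (fun V => -frame₂ V) V θ ε := by
  rw [postVel, add_sub_cancel_left, inner_collisionDir hV, transfer, collisionDir, frameDir,
    Real.cos_add_pi, Real.sin_add_pi]
  simp

theorem postVelStar_eq_sub (ξ ξs : Vel) (θ ε : ℝ) :
    postVelStar ξ ξs θ ε = ξ + ξs - postVel ξ ξs θ ε := by
  rw [postVel, postVelStar]; abel

/-- V - (a·V)a lies in the plane of V and a and is orthogonal to a, hence has polar angle π/2 - θ on
the opposite side of V. Reflecting θ and turning the azimuth by π therefore makes ξ_*' - ξ a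
transferred velocity. -/
theorem postVelStar_reflect_eq {V : Vel} (hV : V 0 ^ 2 + V 1 ^ 2 ≠ 0) (ξ : Vel) (θ ε : ℝ) :
    postVelStar ξ (ξ + V) (Real.pi / 2 - θ) (ε + Real.pi) = ξ + transfer frame₁ frame₂ V θ ε := by
  have hn0 : ‖V‖ ≠ 0 := by
    rw [norm_ne_zero_iff]; rintro rfl; simp at hV
  rw [postVelStar, add_sub_cancel_left, inner_collisionDir hV, transfer, collisionDir, frameDir,
    Real.cos_add_pi, Real.sin_add_pi, Real.cos_pi_div_two_sub, Real.sin_pi_div_two_sub,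
    add_sub_assoc]
  congr 1
  have h1 : V = (‖V‖ * (Real.sin θ ^ 2 + Real.cos θ ^ 2)) • (‖V‖⁻¹ • V) := by
    rw [Real.sin_sq_add_cos_sq, mul_one, smul_smul, mul_inv_cancel₀ hn0, one_smul]
  nth_rewrite 1 [h1]
  module

theorem inner_transfer {f₁ f₂ : Vel → Vel} {V : Vel}
    (hV : Orthonormal ℝ ![‖V‖⁻¹ • V, f₁ V, f₂ V]) (θ ε : ℝ) :
    inner ℝ V (transfer f₁ f₂ V θ ε) = ‖transfer f₁ f₂ V θ ε‖ ^ 2 := by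
  have h := inner_frameDir hV θ ε
  have hn := norm_frameDir hV θ ε
  have hn0 : ‖V‖ ≠ 0 := by
    have := hV.1 0
    rintro h0
    simp [h0] at this
  rw [inner_smul_right, inv_mul_eq_iff_eq_mul₀ hn0] at h
  rw [transfer, inner_smul_right, real_inner_comm, h, norm_smul, hn, Real.norm_eq_abs, mul_one,
    sq_abs]
  ring

theorem sqrt_maxwellian (ζ : Vel) :
    √(maxwellian ζ) = √((√Real.pi ^ 3)⁻¹) * Real.exp (-‖ζ‖ ^ 2 / 2) := by
  rw [maxwellian, Real.sqrt_mul (by positivity), ← Real.exp_half]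

theorem maxwellian_pos (ζ : Vel) : 0 < maxwellian ζ := by
  unfold maxwellian; positivity

/-- Conservation of energy. The hypothesis gives w(ξ + v) w(ξ + V - v) = w(ξ) w(ξ + V); dividing
√w(ξ) out leaves the square root of w(ξ + V) w(ξ + V - v), and the parallelogram identity centres
that Gaussian at ξ + V - v/2. -/
theorem gain_weight_identity {V v : Vel} (h : inner ℝ V v = ‖v‖ ^ 2) (ξ : Vel) :
    √(maxwellian (ξ + v)) * maxwellian (ξ + V - v) =
      √(maxwellian ξ) * ((√Real.pi ^ 3)⁻¹ * gainGauss ξ V v) := by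
  rw [sqrt_maxwellian, sqrt_maxwellian, maxwellian, gainGauss]
  have e1 : ‖ξ + v‖ ^ 2 = ‖ξ‖ ^ 2 + 2 * inner ℝ ξ v + ‖v‖ ^ 2 := norm_add_sq_real _ _
  have e2 : ‖ξ + V - v‖ ^ 2 = ‖ξ + V‖ ^ 2 - 2 * inner ℝ (ξ + V) v + ‖v‖ ^ 2 := norm_sub_sq_real _ _
  have e3 : ‖ξ + V - (1 / 2 : ℝ) • v‖ ^ 2 =
      ‖ξ + V‖ ^ 2 - 2 * inner ℝ (ξ + V) ((1 / 2 : ℝ) • v) + ‖(1 / 2 : ℝ) • v‖ ^ 2 :=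
    norm_sub_sq_real _ _
  rw [inner_add_left] at e2
  rw [inner_smul_right, inner_add_left, norm_smul, h] at e3
  rw [h] at e2
  norm_num at e3
  have : Real.exp (-‖ξ + v‖ ^ 2 / 2) * Real.exp (-‖ξ + V - v‖ ^ 2) = Real.exp (-‖ξ‖ ^ 2 / 2) *
      Real.exp (-(‖ξ + V - (1 / 2 : ℝ) • v‖ ^ 2 + (‖v‖ / 2) ^ 2)) := by
    rw [← Real.exp_add, ← Real.exp_add]
    congr 1
    norm_num
    rw [e1, e2, e3]
    ring
  calc _ = √((√Real.pi ^ 3)⁻¹) * (√Real.pi ^ 3)⁻¹ *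
        (Real.exp (-‖ξ + v‖ ^ 2 / 2) * Real.exp (-‖ξ + V - v‖ ^ 2)) := by ring
    _ = _ := by rw [this]; ring

theorem IsCutoffPowerLaw.isAngularDensity {γ : ℝ} {β : ℝ → ℝ} (h : IsCutoffPowerLaw γ β) :
    IsAngularDensity β := by
  obtain ⟨C, hC⟩ := h.le_cos_mul_sin
  refine ⟨h.measurable, fun θ hθ => h.nonneg θ (Ioo_subset_Icc_self hθ), max C 0,
    le_max_right _ _, fun θ hθ => (hC θ (Ioo_subset_Icc_self hθ)).trans ?_⟩
  have := cos_pos_of_mem hθ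
  have := sin_pos_of_mem hθ
  gcongr
  exact le_max_left _ _

/-- cos θ sin θ is invariant under θ ↦ π/2 - θ, so both gain terms obey the same estimates. -/
theorem IsAngularDensity.reflect {B : ℝ → ℝ} (h : IsAngularDensity B) :
    IsAngularDensity fun θ => B (Real.pi / 2 - θ) := by
  obtain ⟨K, hK, hBK⟩ := h.le_cos_mul_sin
  have hmem : ∀ θ ∈ Ioo 0 (Real.pi / 2), Real.pi / 2 - θ ∈ Ioo 0 (Real.pi / 2) := fun θ hθ =>
    ⟨by linarith [hθ.2], by linarith [hθ.1]⟩
  have := h.measurable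
  refine ⟨by fun_prop, fun θ hθ => h.nonneg _ (hmem θ hθ), K, hK, fun θ hθ => ?_⟩
  have := hBK _ (hmem θ hθ)
  rw [Real.cos_pi_div_two_sub, Real.sin_pi_div_two_sub] at this
  linarith

/-- The part of the gain term with `f(ξ')`. -/
theorem gain_term_eq {γ : ℝ} {β : ℝ → ℝ} (hβ : IsAngularDensity β) (hγ : 0 < γ)
    {f : Vel → ℝ} (hf : Measurable f) (hf2 : eLpNorm f 2 volume < ⊤) (ξ : Vel) :
    IntegrableOn (fun c : Vel × ℝ × ℝ => √(maxwellian (postVel ξ c.1 c.2.1 c.2.2)) *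
      f (postVel ξ c.1 c.2.1 c.2.2) * maxwellian (postVelStar ξ c.1 c.2.1 c.2.2) *
      crossSection γ β ‖c.1 - ξ‖ c.2.1) collisionDomain ∧
    ∫ c in collisionDomain, √(maxwellian (postVel ξ c.1 c.2.1 c.2.2)) *
      f (postVel ξ c.1 c.2.1 c.2.2) * maxwellian (postVelStar ξ c.1 c.2.1 c.2.2) *
      crossSection γ β ‖c.1 - ξ‖ c.2.1 = √(maxwellian ξ) * gainOp γ β f ξ := by
  obtain ⟨C, hC⟩ := exists_lintegral_gainOp_le hβ (δ := 1 / 8) (by norm_num) le_rfl hγ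
  have hβm := hβ.measurable
  have hM : Measurable maxwellian := by unfold maxwellian; fun_prop
  set H : Vel × Vel → ℝ := fun p => gainWeight γ ξ p.1 p.2 * f (ξ + p.2) with hH
  have hHm : Measurable H := (measurable_gainWeight γ (by fun_prop) (by fun_prop)
    (by fun_prop)).mul (hf.comp (by fun_prop))
  have hint : Integrable (fun z : Vel × ℝ × ℝ => β z.2.1 *
      ((Real.cos z.2.1 ^ 3)⁻¹ * H (relVel z.1 z.2.1 z.2.2, z.1))) (volume.prod angMeasure) := by
    have hi : Integrable (fun z : Vel × ℝ × ℝ =>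
        f (ξ + z.1) * gainKernel γ β ξ z.1 z.2.1 z.2.2) (volume.prod angMeasure) := by
      refine ⟨((measurable_gainOp_integrand hβm hf).comp
        (measurable_const.prodMk measurable_id)).aestronglyMeasurable, (hC f hf ξ).trans_lt ?_⟩
      exact ENNReal.mul_lt_top (ENNReal.mul_lt_top ENNReal.coe_lt_top ENNReal.ofReal_lt_top) hf2
    refine hi.congr (Eventually.of_forall fun z => ?_)
    simp only [hH, gainKernel]
    ring
  obtain ⟨h1, h2⟩ := integral_transfer hβ (f₁ := fun V => -frame₁ V) (f₂ := fun V => -frame₂ V)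
    measurable_frame₁.neg measurable_frame₂.neg ae_orthonormal_neg_frame hHm hint
  have hS := measurePreserving_collision ξ
  set g : Vel × ℝ × ℝ → ℝ := fun c => √(maxwellian (postVel ξ c.1 c.2.1 c.2.2)) *
      f (postVel ξ c.1 c.2.1 c.2.2) * maxwellian (postVelStar ξ c.1 c.2.1 c.2.2) *
      crossSection γ β ‖c.1 - ξ‖ c.2.1 with hg
  have hgm : Measurable g := by
    have p1 : Measurable fun c : Vel × ℝ × ℝ => postVel ξ c.1 c.2.1 c.2.2 :=
      measurable_postVel (by fun_prop) (by fun_prop) (by fun_prop) (by fun_prop)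
    have p2 : Measurable fun c : Vel × ℝ × ℝ => postVelStar ξ c.1 c.2.1 c.2.2 :=
      measurable_postVelStar (by fun_prop) (by fun_prop) (by fun_prop) (by fun_prop)
    simp only [hg, crossSection]
    fun_prop
  have hframe : ∀ᵐ z : Vel × ℝ × ℝ ∂(volume.prod angMeasure), z.1 0 ^ 2 + z.1 1 ^ 2 ≠ 0 :=
    Measure.quasiMeasurePreserving_fst.ae ae_frame
  have hcomp : ∀ᵐ z : Vel × ℝ × ℝ ∂(volume.prod angMeasure),
      √(maxwellian ξ) * (β z.2.1 * H (z.1, transfer (fun V => -frame₁ V) (fun V => -frame₂ V)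
        z.1 z.2.1 z.2.2)) = g (ξ + z.1, z.2.1, z.2.2 + Real.pi) := by
    filter_upwards [hframe] with z hz
    have hid := gain_weight_identity (inner_transfer (f₁ := fun V => -frame₁ V)
      (f₂ := fun V => -frame₂ V) (Orthonormal.neg_frame (orthonormal_frame hz)) z.2.1 z.2.2) ξ
    simp only [hg, hH, postVelStar_eq_sub, postVel_eq hz, gainWeight, crossSection,
      add_sub_cancel_left]
    rw [show ξ + (ξ + z.1) - (ξ + transfer (fun V => -frame₁ V) (fun V => -frame₂ V)
        z.1 z.2.1 z.2.2) = ξ + z.1 - transfer (fun V => -frame₁ V) (fun V => -frame₂ V)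
        z.1 z.2.1 z.2.2 by abel]
    linear_combination (-(‖z.1‖ ^ γ * β z.2.1 * f (ξ + transfer (fun V => -frame₁ V)
      (fun V => -frame₂ V) z.1 z.2.1 z.2.2))) * hid
  constructor
  · refine (hS.integrable_comp hgm.aestronglyMeasurable).1 ?_
    exact (h1.const_mul _).congr hcomp
  · have e1 : ∫ c in collisionDomain, g c =
        ∫ z, g (ξ + z.1, z.2.1, z.2.2 + Real.pi) ∂(volume.prod angMeasure) := by
      rw [← hS.map_eq, integral_map hS.measurable.aemeasurable hgm.aestronglyMeasurable]
    rw [e1, ← integral_congr_ae hcomp, integral_const_mul, h2, gainOp]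
    congr 1
    refine integral_congr_ae (Eventually.of_forall fun z => ?_)
    simp only [hH, gainKernel]
    ring

/-- The part of the gain term with `f(ξ_*')`. -/
theorem gain_term_star_eq {γ : ℝ} {β : ℝ → ℝ} (hβ : IsAngularDensity β) (hγ : 0 < γ)
    {f : Vel → ℝ} (hf : Measurable f) (hf2 : eLpNorm f 2 volume < ⊤) (ξ : Vel) :
    IntegrableOn (fun c : Vel × ℝ × ℝ => maxwellian (postVel ξ c.1 c.2.1 c.2.2) *
      (√(maxwellian (postVelStar ξ c.1 c.2.1 c.2.2)) * f (postVelStar ξ c.1 c.2.1 c.2.2)) *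
      crossSection γ β ‖c.1 - ξ‖ c.2.1) collisionDomain ∧
    ∫ c in collisionDomain, maxwellian (postVel ξ c.1 c.2.1 c.2.2) *
      (√(maxwellian (postVelStar ξ c.1 c.2.1 c.2.2)) * f (postVelStar ξ c.1 c.2.1 c.2.2)) *
      crossSection γ β ‖c.1 - ξ‖ c.2.1 =
        √(maxwellian ξ) * gainOp γ (fun θ => β (Real.pi / 2 - θ)) f ξ := by
  have hβ' := hβ.reflect
  obtain ⟨C, hC⟩ := exists_lintegral_gainOp_le hβ' (δ := 1 / 8) (by norm_num) le_rfl hγ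
  have hβm := hβ.measurable
  have hM : Measurable maxwellian := by unfold maxwellian; fun_prop
  set H : Vel × Vel → ℝ := fun p => gainWeight γ ξ p.1 p.2 * f (ξ + p.2) with hH
  have hHm : Measurable H := (measurable_gainWeight γ (by fun_prop) (by fun_prop)
    (by fun_prop)).mul (hf.comp (by fun_prop))
  have hint : Integrable (fun z : Vel × ℝ × ℝ => β (Real.pi / 2 - z.2.1) *
      ((Real.cos z.2.1 ^ 3)⁻¹ * H (relVel z.1 z.2.1 z.2.2, z.1))) (volume.prod angMeasure) := by
    have hi : Integrable (fun z : Vel × ℝ × ℝ =>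
        f (ξ + z.1) * gainKernel γ (fun θ => β (Real.pi / 2 - θ)) ξ z.1 z.2.1 z.2.2)
        (volume.prod angMeasure) := by
      refine ⟨((measurable_gainOp_integrand hβ'.measurable hf).comp
        (measurable_const.prodMk measurable_id)).aestronglyMeasurable, (hC f hf ξ).trans_lt ?_⟩
      exact ENNReal.mul_lt_top (ENNReal.mul_lt_top ENNReal.coe_lt_top ENNReal.ofReal_lt_top) hf2
    refine hi.congr (Eventually.of_forall fun z => ?_)
    simp only [hH, gainKernel]
    ring
  obtain ⟨h1, h2⟩ := integral_transfer hβ' measurable_frame₁ measurable_frame₂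
    ae_orthonormal_frame hHm hint
  have hS := measurePreserving_collision_reflect ξ
  set g : Vel × ℝ × ℝ → ℝ := fun c => maxwellian (postVel ξ c.1 c.2.1 c.2.2) *
      (√(maxwellian (postVelStar ξ c.1 c.2.1 c.2.2)) * f (postVelStar ξ c.1 c.2.1 c.2.2)) *
      crossSection γ β ‖c.1 - ξ‖ c.2.1 with hg
  have hgm : Measurable g := by
    have p1 : Measurable fun c : Vel × ℝ × ℝ => postVel ξ c.1 c.2.1 c.2.2 :=
      measurable_postVel (by fun_prop) (by fun_prop) (by fun_prop) (by fun_prop)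
    have p2 : Measurable fun c : Vel × ℝ × ℝ => postVelStar ξ c.1 c.2.1 c.2.2 :=
      measurable_postVelStar (by fun_prop) (by fun_prop) (by fun_prop) (by fun_prop)
    simp only [hg, crossSection]
    fun_prop
  have hframe : ∀ᵐ z : Vel × ℝ × ℝ ∂(volume.prod angMeasure), z.1 0 ^ 2 + z.1 1 ^ 2 ≠ 0 :=
    Measure.quasiMeasurePreserving_fst.ae ae_frame
  have hcomp : ∀ᵐ z : Vel × ℝ × ℝ ∂(volume.prod angMeasure),
      √(maxwellian ξ) * (β (Real.pi / 2 - z.2.1) * H (z.1, transfer frame₁ frame₂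
        z.1 z.2.1 z.2.2)) = g (ξ + z.1, Real.pi / 2 - z.2.1, z.2.2 + Real.pi) := by
    filter_upwards [hframe] with z hz
    have hid := gain_weight_identity (inner_transfer (f₁ := frame₁) (f₂ := frame₂)
      (orthonormal_frame hz) z.2.1 z.2.2) ξ
    have hpost : postVel ξ (ξ + z.1) (Real.pi / 2 - z.2.1) (z.2.2 + Real.pi) =
        ξ + z.1 - transfer frame₁ frame₂ z.1 z.2.1 z.2.2 := by
      have h3 := postVelStar_eq_sub ξ (ξ + z.1) (Real.pi / 2 - z.2.1) (z.2.2 + Real.pi)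
      rw [postVelStar_reflect_eq hz] at h3
      rw [eq_sub_iff_add_eq] at h3 ⊢
      rw [add_assoc, add_right_inj] at h3
      rw [add_comm]
      exact h3
    simp only [hg, hH, hpost, postVelStar_reflect_eq hz, gainWeight, crossSection,
      add_sub_cancel_left]
    linear_combination (-(‖z.1‖ ^ γ * β (Real.pi / 2 - z.2.1) * f (ξ + transfer frame₁ frame₂
      z.1 z.2.1 z.2.2))) * hid
  constructor
  · refine (hS.integrable_comp hgm.aestronglyMeasurable).1 ?_
    exact (h1.const_mul _).congr hcomp
  · have e1 : ∫ c in collisionDomain, g c = ∫ z, g (ξ + z.1, Real.pi / 2 - z.2.1,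
        z.2.2 + Real.pi) ∂(volume.prod angMeasure) := by
      rw [← hS.map_eq, integral_map hS.measurable.aemeasurable hgm.aestronglyMeasurable]
    rw [e1, ← integral_congr_ae hcomp, integral_const_mul, h2, gainOp]
    congr 1
    refine integral_congr_ae (Eventually.of_forall fun z => ?_)
    simp only [hH, gainKernel]
    ring

/-! ### Gaussian moments -/

theorem integrable_norm_rpow_mul_exp {a b : ℝ} (ha : 0 ≤ a) (hb : 0 < b) :
    Integrable fun η : Vel => ‖η‖ ^ a * Real.exp (-b * ‖η‖ ^ 2) := by
  have h1 : IntegrableOn (fun y : ℝ => y ^ (Module.finrank ℝ Vel - 1) •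
      (y ^ a * Real.exp (-b * y ^ 2))) (Ioi 0) := by
    have h2 := integrableOn_rpow_mul_exp_neg_mul_sq hb (s := a + 2) (by linarith)
    refine h2.congr_fun (fun y hy => ?_) measurableSet_Ioi
    have hy : 0 < y := hy
    simp only [finrank_euclideanSpace, Fintype.card_fin, smul_eq_mul]
    rw [Real.rpow_add hy, ← Real.rpow_natCast y (3 - 1)]
    norm_num
    ring
  exact (integrable_fun_norm_addHaar (volume : Measure Vel)
    (f := fun y => y ^ a * Real.exp (-b * y ^ 2))).2 h1

theorem measurable_maxwellian : Measurable maxwellian := by unfold maxwellian; fun_prop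

theorem integrable_norm_rpow_mul_maxwellian {a : ℝ} (ha : 0 ≤ a) :
    Integrable fun η : Vel => ‖η‖ ^ a * maxwellian η := by
  refine ((integrable_norm_rpow_mul_exp ha one_pos).const_mul ((√Real.pi ^ 3)⁻¹)).congr
    (Eventually.of_forall fun η => ?_)
  simp only [maxwellian]
  rw [neg_one_mul]; ring

theorem integrable_maxwellian : Integrable maxwellian := by
  simpa using integrable_norm_rpow_mul_maxwellian (a := 0) le_rfl

theorem norm_sub_rpow_le {γ : ℝ} (h0 : 0 ≤ γ) (h1 : γ ≤ 1) (η ξ : Vel) :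
    ‖η - ξ‖ ^ γ ≤ ‖η‖ ^ γ + ‖ξ‖ ^ γ :=
  (Real.rpow_le_rpow (norm_nonneg _) (norm_sub_le _ _) h0).trans
    (Real.rpow_add_le_add_rpow (norm_nonneg _) (norm_nonneg _) h0 h1)

/-- For 0 < γ ≤ 1 the function ‖x - y‖^γ is again a metric; this is its reverse triangle inequality.
-/
theorem abs_norm_sub_rpow_sub_le {γ : ℝ} (h0 : 0 ≤ γ) (h1 : γ ≤ 1) (η ξ ξ' : Vel) :
    |‖η - ξ'‖ ^ γ - ‖η - ξ‖ ^ γ| ≤ ‖ξ' - ξ‖ ^ γ := by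
  have e1 := norm_sub_rpow_le h0 h1 (η - ξ') (ξ - ξ')
  have e2 := norm_sub_rpow_le h0 h1 (η - ξ) (ξ' - ξ)
  rw [sub_sub_sub_cancel_right] at e1 e2
  rw [norm_sub_rev ξ ξ'] at e1
  rw [abs_le]
  constructor <;> linarith

theorem rpow_le_one_add {x γ : ℝ} (hx : 0 ≤ x) (h0 : 0 ≤ γ) (h1 : γ ≤ 1) : x ^ γ ≤ 1 + x := by
  calc x ^ γ ≤ (1 + x) ^ γ := Real.rpow_le_rpow hx (by linarith) h0
    _ ≤ (1 + x) ^ (1 : ℝ) := Real.rpow_le_rpow_of_exponent_le (by linarith) h1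
    _ = _ := Real.rpow_one _

/-! ### The collision frequency -/

/-- The total angular mass of the cross-section. -/
noncomputable def angularMass (β : ℝ → ℝ) : ℝ :=
  ∫ z : ℝ × ℝ, β z.1 ∂((volume.restrict (Ioo 0 (Real.pi / 2))).prod
    (volume.restrict (Ioo 0 (2 * Real.pi))))

/-- The convolution of the Maxwellian with `|·| ^ γ`. -/
noncomputable def freqProfile (γ : ℝ) (ξ : Vel) : ℝ := ∫ η, maxwellian η * ‖η - ξ‖ ^ γ

theorem integrable_freqProfile {γ : ℝ} (h0 : 0 ≤ γ) (h1 : γ ≤ 1) (ξ : Vel) :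
    Integrable fun η => maxwellian η * ‖η - ξ‖ ^ γ := by
  have hM := measurable_maxwellian
  refine ((integrable_norm_rpow_mul_maxwellian h0).add
    (integrable_maxwellian.const_mul (‖ξ‖ ^ γ))).mono' (by fun_prop)
    (Eventually.of_forall fun η => ?_)
  have hp := maxwellian_pos η
  rw [Real.norm_of_nonneg (by positivity)]
  have := norm_sub_rpow_le h0 h1 η ξ
  simp only [Pi.add_apply]
  nlinarith

theorem integral_collisionDomain_mul (β : ℝ → ℝ) (F : Vel → ℝ) :
    ∫ c in collisionDomain, F c.1 * β c.2.1 = angularMass β * ∫ η, F η := by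
  rw [restrict_collisionDomain, integral_prod_mul F (fun z : ℝ × ℝ => β z.1), angularMass, mul_comm]

theorem collisionFreq_eq (γ : ℝ) (β : ℝ → ℝ) (ξ : Vel) :
    collisionFreq γ β ξ = angularMass β * freqProfile γ ξ := by
  rw [freqProfile, ← integral_collisionDomain_mul, collisionFreq]
  simp only [crossSection, mul_assoc]

theorem IsAngularDensity.integrable {B : ℝ → ℝ} (h : IsAngularDensity B) :
    Integrable (fun z : ℝ × ℝ => B z.1) ((volume.restrict (Ioo 0 (Real.pi / 2))).prod
      (volume.restrict (Ioo 0 (2 * Real.pi)))) := by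
  obtain ⟨K, hK, hBK⟩ := h.le_cos_mul_sin
  have h1 : Integrable B (volume.restrict (Ioo 0 (Real.pi / 2))) := by
    refine (integrable_const K).mono' h.measurable.aestronglyMeasurable ?_
    filter_upwards [ae_restrict_mem measurableSet_Ioo] with θ hθ
    rw [Real.norm_of_nonneg (h.nonneg θ hθ)]
    refine (hBK θ hθ).trans ?_
    have h1 := Real.cos_le_one θ
    have h2 := Real.sin_le_one θ
    have h3 := cos_pos_of_mem hθ
    have h4 := sin_pos_of_mem hθ
    have : Real.cos θ * Real.sin θ ≤ 1 := mul_le_one₀ h1 h4.le h2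
    nlinarith
  exact h1.comp_fst _

theorem IsCutoffPowerLaw.angularMass_pos {γ : ℝ} {β : ℝ → ℝ} (h : IsCutoffPowerLaw γ β) :
    0 < angularMass β := by
  have h1 : angularMass β = (∫ θ in Icc (0 : ℝ) (Real.pi / 2), β θ) * (2 * Real.pi) := by
    have := integral_prod_mul (μ := volume.restrict (Ioo 0 (Real.pi / 2)))
      (ν := volume.restrict (Ioo 0 (2 * Real.pi))) β (fun _ => (1 : ℝ))
    simp only [mul_one] at this
    rw [angularMass, this, integral_Icc_eq_integral_Ioo]
    congr 1
    simp [Real.pi_pos.le]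
  rw [h1]
  have := h.nontrivial
  have := Real.pi_pos
  positivity

theorem stronglyMeasurable_freqProfile (γ : ℝ) : StronglyMeasurable (freqProfile γ) := by
  have hM := measurable_maxwellian
  have : Measurable fun p : Vel × Vel => maxwellian p.2 * ‖p.2 - p.1‖ ^ γ := by fun_prop
  exact this.stronglyMeasurable.integral_prod_right'

theorem freqProfile_le {γ : ℝ} (h0 : 0 ≤ γ) (h1 : γ ≤ 1) (ξ : Vel) :
    freqProfile γ ξ ≤ (∫ η, ‖η‖ ^ γ * maxwellian η) + ‖ξ‖ ^ γ * ∫ η, maxwellian η := by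
  rw [← integral_const_mul, ← integral_add (integrable_norm_rpow_mul_maxwellian h0)
    (integrable_maxwellian.const_mul _)]
  refine integral_mono (integrable_freqProfile h0 h1 ξ)
    ((integrable_norm_rpow_mul_maxwellian h0).add (integrable_maxwellian.const_mul _)) fun η => ?_
  have := norm_sub_rpow_le h0 h1 η ξ
  have hp := maxwellian_pos η
  simp only
  nlinarith

theorem abs_freqProfile_sub_le {γ : ℝ} (h0 : 0 ≤ γ) (h1 : γ ≤ 1) (ξ ξ' : Vel) :
    |freqProfile γ ξ' - freqProfile γ ξ| ≤ (∫ η, maxwellian η) * ‖ξ' - ξ‖ ^ γ := by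
  rw [freqProfile, freqProfile, ← integral_sub (integrable_freqProfile h0 h1 _)
    (integrable_freqProfile h0 h1 _), ← integral_mul_const]
  refine (abs_integral_le_integral_abs).trans (integral_mono_of_nonneg
    (Eventually.of_forall fun _ => abs_nonneg _) (integrable_maxwellian.mul_const _)
    (Eventually.of_forall fun η => ?_))
  have hp := maxwellian_pos η
  simp only
  rw [← mul_sub, abs_mul, abs_of_pos hp]
  gcongr
  exact abs_norm_sub_rpow_sub_le h0 h1 η ξ ξ'

/-- Since 2η = (η - ξ) - (-η - ξ), one of η - ξ and -η - ξ is at least as long as η. Averaging over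
η and -η, which the even weight allows, gives a lower bound independent of ξ. -/
theorem le_freqProfile {γ : ℝ} (h0 : 0 ≤ γ) (h1 : γ ≤ 1) (ξ : Vel) :
    (∫ η, ‖η‖ ^ γ * maxwellian η) ≤ 2 * freqProfile γ ξ := by
  have hneg : ∀ η, maxwellian (-η) = maxwellian η := fun η => by simp [maxwellian]
  have hsym : freqProfile γ ξ = ∫ η, maxwellian η * ‖-η - ξ‖ ^ γ := by
    rw [freqProfile, ← integral_neg_eq_self]
    simp only [hneg]
  have hi := integrable_freqProfile h0 h1 ξ
  have hi' : Integrable fun η => maxwellian η * ‖-η - ξ‖ ^ γ := by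
    have := hi.comp_neg
    simpa only [hneg] using this
  calc (∫ η, ‖η‖ ^ γ * maxwellian η)
      ≤ ∫ η, (maxwellian η * ‖η - ξ‖ ^ γ + maxwellian η * ‖-η - ξ‖ ^ γ) := by
        refine integral_mono (integrable_norm_rpow_mul_maxwellian h0) (hi.add hi') fun η => ?_
        have hp := maxwellian_pos η
        have e1 : ‖η‖ ^ γ ≤ ‖η - ξ‖ ^ γ + ‖-η - ξ‖ ^ γ := by
          have e2 : ‖η‖ ≤ max ‖η - ξ‖ ‖-η - ξ‖ := by
            have e3 : (2 : ℝ) • η = (η - ξ) - (-η - ξ) := by module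
            have e4 := norm_sub_le (η - ξ) (-η - ξ)
            rw [← e3, norm_smul] at e4
            have := le_max_left ‖η - ξ‖ ‖-η - ξ‖
            have := le_max_right ‖η - ξ‖ ‖-η - ξ‖
            norm_num at e4
            linarith
          have p1 := Real.rpow_nonneg (norm_nonneg (η - ξ)) γ
          have p2 := Real.rpow_nonneg (norm_nonneg (-η - ξ)) γ
          have e5 := Real.rpow_le_rpow (norm_nonneg η) e2 h0
          rcases max_choice ‖η - ξ‖ ‖-η - ξ‖ with h | h <;> rw [h] at e5 <;> linarith
        simp only
        nlinarith
    _ = 2 * freqProfile γ ξ := by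
        rw [integral_add hi hi', ← hsym]
        change freqProfile γ ξ + freqProfile γ ξ = _
        ring

theorem integral_norm_rpow_mul_maxwellian_pos {a : ℝ} (ha : 0 ≤ a) :
    0 < ∫ η : Vel, ‖η‖ ^ a * maxwellian η := by
  rw [integral_pos_iff_support_of_nonneg
    (fun η => mul_nonneg (Real.rpow_nonneg (norm_nonneg _) _) (maxwellian_pos η).le)
    (integrable_norm_rpow_mul_maxwellian ha)]
  have : ({0}ᶜ : Set Vel) ⊆ Function.support fun η : Vel => ‖η‖ ^ a * maxwellian η := by
    intro η hη
    have h1 : 0 < ‖η‖ := norm_pos_iff.2 hη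
    have := maxwellian_pos η
    exact (by positivity : 0 < ‖η‖ ^ a * maxwellian η).ne'
  refine lt_of_lt_of_le ?_ (measure_mono this)
  rw [measure_compl (measurableSet_singleton _) (by simp)]
  simp

/-- The bounds for the collision frequency that are used below. -/
structure IsFrequency (γ : ℝ) (ν : Vel → ℝ) (ν₀ ν₁ : ℝ) : Prop where
  pos : 0 < ν₀
  measurable : Measurable ν
  lower : ∀ ζ, ν₀ ≤ ν ζ
  upper : ∀ ζ, ν ζ ≤ ν₁ * (1 + ‖ζ‖)
  holder : ∀ ζ ζ', |ν ζ' - ν ζ| ≤ ν₁ * ‖ζ' - ζ‖ ^ γ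

theorem IsCutoffPowerLaw.exists_isFrequency {γ : ℝ} {β : ℝ → ℝ} (h : IsCutoffPowerLaw γ β) :
    ∃ ν₀ ν₁ : ℝ, IsFrequency γ (collisionFreq γ β) ν₀ ν₁ := by
  have h0 := h.gamma_pos.le
  have h1 := h.gamma_le_one
  have hb := h.angularMass_pos
  set m := ∫ η : Vel, ‖η‖ ^ γ * maxwellian η with hm
  have hm0 : 0 < m := integral_norm_rpow_mul_maxwellian_pos h0
  set M := ∫ η : Vel, maxwellian η with hM
  have hM0 : 0 ≤ M := integral_nonneg fun η => (maxwellian_pos η).le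
  refine ⟨angularMass β * (m / 2), angularMass β * (m + M), by positivity, ?_, fun ζ => ?_,
    fun ζ => ?_, fun ζ ζ' => ?_⟩
  · have := (stronglyMeasurable_freqProfile γ).measurable
    simp only [funext (collisionFreq_eq γ β)]
    fun_prop
  · rw [collisionFreq_eq]
    have := le_freqProfile h0 h1 ζ
    gcongr
    linarith
  · rw [collisionFreq_eq, mul_assoc]
    have e1 := freqProfile_le h0 h1 ζ
    have e2 := rpow_le_one_add (norm_nonneg ζ) h0 h1
    gcongr
    have := norm_nonneg ζ
    nlinarith
  · rw [collisionFreq_eq, collisionFreq_eq, ← mul_sub, abs_mul, abs_of_pos hb, mul_assoc]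
    have e1 := abs_freqProfile_sub_le h0 h1 ζ ζ'
    have := Real.rpow_nonneg (norm_nonneg (ζ' - ζ)) γ
    gcongr
    nlinarith

/-! ### The loss operator -/

/-- The integral part of the loss term. -/
noncomputable def lossOp (γ : ℝ) (f : Vel → ℝ) (ξ : Vel) : ℝ :=
  ∫ η, f η * (√(maxwellian ξ) * (√(maxwellian η) * ‖η - ξ‖ ^ γ))

/-- The majorant of the kernel of the loss operator. -/
noncomputable def lossMajorant (γ : ℝ) (η : Vel) : ℝ := √(maxwellian η) * (1 + ‖η‖ ^ γ)

theorem measurable_lossMajorant (γ : ℝ) : Measurable (lossMajorant γ) := by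
  have := measurable_maxwellian
  unfold lossMajorant
  fun_prop

theorem lossMajorant_nonneg (γ : ℝ) (η : Vel) : 0 ≤ lossMajorant γ η := by
  unfold lossMajorant; positivity

theorem memLp_lossMajorant {γ : ℝ} (h0 : 0 ≤ γ) : MemLp (lossMajorant γ) 2 volume := by
  have hm := measurable_lossMajorant γ
  rw [memLp_two_iff_integrable_sq hm.aestronglyMeasurable]
  refine ((integrable_maxwellian.const_mul 2).add
    ((integrable_norm_rpow_mul_maxwellian (a := γ + γ) (by linarith)).const_mul 2)).mono'
    (by fun_prop) (Eventually.of_forall fun η => ?_)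
  have hp := maxwellian_pos η
  rw [Real.norm_of_nonneg (by positivity), lossMajorant, mul_pow, Real.sq_sqrt hp.le]
  have e1 : ‖η‖ ^ (γ + γ) = (‖η‖ ^ γ) ^ 2 := by
    rw [sq, ← Real.rpow_add_of_nonneg (norm_nonneg _) h0 h0]
  simp only [Pi.add_apply]
  rw [e1]
  nlinarith [sq_nonneg (1 - ‖η‖ ^ γ)]

theorem norm_sub_rpow_le_mul {γ : ℝ} (h0 : 0 ≤ γ) (h1 : γ ≤ 1) (η ξ : Vel) :
    ‖η - ξ‖ ^ γ ≤ (1 + ‖η‖ ^ γ) * (1 + ‖ξ‖ ^ γ) := by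
  have := norm_sub_rpow_le h0 h1 η ξ
  have p1 := Real.rpow_nonneg (norm_nonneg η) γ
  have p2 := Real.rpow_nonneg (norm_nonneg ξ) γ
  nlinarith

theorem one_add_rpow_le_exp {γ : ℝ} (h0 : 0 ≤ γ) (h1 : γ ≤ 1) (ξ : Vel) :
    1 + ‖ξ‖ ^ γ ≤ 6 * Real.exp (‖ξ‖ ^ 2 / 16) := by
  have e1 := rpow_le_one_add (norm_nonneg ξ) h0 h1
  have e2 := Real.add_one_le_exp (‖ξ‖ ^ 2 / 16)
  nlinarith [sq_nonneg (‖ξ‖ / 4 - 2), sq_nonneg ‖ξ‖]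

theorem sqrt_maxwellian_le (ξ : Vel) : √(maxwellian ξ) ≤ √((√Real.pi ^ 3)⁻¹) := by
  rw [sqrt_maxwellian]
  refine mul_le_of_le_one_right (Real.sqrt_nonneg _) ?_
  rw [Real.exp_le_one_iff]
  have := sq_nonneg ‖ξ‖
  linarith

theorem abs_sqrt_maxwellian_sub_le (ξ ξ' : Vel) :
    |√(maxwellian ξ') - √(maxwellian ξ)| ≤ √((√Real.pi ^ 3)⁻¹) * ‖ξ' - ξ‖ := by
  rw [sqrt_maxwellian, sqrt_maxwellian, ← mul_sub, abs_mul, abs_of_nonneg (Real.sqrt_nonneg _)]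
  gcongr
  have hs : (√2 : ℝ) ^ 2 = 2 := Real.sq_sqrt (by norm_num)
  have e := abs_exp_neg_sq_sub_le (‖ξ'‖ / √2) (‖ξ‖ / √2)
  rw [div_pow, div_pow, hs, ← neg_div, ← neg_div, ← sub_div, abs_div,
    abs_of_nonneg (Real.sqrt_nonneg 2)] at e
  refine e.trans ((div_le_self (abs_nonneg _) ?_).trans (abs_norm_sub_norm_le _ _))
  rw [Real.one_le_sqrt]; norm_num

theorem lintegral_lossOp_le {γ : ℝ} (h0 : 0 ≤ γ) (h1 : γ ≤ 1) {f : Vel → ℝ} (hf : Measurable f)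
    (ξ : Vel) :
    ∫⁻ η, ‖f η * (√(maxwellian ξ) * (√(maxwellian η) * ‖η - ξ‖ ^ γ))‖ₑ ≤
      ENNReal.ofReal (√((√Real.pi ^ 3)⁻¹) * (6 * Real.exp (‖ξ‖ ^ 2 / 16))) *
        (eLpNorm f 2 volume * eLpNorm (lossMajorant γ) 2 volume) := by
  have hm := measurable_lossMajorant γ
  have h2 := lintegral_enorm_mul_le (μ := (volume : Measure Vel)) hf.aestronglyMeasurable
    hm.aestronglyMeasurable 2 2
  refine le_trans ?_ (mul_le_mul_right h2 _)
  rw [← lintegral_const_mul _ (by fun_prop)]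
  refine lintegral_mono fun η => ?_
  rw [enorm_mul, mul_left_comm (ENNReal.ofReal _), Real.enorm_eq_ofReal (lossMajorant_nonneg γ η),
    ← ENNReal.ofReal_mul (by positivity), Real.enorm_eq_ofReal_abs (√(maxwellian ξ) * _),
    abs_of_nonneg (by positivity)]
  refine mul_le_mul' le_rfl (ENNReal.ofReal_le_ofReal ?_)
  have e1 := norm_sub_rpow_le_mul h0 h1 η ξ
  have e2 := one_add_rpow_le_exp h0 h1 ξ
  have e3 := sqrt_maxwellian_le ξ
  calc √(maxwellian ξ) * (√(maxwellian η) * ‖η - ξ‖ ^ γ)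
      ≤ √((√Real.pi ^ 3)⁻¹) * (√(maxwellian η) * ((1 + ‖η‖ ^ γ) *
        (6 * Real.exp (‖ξ‖ ^ 2 / 16)))) := by
        gcongr
        refine e1.trans ?_
        gcongr
    _ = _ := by rw [lossMajorant]; ring

theorem integrable_lossOp {γ : ℝ} (h0 : 0 ≤ γ) (h1 : γ ≤ 1) {f : Vel → ℝ} (hf : Measurable f)
    (hf2 : eLpNorm f 2 volume < ⊤) (ξ : Vel) :
    Integrable fun η => f η * (√(maxwellian ξ) * (√(maxwellian η) * ‖η - ξ‖ ^ γ)) := by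
  have hM := measurable_maxwellian
  refine ⟨by fun_prop, (lintegral_lossOp_le h0 h1 hf ξ).trans_lt ?_⟩
  exact ENNReal.mul_lt_top ENNReal.ofReal_lt_top (ENNReal.mul_lt_top hf2 (memLp_lossMajorant h0).2)

theorem stronglyMeasurable_lossOp (γ : ℝ) {f : Vel → ℝ} (hf : Measurable f) :
    StronglyMeasurable (lossOp γ f) := by
  have hM := measurable_maxwellian
  have : Measurable fun p : Vel × Vel =>
    f p.2 * (√(maxwellian p.1) * (√(maxwellian p.2) * ‖p.2 - p.1‖ ^ γ)) := by fun_prop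
  exact this.stronglyMeasurable.integral_prod_right'

/-- The Maxwellian factor is Lipschitz and the power is γ-Hölder in ξ. The restriction to
displacements t ≤ 1 replaces both t and t^γ by t^δ. -/
theorem enorm_lossOp_sub_le {γ δ : ℝ} (h0 : 0 ≤ γ) (h1 : γ ≤ 1) (hδγ : δ ≤ γ)
    {f : Vel → ℝ} (hf : Measurable f) (hf2 : eLpNorm f 2 volume < ⊤) (ξ ξ' : Vel)
    (hne : 0 < ‖ξ' - ξ‖) (hle : ‖ξ' - ξ‖ ≤ 1) :
    ‖lossOp γ f ξ' - lossOp γ f ξ‖ₑ ≤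
      ENNReal.ofReal (2 * √((√Real.pi ^ 3)⁻¹) * ‖ξ' - ξ‖ ^ δ * (6 * Real.exp (‖ξ‖ ^ 2 / 16))) *
        (eLpNorm f 2 volume * eLpNorm (lossMajorant γ) 2 volume) := by
  have hm := measurable_lossMajorant γ
  have h2 := lintegral_enorm_mul_le (μ := (volume : Measure Vel)) hf.aestronglyMeasurable
    hm.aestronglyMeasurable 2 2
  refine le_trans ?_ (mul_le_mul_right h2 _)
  rw [lossOp, lossOp, ← integral_sub (integrable_lossOp h0 h1 hf hf2 _)
    (integrable_lossOp h0 h1 hf hf2 _)]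
  refine (enorm_integral_le_lintegral_enorm _).trans ?_
  rw [← lintegral_const_mul _ (by fun_prop)]
  refine lintegral_mono fun η => ?_
  simp only
  have hpos : 0 ≤ 2 * √((√Real.pi ^ 3)⁻¹) * ‖ξ' - ξ‖ ^ δ * (6 * Real.exp (‖ξ‖ ^ 2 / 16)) := by
    positivity
  rw [← mul_sub, enorm_mul, mul_left_comm (ENNReal.ofReal _),
    Real.enorm_eq_ofReal (lossMajorant_nonneg γ η), ← ENNReal.ofReal_mul hpos,
    Real.enorm_eq_ofReal_abs (_ - _)]
  refine mul_le_mul' le_rfl (ENNReal.ofReal_le_ofReal ?_)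
  set t := ‖ξ' - ξ‖
  set P := √((√Real.pi ^ 3)⁻¹)
  have hP : 0 ≤ P := Real.sqrt_nonneg _
  have e1 := norm_sub_rpow_le_mul h0 h1 η ξ
  have e2 := one_add_rpow_le_exp h0 h1 ξ
  have e3 := sqrt_maxwellian_le ξ'
  have e4 := abs_sqrt_maxwellian_sub_le ξ ξ'
  have e5 := abs_norm_sub_rpow_sub_le h0 h1 η ξ ξ'
  have e6 : t ^ γ ≤ t ^ δ := Real.rpow_le_rpow_of_exponent_ge hne hle hδγ
  have e7 : t ≤ t ^ δ := by
    have := Real.rpow_le_rpow_of_exponent_ge hne hle (hδγ.trans h1)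
    simpa using this
  have p1 := Real.rpow_nonneg (norm_nonneg η) γ
  have p2 := Real.rpow_nonneg (norm_nonneg ξ) γ
  have p3 : 0 ≤ t ^ δ := Real.rpow_nonneg hne.le _
  have hsplit : √(maxwellian ξ') * (√(maxwellian η) * ‖η - ξ'‖ ^ γ) -
      √(maxwellian ξ) * (√(maxwellian η) * ‖η - ξ‖ ^ γ) = √(maxwellian η) *
      (√(maxwellian ξ') * (‖η - ξ'‖ ^ γ - ‖η - ξ‖ ^ γ) +
        (√(maxwellian ξ') - √(maxwellian ξ)) * ‖η - ξ‖ ^ γ) := by ring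
  rw [hsplit, abs_mul, abs_of_nonneg (Real.sqrt_nonneg (maxwellian η))]
  have hb : |√(maxwellian ξ') * (‖η - ξ'‖ ^ γ - ‖η - ξ‖ ^ γ) +
        (√(maxwellian ξ') - √(maxwellian ξ)) * ‖η - ξ‖ ^ γ| ≤
      P * t ^ δ * 1 + P * t ^ δ * ((1 + ‖η‖ ^ γ) * (1 + ‖ξ‖ ^ γ)) := by
    refine (abs_add_le _ _).trans ?_
    rw [abs_mul, abs_mul, abs_of_nonneg (Real.sqrt_nonneg (maxwellian ξ')),
      abs_of_nonneg (Real.rpow_nonneg (norm_nonneg (η - ξ)) γ), mul_one]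
    gcongr
    · exact e5.trans e6
    · exact e4.trans (by gcongr)
  calc √(maxwellian η) * _ ≤ √(maxwellian η) *
        (P * t ^ δ * 1 + P * t ^ δ * ((1 + ‖η‖ ^ γ) * (1 + ‖ξ‖ ^ γ))) := by gcongr
    _ ≤ √(maxwellian η) * (2 * (P * t ^ δ) * ((1 + ‖η‖ ^ γ) * (1 + ‖ξ‖ ^ γ))) := by
        gcongr
        have : 1 ≤ (1 + ‖η‖ ^ γ) * (1 + ‖ξ‖ ^ γ) := by nlinarith
        have hPt : 0 ≤ P * t ^ δ := by positivity
        nlinarith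
    _ ≤ √(maxwellian η) * (2 * (P * t ^ δ) * ((1 + ‖η‖ ^ γ) *
        (6 * Real.exp (‖ξ‖ ^ 2 / 16)))) := by gcongr
    _ = _ := by rw [lossMajorant]; ring

/-! ### Decomposition of the linearized collision operator -/

/-- For fixed ξ the map to ξ' pulls null sets back to null sets, so the gain term depends only on
the almost everywhere class of f. -/
theorem quasiMeasurePreserving_postVel (ξ : Vel) :
    Measure.QuasiMeasurePreserving (fun c : Vel × ℝ × ℝ => postVel ξ c.1 c.2.1 c.2.2)
      (volume.restrict collisionDomain) volume := by
  have hS := measurePreserving_collision ξ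
  have p1 : Measurable fun c : Vel × ℝ × ℝ => postVel ξ c.1 c.2.1 c.2.2 :=
    measurable_postVel (by fun_prop) (by fun_prop) (by fun_prop) (by fun_prop)
  have hT := quasiMeasurePreserving_transfer (f₁ := fun V => -frame₁ V) (f₂ := fun V => -frame₂ V)
    measurable_frame₁.neg measurable_frame₂.neg ae_orthonormal_neg_frame
  have hQ := (measurePreserving_add_left (volume : Measure Vel) ξ).quasiMeasurePreserving.comp hT
  refine ⟨p1, ?_⟩
  have hframe : ∀ᵐ z : Vel × ℝ × ℝ ∂(volume.prod angMeasure), z.1 0 ^ 2 + z.1 1 ^ 2 ≠ 0 :=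
    Measure.quasiMeasurePreserving_fst.ae ae_frame
  rw [← hS.map_eq, Measure.map_map p1 hS.measurable]
  refine (Measure.map_congr (hframe.mono fun z hz => ?_)).trans_le le_rfl |>.absolutelyContinuous.trans
    hQ.absolutelyContinuous
  exact postVel_eq hz ξ z.2.1 z.2.2

theorem quasiMeasurePreserving_postVelStar (ξ : Vel) :
    Measure.QuasiMeasurePreserving (fun c : Vel × ℝ × ℝ => postVelStar ξ c.1 c.2.1 c.2.2)
      (volume.restrict collisionDomain) volume := by
  have hS := measurePreserving_collision_reflect ξ
  have p1 : Measurable fun c : Vel × ℝ × ℝ => postVelStar ξ c.1 c.2.1 c.2.2 :=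
    measurable_postVelStar (by fun_prop) (by fun_prop) (by fun_prop) (by fun_prop)
  have hT := quasiMeasurePreserving_transfer measurable_frame₁ measurable_frame₂
    ae_orthonormal_frame
  have hQ := (measurePreserving_add_left (volume : Measure Vel) ξ).quasiMeasurePreserving.comp hT
  refine ⟨p1, ?_⟩
  have hframe : ∀ᵐ z : Vel × ℝ × ℝ ∂(volume.prod angMeasure), z.1 0 ^ 2 + z.1 1 ^ 2 ≠ 0 :=
    Measure.quasiMeasurePreserving_fst.ae ae_frame
  rw [← hS.map_eq, Measure.map_map p1 hS.measurable]
  refine (Measure.map_congr (hframe.mono fun z hz => ?_)).trans_le le_rfl |>.absolutelyContinuous.trans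
    hQ.absolutelyContinuous
  exact postVelStar_reflect_eq hz ξ z.2.1 z.2.2

/-- A change of `f` on a null set changes `L(f)` only where `f` itself is changed. -/
theorem linCollision_congr {γ : ℝ} {β : ℝ → ℝ} {f g : Vel → ℝ} (hfg : f =ᵐ[volume] g) {ξ : Vel}
    (hξ : f ξ = g ξ) : linCollision γ β f ξ = linCollision γ β g ξ := by
  have h1 := (quasiMeasurePreserving_postVel ξ).ae hfg
  have h2 := (quasiMeasurePreserving_postVelStar ξ).ae hfg
  have h3 : ∀ᵐ c ∂(volume.restrict collisionDomain), f c.1 = g c.1 := by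
    rw [restrict_collisionDomain]
    exact Measure.quasiMeasurePreserving_fst.ae hfg
  rw [linCollision, linCollision, collisionQ, collisionQ]
  congr 2
  refine integral_congr_ae ?_
  filter_upwards [h1, h2, h3] with c h1 h2 h3
  rw [h1, h2, h3, hξ]

/-- The integral part of the linearized collision operator. -/
noncomputable def integralOp (γ : ℝ) (β : ℝ → ℝ) (f : Vel → ℝ) (ξ : Vel) : ℝ :=
  gainOp γ β f ξ + gainOp γ (fun θ => β (Real.pi / 2 - θ)) f ξ - angularMass β * lossOp γ f ξ

/-- For square-integrable f the four terms of the collision integral converge absolutely and may be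
separated. The identity holds at every ξ, not merely almost everywhere, which is what allows
evaluation at the boundary t = 0. -/
theorem linCollision_eq {γ : ℝ} {β : ℝ → ℝ} (hB : IsCutoffPowerLaw γ β) {f : Vel → ℝ}
    (hf : Measurable f) (hf2 : eLpNorm f 2 volume < ⊤) (ξ : Vel) :
    linCollision γ β f ξ = integralOp γ β f ξ - collisionFreq γ β ξ * f ξ := by
  have hβ := hB.isAngularDensity
  have h0 := hB.gamma_pos
  have h1 := hB.gamma_le_one
  obtain ⟨i1, e1⟩ := gain_term_eq hβ h0 hf hf2 ξ
  obtain ⟨i2, e2⟩ := gain_term_star_eq hβ h0 hf hf2 ξ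
  have hM := measurable_maxwellian
  have hw := maxwellian_pos ξ
  have i3 : IntegrableOn (fun c : Vel × ℝ × ℝ => (f c.1 * (√(maxwellian ξ) * (√(maxwellian c.1) *
      ‖c.1 - ξ‖ ^ γ))) * β c.2.1) collisionDomain := by
    rw [IntegrableOn, restrict_collisionDomain]
    exact (integrable_lossOp h0.le h1 hf hf2 ξ).mul_prod hβ.integrable
  have i4 : IntegrableOn (fun c : Vel × ℝ × ℝ => (maxwellian c.1 * ‖c.1 - ξ‖ ^ γ) * β c.2.1)
      collisionDomain := by
    rw [IntegrableOn, restrict_collisionDomain]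
    exact (integrable_freqProfile h0.le h1 ξ).mul_prod hβ.integrable
  have e3 := integral_collisionDomain_mul β
    (fun η => f η * (√(maxwellian ξ) * (√(maxwellian η) * ‖η - ξ‖ ^ γ)))
  have e4 := integral_collisionDomain_mul β (fun η => maxwellian η * ‖η - ξ‖ ^ γ)
  have hs : √(maxwellian ξ) ≠ 0 := (Real.sqrt_pos.2 hw).ne'
  have hsq : √(maxwellian ξ) * √(maxwellian ξ) = maxwellian ξ := Real.mul_self_sqrt hw.le
  have key : ∫ c in collisionDomain,
      (maxwellian (postVel ξ c.1 c.2.1 c.2.2) * (√(maxwellian (postVelStar ξ c.1 c.2.1 c.2.2)) *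
        f (postVelStar ξ c.1 c.2.1 c.2.2))
      + √(maxwellian (postVel ξ c.1 c.2.1 c.2.2)) * f (postVel ξ c.1 c.2.1 c.2.2) *
        maxwellian (postVelStar ξ c.1 c.2.1 c.2.2)
      - maxwellian ξ * (√(maxwellian c.1) * f c.1) - √(maxwellian ξ) * f ξ * maxwellian c.1) *
        crossSection γ β ‖c.1 - ξ‖ c.2.1 =
      √(maxwellian ξ) * (integralOp γ β f ξ - collisionFreq γ β ξ * f ξ) := by
    have i12 := i2.add i1
    have i34 := (i3.const_mul (√(maxwellian ξ))).add (i4.const_mul (√(maxwellian ξ) * f ξ))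
    have hsub := integral_sub i12 i34
    have ha := integral_add i2 i1
    have hb := integral_add (i3.const_mul (√(maxwellian ξ))) (i4.const_mul (√(maxwellian ξ) * f ξ))
    simp only [Pi.add_apply] at hsub
    rw [ha, hb, integral_const_mul, integral_const_mul, e1, e2, e3, e4] at hsub
    rw [integralOp, collisionFreq_eq, lossOp, freqProfile]
    refine Eq.trans ?_ (hsub.trans ?_)
    · refine integral_congr_ae (Eventually.of_forall fun c => ?_)
      simp only [crossSection]
      linear_combination (-(√(maxwellian c.1) * f c.1 * ‖c.1 - ξ‖ ^ γ * β c.2.1)) * -hsq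
    · ring
  rw [linCollision, collisionQ, key]
  field_simp

theorem norm_single_zero (t : ℝ) : ‖t • (EuclideanSpace.single 0 1 : Vel)‖ = |t| := by
  rw [norm_smul]; simp

/-- Everything needed about the integral operator: growth at most e^{|ξ|²/16} and a δ-Hölder modulus
along the first axis, linear in the L² norm. The growth is later absorbed by e^{-|ξ|²/8}. -/
theorem exists_integralOp_bounds {γ : ℝ} {β : ℝ → ℝ} (hB : IsCutoffPowerLaw γ β) {δ : ℝ}
    (hδ : 0 < δ) (hδ8 : δ ≤ 1 / 8) (hδγ : δ ≤ γ) :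
    ∃ C : ℝ, 0 ≤ C ∧ ∀ f : Vel → ℝ, Measurable f → eLpNorm f 2 volume < ⊤ →
      (∀ ξ, |integralOp γ β f ξ| ≤
        C * Real.exp (‖ξ‖ ^ 2 / 16) * (eLpNorm f 2 volume).toReal) ∧
      ∀ ξ t, 0 < t → t ≤ 1 →
        |integralOp γ β f (ξ + t • EuclideanSpace.single 0 1) - integralOp γ β f ξ| ≤
        C * (t ^ δ * (Real.exp (‖ξ‖ ^ 2 / 16) +
          Real.exp (‖ξ + t • (EuclideanSpace.single 0 1 : Vel)‖ ^ 2 / 16))) *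
          (eLpNorm f 2 volume).toReal := by
  have hβ := hB.isAngularDensity
  have h0 := hB.gamma_pos
  have h1 := hB.gamma_le_one
  obtain ⟨C1, hC1⟩ := exists_lintegral_gainOp_le hβ hδ hδ8 h0
  obtain ⟨C2, hC2⟩ := exists_lintegral_gainOp_le hβ.reflect hδ hδ8 h0
  obtain ⟨D1, hD1⟩ := exists_gainOp_sub_le hβ hδ hδ8 hδγ h1
  obtain ⟨D2, hD2⟩ := exists_gainOp_sub_le hβ.reflect hδ hδ8 hδγ h1
  have hLfin := (memLp_lossMajorant h0.le).2
  set L : ℝ := (eLpNorm (lossMajorant γ) 2 volume).toReal with hL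
  have hL0 : 0 ≤ L := ENNReal.toReal_nonneg
  set P := √((√Real.pi ^ 3)⁻¹) with hP
  have hP0 : 0 ≤ P := Real.sqrt_nonneg _
  have hm := hB.angularMass_pos
  set E1 : ℝ := C1 + C2 + angularMass β * (6 * P * L) with hE1
  set E2 : ℝ := D1 + D2 + angularMass β * (12 * P * L) with hE2
  have hE10 : 0 ≤ E1 := by positivity
  have hE20 : 0 ≤ E2 := by positivity
  have conv : ∀ (a : ℝ) (x y : ℝ≥0∞), y < ⊤ → ‖a‖ₑ ≤ x * y → x < ⊤ → |a| ≤ x.toReal * y.toReal := by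
    intro a x y hy h hx
    rw [← ENNReal.toReal_mul, ← Real.norm_eq_abs, ← toReal_enorm]
    exact ENNReal.toReal_mono (ENNReal.mul_lt_top hx hy).ne h
  refine ⟨E1 + E2, by positivity, fun f hf hf2 => ⟨fun ξ => ?_, fun ξ t ht ht1 => ?_⟩⟩
  · set N := (eLpNorm f 2 volume).toReal
    have hN : 0 ≤ N := ENNReal.toReal_nonneg
    have a1 := conv (gainOp γ β f ξ) _ _ hf2
      ((enorm_integral_le_lintegral_enorm _).trans (hC1 f hf ξ))
      (ENNReal.mul_lt_top ENNReal.coe_lt_top ENNReal.ofReal_lt_top)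
    have a2 := conv (gainOp γ (fun θ => β (Real.pi / 2 - θ)) f ξ) _ _ hf2
      ((enorm_integral_le_lintegral_enorm _).trans (hC2 f hf ξ))
      (ENNReal.mul_lt_top ENNReal.coe_lt_top ENNReal.ofReal_lt_top)
    have a3 := conv (lossOp γ f ξ) _ _ (ENNReal.mul_lt_top hf2 hLfin)
      ((enorm_integral_le_lintegral_enorm _).trans (lintegral_lossOp_le h0.le h1 hf ξ))
      ENNReal.ofReal_lt_top
    rw [ENNReal.toReal_mul, ENNReal.toReal_ofReal (Real.exp_nonneg _), ENNReal.coe_toReal]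
      at a1 a2
    rw [ENNReal.toReal_mul, ENNReal.toReal_ofReal (by positivity)] at a3
    set e := Real.exp (‖ξ‖ ^ 2 / 16)
    have he : 0 ≤ e := Real.exp_nonneg _
    have a4 : |angularMass β * lossOp γ f ξ| ≤ angularMass β * (P * (6 * e) * (N * L)) := by
      rw [abs_mul, abs_of_pos hm]
      gcongr
    calc |integralOp γ β f ξ| ≤ C1 * e * N + C2 * e * N + angularMass β * (P * (6 * e) * (N * L)) :=
          (abs_sub _ _).trans (add_le_add ((abs_add_le _ _).trans (add_le_add a1 a2)) a4)
      _ = E1 * e * N := by rw [hE1]; ring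
      _ ≤ (E1 + E2) * e * N := by gcongr; linarith
  · set N := (eLpNorm f 2 volume).toReal
    have hN : 0 ≤ N := ENNReal.toReal_nonneg
    set ξ' := ξ + t • (EuclideanSpace.single 0 1 : Vel) with hξ'
    have hnorm : ‖ξ' - ξ‖ = t := by
      rw [hξ', add_sub_cancel_left, norm_single_zero, abs_of_pos ht]
    have a1 := conv _ _ _ hf2 (hD1 f hf hf2 ξ t ht.le)
      (ENNReal.mul_lt_top ENNReal.coe_lt_top ENNReal.ofReal_lt_top)
    have a2 := conv _ _ _ hf2 (hD2 f hf hf2 ξ t ht.le)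
      (ENNReal.mul_lt_top ENNReal.coe_lt_top ENNReal.ofReal_lt_top)
    have a3 := conv _ _ _ (ENNReal.mul_lt_top hf2 hLfin)
      (enorm_lossOp_sub_le h0.le h1 hδγ hf hf2 ξ ξ' (by rw [hnorm]; exact ht)
        (by rw [hnorm]; exact ht1)) ENNReal.ofReal_lt_top
    rw [hnorm] at a3
    rw [ENNReal.toReal_mul, ENNReal.toReal_ofReal (by positivity), ENNReal.coe_toReal] at a1 a2
    rw [ENNReal.toReal_mul, ENNReal.toReal_ofReal (by positivity)] at a3
    set e := Real.exp (‖ξ‖ ^ 2 / 16)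
    set e' := Real.exp (‖ξ'‖ ^ 2 / 16)
    have he : 0 ≤ e := Real.exp_nonneg _
    have he' : 0 ≤ e' := Real.exp_nonneg _
    have htd : 0 ≤ t ^ δ := Real.rpow_nonneg ht.le _
    have a4 : |angularMass β * (lossOp γ f ξ' - lossOp γ f ξ)| ≤
        angularMass β * (2 * P * t ^ δ * (6 * (e + e')) * (N * L)) := by
      rw [abs_mul, abs_of_pos hm]
      gcongr
      refine a3.trans ?_
      gcongr
      linarith
    calc |integralOp γ β f ξ' - integralOp γ β f ξ|
        = |(gainOp γ β f ξ' - gainOp γ β f ξ) + (gainOp γ (fun θ => β (Real.pi / 2 - θ)) f ξ' -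
          gainOp γ (fun θ => β (Real.pi / 2 - θ)) f ξ) -
          angularMass β * (lossOp γ f ξ' - lossOp γ f ξ)| := by
          rw [integralOp, integralOp]; congr 1; ring
      _ ≤ D1 * (t ^ δ * (e + e')) * N + D2 * (t ^ δ * (e + e')) * N +
          angularMass β * (2 * P * t ^ δ * (6 * (e + e')) * (N * L)) :=
          (abs_sub _ _).trans (add_le_add ((abs_add_le _ _).trans (add_le_add a1 a2)) a4)
      _ = E2 * (t ^ δ * (e + e')) * N := by rw [hE2]; ring
      _ ≤ (E1 + E2) * (t ^ δ * (e + e')) * N := by gcongr; linarith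

theorem measurable_integralOp {γ : ℝ} {β : ℝ → ℝ} (hB : IsCutoffPowerLaw γ β) {f : Vel → ℝ}
    (hf : Measurable f) : Measurable (integralOp γ β f) := by
  have h1 := (stronglyMeasurable_gainOp (γ := γ) hB.isAngularDensity.measurable hf).measurable
  have h2 := (stronglyMeasurable_gainOp (γ := γ) hB.isAngularDensity.reflect.measurable hf).measurable
  have h3 := (stronglyMeasurable_lossOp γ hf).measurable
  unfold integralOp
  fun_prop

/-! ### Weak gradients and translations -/

/-- The unit vector in the direction of the first coordinate. -/
noncomputable def axisVec : Vel := EuclideanSpace.single 0 1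

theorem isOpen_halfPos : IsOpen halfPos := by
  have : Continuous fun ζ : Vel => ζ 0 := by fun_prop
  exact isOpen_lt continuous_const this

theorem add_smul_axisVec_mem {ζ : Vel} (hζ : ζ ∈ halfPos) {s : ℝ} (hs : 0 ≤ s) :
    ζ + s • axisVec ∈ halfPos := by
  have h : 0 < ζ 0 := hζ
  change 0 < (ζ + s • axisVec) 0
  simp only [axisVec, PiLp.add_apply, PiLp.smul_apply, PiLp.single_apply]
  simp
  linarith

/-- The shear `(ζ, s) ↦ (ζ + s e, s)` preserves product measures. -/
theorem measurePreserving_shear (μ : Measure ℝ) [SFinite μ] :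
    MeasurePreserving (fun z : Vel × ℝ => (z.1 + z.2 • axisVec, z.2))
      ((volume : Measure Vel).prod μ) ((volume : Measure Vel).prod μ) := by
  have h1 : MeasurePreserving (fun p : ℝ × Vel => (p.1, p.2 + p.1 • axisVec))
      (μ.prod (volume : Measure Vel)) (μ.prod volume) :=
    (MeasurePreserving.id μ).skew_product (g := fun s ζ => ζ + s • axisVec)
      (by simp only [Function.uncurry_def]; fun_prop)
      (Eventually.of_forall fun s => (measurePreserving_add_right volume (s • axisVec)).map_eq)
  exact Measure.measurePreserving_swap.comp (h1.comp Measure.measurePreserving_swap)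

/-- The translates of K by s e₁ with 0 ≤ s ≤ h sweep out a compact subset of the open half space,
where H is integrable. Only translations to the right occur, so the boundary is never approached. -/
theorem integrable_mul_translate {H ψ : Vel → ℝ} (hH : Measurable H)
    (hloc : LocallyIntegrableOn H halfPos) (hψ : Measurable ψ) {K : Set Vel} (hK : IsCompact K)
    (hKU : K ⊆ halfPos) (hψK : ∀ ζ, ζ ∉ K → ψ ζ = 0) {C : ℝ} (hC : ∀ ζ, |ψ ζ| ≤ C) (h : ℝ) :
    Integrable (fun z : Vel × ℝ => H z.1 * ψ (z.1 - z.2 • axisVec))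
      ((volume : Measure Vel).prod (volume.restrict (Ioc 0 h))) := by
  set K' : Set Vel := (fun z : Vel × ℝ => z.1 + z.2 • axisVec) '' (K ×ˢ Icc 0 h) with hK'
  have hK'c : IsCompact K' := (hK.prod isCompact_Icc).image (by fun_prop)
  have hK'U : K' ⊆ halfPos := by
    rintro _ ⟨z, hz, rfl⟩
    exact add_smul_axisVec_mem (hKU hz.1) hz.2.1
  have hint : IntegrableOn H K' := hloc.integrableOn_compact_subset hK'U hK'c
  have hi : Integrable (fun z : Vel × ℝ => K'.indicator H z.1 * C)
      ((volume : Measure Vel).prod (volume.restrict (Ioc 0 h))) :=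
    ((integrable_indicator_iff hK'c.measurableSet).2 hint).mul_prod (integrable_const C)
  refine hi.mono (by fun_prop) ?_
  filter_upwards [Measure.quasiMeasurePreserving_snd.ae (ae_restrict_mem measurableSet_Ioc)]
    with z hz
  by_cases hm : z.1 - z.2 • axisVec ∈ K
  · have : z.1 ∈ K' := ⟨(z.1 - z.2 • axisVec, z.2), ⟨hm, hz.1.le, hz.2⟩, by simp⟩
    rw [indicator_of_mem this, norm_mul, norm_mul]
    gcongr
    exact (hC _).trans (le_abs_self C)
  · rw [hψK _ hm, mul_zero, norm_zero]
    exact norm_nonneg _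

theorem integrable_translate_mul {H ψ : Vel → ℝ} (hH : Measurable H)
    (hloc : LocallyIntegrableOn H halfPos) (hψ : Measurable ψ) {K : Set Vel} (hK : IsCompact K)
    (hKU : K ⊆ halfPos) (hψK : ∀ ζ, ζ ∉ K → ψ ζ = 0) {C : ℝ} (hC : ∀ ζ, |ψ ζ| ≤ C) (h : ℝ) :
    Integrable (fun z : Vel × ℝ => H (z.1 + z.2 • axisVec) * ψ z.1)
      ((volume : Measure Vel).prod (volume.restrict (Ioc 0 h))) := by
  have h1 := (measurePreserving_shear (volume.restrict (Ioc 0 h))).integrable_comp_of_integrable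
    (integrable_mul_translate hH hloc hψ hK hKU hψK hC h)
  refine h1.congr (Eventually.of_forall fun z => ?_)
  simp

theorem locallyIntegrableOn_translate {H : Vel → ℝ}
    (hloc : LocallyIntegrableOn H halfPos) {h : ℝ} (h0 : 0 ≤ h) :
    LocallyIntegrableOn (fun ζ => H (ζ + h • axisVec)) halfPos := by
  rw [locallyIntegrableOn_iff isOpen_halfPos.isLocallyClosed]
  intro K hKU hK
  have hK' : IsCompact ((fun ζ : Vel => ζ + h • axisVec) '' K) := hK.image (by fun_prop)
  have hK'U : (fun ζ : Vel => ζ + h • axisVec) '' K ⊆ halfPos := by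
    rintro _ ⟨z, hz, rfl⟩
    exact add_smul_axisVec_mem (hKU hz) h0
  have h1 := hloc.integrableOn_compact_subset hK'U hK'
  have h2 := (measurePreserving_add_right (volume : Measure Vel) (h • axisVec)).integrableOn_image
    (Homeomorph.addRight (h • axisVec : Vel)).measurableEmbedding (f := H) (s := K)
  exact h2.1 h1

theorem locallyIntegrableOn_integral_translate {H : Vel → ℝ} (hH : Measurable H)
    (hloc : LocallyIntegrableOn H halfPos) (h : ℝ) :
    LocallyIntegrableOn (fun ζ => ∫ s in Ioc 0 h, H (ζ + s • axisVec)) halfPos := by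
  rw [locallyIntegrableOn_iff isOpen_halfPos.isLocallyClosed]
  intro K hKU hK
  have h1 := (integrable_translate_mul hH hloc (ψ := K.indicator 1)
    (measurable_one.indicator hK.measurableSet) hK hKU
    (fun ζ hζ => indicator_of_notMem hζ _) (C := 1)
    (fun ζ => by by_cases hζ : ζ ∈ K <;> simp [hζ]) h).integral_prod_left
  rw [← integrable_indicator_iff hK.measurableSet]
  refine h1.congr (Eventually.of_forall fun ζ => ?_)
  simp only
  rw [integral_mul_const]
  by_cases hζ : ζ ∈ K <;> simp [hζ]

theorem setIntegral_halfPos_eq {F : Vel → ℝ} (hF : ∀ ζ, ζ ∉ halfPos → F ζ = 0) :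
    ∫ ζ in halfPos, F ζ = ∫ ζ, F ζ :=
  setIntegral_eq_integral_of_forall_compl_eq_zero hF

/-- A weak derivative in the direction of the first coordinate satisfies the fundamental theorem of
calculus along almost every segment of a given length. -/
theorem ae_translate_sub_eq {g Γ : Vel → ℝ} (hg : Measurable g) (hΓ : Measurable Γ)
    (hgloc : LocallyIntegrableOn g halfPos) (hΓloc : LocallyIntegrableOn Γ halfPos)
    (hweak : ∀ φ : Vel → ℝ, ContDiff ℝ ((⊤ : ℕ∞) : WithTop ℕ∞) φ → HasCompactSupport φ →
      tsupport φ ⊆ halfPos → ∫ ζ in halfPos, g ζ * fderiv ℝ φ ζ axisVec =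
        -∫ ζ in halfPos, Γ ζ * φ ζ) {h : ℝ} (h0 : 0 ≤ h) :
    ∀ᵐ ζ : Vel, ζ ∈ halfPos →
      g (ζ + h • axisVec) - g ζ = ∫ s in Ioc 0 h, Γ (ζ + s • axisVec) := by
  have hloc := ((locallyIntegrableOn_translate hgloc h0).sub hgloc).sub
    (locallyIntegrableOn_integral_translate hΓ hΓloc h)
  -- By the fundamental lemma of the calculus of variations it is enough to pair the difference of
  -- the two sides with test functions.
  have key := isOpen_halfPos.ae_eq_zero_of_integral_contDiff_smul_eq_zero hloc ?_
  · filter_upwards [key] with ζ hζ hm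
    have := hζ hm
    simp only [Pi.sub_apply] at this
    linarith
  intro φ hφ hc hs
  have hφc : Continuous φ := hφ.continuous
  have hd : Continuous fun ζ => fderiv ℝ φ ζ axisVec :=
    (hφ.continuous_fderiv (by simp)).clm_apply continuous_const
  have hdc : HasCompactSupport fun ζ => fderiv ℝ φ ζ axisVec := hc.fderiv_apply ℝ axisVec
  obtain ⟨C, hC⟩ := hφc.bounded_above_of_compact_support hc
  obtain ⟨C', hC'⟩ := hd.bounded_above_of_compact_support hdc
  have hz : ∀ ζ, ζ ∉ tsupport φ → φ ζ = 0 := fun ζ hζ => image_eq_zero_of_notMem_tsupport hζ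
  have hz' : ∀ ζ, ζ ∉ tsupport φ → fderiv ℝ φ ζ axisVec = 0 := fun ζ hζ => by
    rw [fderiv_of_notMem_tsupport ℝ hζ]; rfl
  -- integrability of the three terms
  have i1 : Integrable fun ζ => φ ζ * g (ζ + h • axisVec) := by
    have := (locallyIntegrableOn_translate hgloc h0).integrableOn_compact_subset hs hc
    have h2 := this.continuousOn_mul hφc.continuousOn hc
    rw [IntegrableOn] at h2
    exact (integrableOn_iff_integrable_of_support_subset (fun ζ hζ => by
      by_contra hn; exact hζ (by simp [hz ζ hn]))).1 h2
  have i2 : Integrable fun ζ => φ ζ * g ζ := by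
    have := hgloc.integrableOn_compact_subset hs hc
    have h2 := this.continuousOn_mul hφc.continuousOn hc
    exact (integrableOn_iff_integrable_of_support_subset (fun ζ hζ => by
      by_contra hn; exact hζ (by simp [hz ζ hn]))).1 h2
  have j1 := integrable_translate_mul hΓ hΓloc hφc.measurable hc hs hz hC h
  have i3 : Integrable fun ζ => φ ζ * ∫ s in Ioc 0 h, Γ (ζ + s • axisVec) := by
    refine j1.integral_prod_left.congr (Eventually.of_forall fun ζ => ?_)
    simp only
    rw [integral_mul_const, mul_comm]
  have j2 := integrable_mul_translate hg hgloc hd.measurable hc hs hz' hC' h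
  have e3 : ∫ ζ, φ ζ * ∫ s in Ioc 0 h, Γ (ζ + s • axisVec) =
      ∫ s in Ioc 0 h, ∫ ζ, Γ (ζ + s • axisVec) * φ ζ := by
    rw [← integral_integral_swap (f := fun ζ s => Γ (ζ + s • axisVec) * φ ζ) j1]
    refine integral_congr_ae (Eventually.of_forall fun ζ => ?_)
    simp only
    rw [integral_mul_const, mul_comm]
  -- The translate of φ to the right is again a test function in the half space, so the weak
  -- derivative may be moved onto it.
  have e4 : ∀ s ∈ Ioc 0 h, ∫ ζ, Γ (ζ + s • axisVec) * φ ζ =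
      -∫ ζ, g ζ * fderiv ℝ φ (ζ - s • axisVec) axisVec := by
    intro s hs0
    set φs : Vel → ℝ := fun ζ => φ (ζ - s • axisVec) with hφs
    have hsup : tsupport φs ⊆ halfPos := by
      have h1 : tsupport φs ⊆ (fun ζ : Vel => ζ + s • axisVec) '' tsupport φ := by
        refine closure_minimal (fun ζ hζ => ?_) ((hc.image (by fun_prop)).isClosed)
        exact ⟨ζ - s • axisVec, subset_tsupport _ hζ, by simp⟩
      refine h1.trans ?_
      rintro _ ⟨z, hz, rfl⟩
      exact add_smul_axisVec_mem (hs hz) hs0.1.le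
    have hcs : HasCompactSupport φs :=
      hc.comp_homeomorph (Homeomorph.subRight (s • axisVec : Vel))
    have hw := hweak φs (hφ.comp (by fun_prop)) hcs hsup
    have hzs : ∀ ζ, ζ ∉ halfPos → φs ζ = 0 := fun ζ hζ =>
      image_eq_zero_of_notMem_tsupport fun hn => hζ (hsup hn)
    have hzs' : ∀ ζ, ζ ∉ halfPos → fderiv ℝ φs ζ axisVec = 0 := fun ζ hζ => by
      rw [fderiv_of_notMem_tsupport ℝ fun hn => hζ (hsup hn)]; rfl
    rw [setIntegral_halfPos_eq fun ζ hζ => by rw [hzs' ζ hζ, mul_zero],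
      setIntegral_halfPos_eq fun ζ hζ => by rw [hzs ζ hζ, mul_zero]] at hw
    have hfd : ∀ ζ, fderiv ℝ φs ζ axisVec = fderiv ℝ φ (ζ - s • axisVec) axisVec := fun ζ => by
      rw [hφs]; simp only [sub_eq_add_neg]; rw [fderiv_comp_add_right]
    simp only [hfd] at hw
    rw [hw, neg_neg, ← integral_add_right_eq_self (fun ζ => Γ ζ * φs ζ) (s • axisVec)]
    simp [hφs]
  -- For the smooth φ the fundamental theorem of calculus along the segment is classical; duality
  -- transfers it to g.
  have e5 : ∀ ζ, ∫ s in Ioc 0 h, g ζ * fderiv ℝ φ (ζ - s • axisVec) axisVec =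
      g ζ * (φ ζ - φ (ζ - h • axisVec)) := by
    intro ζ
    rw [integral_const_mul, ← intervalIntegral.integral_of_le h0]
    congr 1
    have hderiv : ∀ s ∈ uIcc 0 h, HasDerivAt (fun s : ℝ => -φ (ζ - s • axisVec))
        (fderiv ℝ φ (ζ - s • axisVec) axisVec) s := by
      intro s _
      have h1 : HasDerivAt (fun s : ℝ => ζ - s • axisVec) (-axisVec) s := by
        simpa using ((hasDerivAt_id s).smul_const axisVec).const_sub ζ
      have h2 := ((hφ.differentiable (by simp)) (ζ - s • axisVec)).hasFDerivAt.comp_hasDerivAt s h1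
      refine h2.fun_neg.congr_deriv ?_
      simp
    rw [intervalIntegral.integral_eq_sub_of_hasDerivAt hderiv
      ((hd.comp (by fun_prop)).intervalIntegrable _ _)]
    simp
    ring
  have i4 : Integrable fun ζ => φ (ζ - h • axisVec) * g ζ := by
    have := i1.comp_sub_right (h • axisVec)
    simpa using this
  have e6 : ∫ ζ, φ ζ * g (ζ + h • axisVec) = ∫ ζ, φ (ζ - h • axisVec) * g ζ := by
    rw [← integral_add_right_eq_self (fun ζ => φ (ζ - h • axisVec) * g ζ) (h • axisVec)]
    simp
  have e7 : ∫ ζ, φ ζ * ∫ s in Ioc 0 h, Γ (ζ + s • axisVec) =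
      (∫ ζ, φ (ζ - h • axisVec) * g ζ) - ∫ ζ, φ ζ * g ζ := by
    rw [e3, setIntegral_congr_fun measurableSet_Ioc e4, integral_neg,
      ← integral_integral_swap (f := fun ζ s => g ζ * fderiv ℝ φ (ζ - s • axisVec) axisVec) j2,
      ← integral_sub i4 i2, ← integral_neg]
    refine integral_congr_ae (Eventually.of_forall fun ζ => ?_)
    simp only
    rw [e5]
    ring
  have hsum : ∀ ζ, φ ζ • ((fun ζ => g (ζ + h • axisVec)) - g -
      fun ζ => ∫ s in Ioc 0 h, Γ (ζ + s • axisVec)) ζ = φ ζ * g (ζ + h • axisVec) - φ ζ * g ζ -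
      φ ζ * ∫ s in Ioc 0 h, Γ (ζ + s • axisVec) := fun ζ => by
    simp only [Pi.sub_apply, smul_eq_mul]; ring
  simp only [hsum]
  have i12 : Integrable fun ζ => φ ζ * g (ζ + h • axisVec) - φ ζ * g ζ := i1.sub i2
  rw [integral_sub i12 i3, integral_sub i1 i2, e6, e7]
  ring

/-! ### Traces on the boundary of the half space -/

/-- The variable upper limit is encoded in an indicator, so that the integral is one over a fixed
space with a jointly measurable integrand. -/
theorem measurable_setIntegral_Ioc {α : Type*} [MeasurableSpace α] {F : α × ℝ → ℝ}
    (hF : Measurable F) {u : α → ℝ} (hu : Measurable u) :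
    Measurable fun x => ∫ s in Ioc 0 (u x), F (x, s) := by
  have hset : MeasurableSet {p : α × ℝ | 0 < p.2 ∧ p.2 ≤ u p.1} :=
    (measurableSet_lt measurable_const measurable_snd).inter
      (measurableSet_le measurable_snd (hu.comp measurable_fst))
  have h1 : Measurable fun x => ∫ s, {p : α × ℝ | 0 < p.2 ∧ p.2 ≤ u p.1}.indicator F (x, s) :=
    ((hF.indicator hset).stronglyMeasurable.integral_prod_right' (ν := volume)).measurable
  convert h1 using 2 with x
  rw [← integral_indicator measurableSet_Ioc]
  refine integral_congr_ae (Eventually.of_forall fun s => ?_)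
  by_cases hs : 0 < s ∧ s ≤ u x <;> simp [indicator, hs]

theorem vel_mk_add_smul_axisVec (t h : ℝ) (q : ℝ × ℝ) :
    (!₂[t, q.1, q.2] : Vel) + h • axisVec = !₂[t + h, q.1, q.2] := by
  ext i
  fin_cases i <;> simp [axisVec]

theorem measurable_vel_slice (q : ℝ × ℝ) : Measurable fun t : ℝ => (!₂[t, q.1, q.2] : Vel) :=
  measurable_vel_mk.comp (measurable_id.prodMk measurable_const)

/-- The fundamental theorem of calculus along almost every line in the direction of the first
coordinate. -/
theorem ae_slice_sub_eq {g Γ : Vel → ℝ} (hg : Measurable g) (hΓ : Measurable Γ)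
    (h : ∀ h : ℝ, 0 ≤ h → ∀ᵐ ζ : Vel, ζ ∈ halfPos →
      g (ζ + h • axisVec) - g ζ = ∫ s in Ioc 0 h, Γ (ζ + s • axisVec)) :
    ∀ᵐ q : ℝ × ℝ, ∀ᵐ t : ℝ, 0 < t → ∀ᵐ h : ℝ, 0 < h →
      g !₂[t + h, q.1, q.2] - g !₂[t, q.1, q.2] = ∫ s in Ioc 0 h, Γ !₂[t + s, q.1, q.2] := by
  set P : ℝ → Vel → Prop := fun h ζ => 0 < h → ζ ∈ halfPos →
      g (ζ + h • axisVec) - g ζ = ∫ s in Ioc 0 h, Γ (ζ + s • axisVec) with hP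
  have h1 : ∀ᵐ h : ℝ, ∀ᵐ ζ : Vel, P h ζ := Eventually.of_forall fun t => by
    by_cases ht : 0 < t
    · filter_upwards [h t ht.le] with ζ hζ _ hm using hζ hm
    · exact Eventually.of_forall fun ζ h => absurd h ht
  have hmeas : MeasurableSet {x : ℝ × Vel | P x.1 x.2} := by
    have m1 : MeasurableSet {x : ℝ × Vel | 0 < x.1} := measurableSet_lt measurable_const
      measurable_fst
    have m2 : MeasurableSet {x : ℝ × Vel | x.2 ∈ halfPos} :=
      measurable_snd isOpen_halfPos.measurableSet
    have m4 : Measurable fun x : ℝ × Vel => ∫ s in Ioc 0 x.1, Γ (x.2 + s • axisVec) :=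
      measurable_setIntegral_Ioc (F := fun p : (ℝ × Vel) × ℝ => Γ (p.1.2 + p.2 • axisVec))
        (by fun_prop) measurable_fst
    have m3 : MeasurableSet {x : ℝ × Vel | g (x.2 + x.1 • axisVec) - g x.2 =
        ∫ s in Ioc 0 x.1, Γ (x.2 + s • axisVec)} := measurableSet_eq_fun (by fun_prop) m4
    convert m1.compl.union (m2.compl.union m3) using 1
    ext x
    simp only [hP, mem_ofPred_eq, mem_union, mem_compl_iff]
    tauto
  -- The exceptional set of ζ depends on h. Joint measurability lets Fubini exchange the
  -- quantifiers, so that almost every starting point works for almost every increment; this is why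
  -- the conclusion holds only for almost every h.
  rw [Measure.ae_ae_comm hmeas] at h1
  have h2 := measurePreserving_velCoord.symm.quasiMeasurePreserving.ae h1
  have h3 : ∀ᵐ p : (ℝ × ℝ) × ℝ, ∀ᵐ h : ℝ, P h !₂[p.2, p.1.1, p.1.2] := by
    have := (Measure.measurePreserving_swap (μ := (volume : Measure (ℝ × ℝ)))
      (ν := (volume : Measure ℝ))).quasiMeasurePreserving.ae h2
    simp only [velCoord_symm_apply] at this
    exact this
  filter_upwards [Measure.ae_ae_of_ae_prod h3] with q hq
  filter_upwards [hq] with t ht ht0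
  filter_upwards [ht] with s hs hs0
  have := hs hs0 (show 0 < (!₂[t, q.1, q.2] : Vel) 0 by simpa using ht0)
  simpa only [vel_mk_add_smul_axisVec] using this

/-- φ(t) - ∫₀ᵗ G is almost everywhere constant on (0,1), and the constant is the boundary value of
φ. It is written as the mean over (0,1) so that it will depend measurably on the line. The remainder
∫₀ᵗ |G| is at most t^a ∫ s^{-a} |G|, since (t/s)^a ≥ 1 for s ≤ t. -/
theorem ae_enorm_sub_integral_le {φ G : ℝ → ℝ} (hφ : Measurable φ) (hG : Measurable G) {a : ℝ}
    (ha : 0 ≤ a) (hfin : ∫⁻ s in Ioo (0 : ℝ) 1, ENNReal.ofReal (s ^ (-a)) * ‖G s‖ₑ < ⊤)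
    (H : ∀ᵐ t : ℝ, 0 < t → ∀ᵐ h : ℝ, 0 < h → φ (t + h) - φ t = ∫ s in Ioc 0 h, G (t + s)) :
    ∀ᵐ t : ℝ, t ∈ Ioo (0 : ℝ) 1 →
      ‖φ t - ∫ τ in Ioo (0 : ℝ) 1, (φ τ - ∫ s in Ioc 0 τ, G s)‖ₑ ≤
        ENNReal.ofReal (t ^ a) * ∫⁻ s in Ioo (0 : ℝ) 1, ENNReal.ofReal (s ^ (-a)) * ‖G s‖ₑ := by
  have hGint : IntegrableOn G (Ioo 0 1) := by
    refine ⟨hG.aestronglyMeasurable, lt_of_le_of_lt (setLIntegral_mono' measurableSet_Ioo ?_) hfin⟩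
    intro s hs
    have : 1 ≤ s ^ (-a) := Real.one_le_rpow_of_pos_of_le_one_of_nonpos hs.1 hs.2.le (by linarith)
    calc ‖G s‖ₑ = ENNReal.ofReal 1 * ‖G s‖ₑ := by simp
      _ ≤ _ := by gcongr
  set Φ : ℝ → ℝ := fun t => φ t - ∫ s in Ioc 0 t, G s with hΦ
  have hΦm : Measurable Φ := hφ.sub
    (measurable_setIntegral_Ioc (F := fun p : ℝ × ℝ => G p.2) (by fun_prop) measurable_id)
  have hint : ∀ u v : ℝ, 0 < u → u ≤ v → v < 1 → IntervalIntegrable G volume u v := by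
    intro u v hu huv hv
    rw [intervalIntegrable_iff_integrableOn_Ioc_of_le huv]
    exact hGint.mono_set fun s hs => ⟨hu.trans hs.1, hs.2.trans_lt hv⟩
  have hint0 : ∀ v : ℝ, 0 ≤ v → v < 1 → IntervalIntegrable G volume 0 v := by
    intro v hv hv1
    rw [intervalIntegrable_iff_integrableOn_Ioc_of_le hv]
    exact hGint.mono_set fun s hs => ⟨hs.1, hs.2.trans_lt hv1⟩
  set P : ℝ → ℝ → Prop := fun t t' => 0 < t → t < t' → t' < 1 → Φ t' = Φ t with hP
  have h1 : ∀ᵐ t : ℝ, ∀ᵐ t' : ℝ, P t t' := by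
    filter_upwards [H] with t ht
    by_cases ht0 : 0 < t
    · have h2 := (measurePreserving_sub_right (volume : Measure ℝ) t).quasiMeasurePreserving.ae
        (ht ht0)
      filter_upwards [h2] with t' ht' _ htt' ht1
      have e := ht' (by linarith)
      rw [add_sub_cancel, ← intervalIntegral.integral_of_le (by linarith),
        intervalIntegral.integral_comp_add_left (fun s => G s), add_zero, add_sub_cancel] at e
      have e2 := intervalIntegral.integral_add_adjacent_intervals (hint0 t ht0.le (by linarith))
        (hint t t' ht0 htt'.le ht1)
      simp only [hΦ]
      rw [← intervalIntegral.integral_of_le (by linarith),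
        ← intervalIntegral.integral_of_le ht0.le]
      linarith
    · exact Eventually.of_forall fun t' h => absurd h ht0
  have hPm : MeasurableSet {x : ℝ × ℝ | P x.1 x.2} := by
    have m1 : MeasurableSet {x : ℝ × ℝ | 0 < x.1} := measurableSet_lt measurable_const
      measurable_fst
    have m2 : MeasurableSet {x : ℝ × ℝ | x.1 < x.2} := measurableSet_lt measurable_fst
      measurable_snd
    have m3 : MeasurableSet {x : ℝ × ℝ | x.2 < 1} := measurableSet_lt measurable_snd
      measurable_const
    have m4 : MeasurableSet {x : ℝ × ℝ | Φ x.2 = Φ x.1} := measurableSet_eq_fun (by fun_prop)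
      (by fun_prop)
    convert m1.compl.union (m2.compl.union (m3.compl.union m4)) using 1
    ext x
    simp only [hP, mem_ofPred_eq, mem_union, mem_compl_iff]
    tauto
  have h2 := (Measure.ae_ae_comm hPm).1 h1
  have hne : (ae (volume.restrict (Ioo (0 : ℝ) 1))).NeBot := by
    rw [ae_neBot, Ne, Measure.restrict_eq_zero]
    simp
  -- A reference point for which the comparison holds with almost every t to its right and almost
  -- every t to its left.
  obtain ⟨t₀, ⟨hta, htb⟩, htm⟩ := ((ae_restrict_of_ae (h1.and h2)).and
    (ae_restrict_mem (measurableSet_Ioo (a := (0 : ℝ)) (b := 1)))).exists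
  have hconst : ∀ᵐ t : ℝ, t ∈ Ioo (0 : ℝ) 1 → Φ t = Φ t₀ := by
    filter_upwards [hta, htb] with t h3 h4 ht
    rcases lt_trichotomy t t₀ with h | h | h
    · exact (h4 ht.1 h htm.2).symm
    · rw [h]
    · exact h3 htm.1 h ht.2
  have hc : ∫ τ in Ioo (0 : ℝ) 1, (φ τ - ∫ s in Ioc 0 τ, G s) = Φ t₀ := by
    rw [setIntegral_congr_ae (g := fun _ => Φ t₀) measurableSet_Ioo hconst]
    simp
  filter_upwards [hconst] with t ht htI
  rw [hc, ← ht htI]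
  simp only [hΦ, sub_sub_cancel]
  refine (enorm_integral_le_lintegral_enorm _).trans ?_
  rw [← lintegral_const_mul _ (by fun_prop)]
  calc ∫⁻ s in Ioc 0 t, ‖G s‖ₑ
      ≤ ∫⁻ s in Ioc 0 t, ENNReal.ofReal (t ^ a) * (ENNReal.ofReal (s ^ (-a)) * ‖G s‖ₑ) := by
        refine setLIntegral_mono' measurableSet_Ioc fun s hs => ?_
        rw [← mul_assoc, ← ENNReal.ofReal_mul (Real.rpow_nonneg htI.1.le _)]
        have : 1 ≤ t ^ a * s ^ (-a) := by
          rw [Real.rpow_neg hs.1.le, ← div_eq_mul_inv, one_le_div (Real.rpow_pos_of_pos hs.1 _)]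
          exact Real.rpow_le_rpow hs.1.le hs.2 ha
        calc ‖G s‖ₑ = ENNReal.ofReal 1 * ‖G s‖ₑ := by simp
          _ ≤ _ := by gcongr
    _ ≤ _ := lintegral_mono_set (Ioc_subset_Ioo_right htI.2)

/-- The weighted integral of `|Γ|` along the first unit of a line in the direction of the first
coordinate. -/
noncomputable def traceMajorant (a : ℝ) (Γ : Vel → ℝ) (q : ℝ × ℝ) : ℝ≥0∞ :=
  ∫⁻ s in Ioo (0 : ℝ) 1, ENNReal.ofReal (s ^ (-a)) * ‖Γ !₂[s, q.1, q.2]‖ₑ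

theorem measurable_vel_swap :
    Measurable fun p : (ℝ × ℝ) × ℝ => (!₂[p.2, p.1.1, p.1.2] : Vel) :=
  measurable_vel_mk.comp measurable_swap

theorem measurable_traceMajorant (a : ℝ) {Γ : Vel → ℝ} (hΓ : Measurable Γ) :
    Measurable (traceMajorant a Γ) := by
  have h1 : Measurable fun p : (ℝ × ℝ) × ℝ => Γ !₂[p.2, p.1.1, p.1.2] :=
    hΓ.comp measurable_vel_swap
  have h2 : Measurable fun p : (ℝ × ℝ) × ℝ =>
      ENNReal.ofReal (p.2 ^ (-a)) * ‖Γ !₂[p.2, p.1.1, p.1.2]‖ₑ := by fun_prop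
  exact h2.lintegral_prod_right'

theorem exists_trace {g Γ : Vel → ℝ} (hg : Measurable g) (hΓ : Measurable Γ) {a : ℝ} (ha : 0 ≤ a)
    (hfin : ∀ᵐ q : ℝ × ℝ, traceMajorant a Γ q < ⊤)
    (h : ∀ h : ℝ, 0 ≤ h → ∀ᵐ ζ : Vel, ζ ∈ halfPos →
      g (ζ + h • axisVec) - g ζ = ∫ s in Ioc 0 h, Γ (ζ + s • axisVec)) :
    ∃ g₀ : ℝ × ℝ → ℝ, Measurable g₀ ∧ ∀ᵐ q : ℝ × ℝ, ∀ᵐ t : ℝ, t ∈ Ioo (0 : ℝ) 1 →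
      ‖g !₂[t, q.1, q.2] - g₀ q‖ₑ ≤ ENNReal.ofReal (t ^ a) * traceMajorant a Γ q := by
  refine ⟨fun q => ∫ τ in Ioo (0 : ℝ) 1, (g !₂[τ, q.1, q.2] - ∫ s in Ioc 0 τ, Γ !₂[s, q.1, q.2]),
    ?_, ?_⟩
  · have h1 : Measurable fun p : (ℝ × ℝ) × ℝ => g !₂[p.2, p.1.1, p.1.2] :=
      hg.comp measurable_vel_swap
    have h2 : Measurable fun p : ((ℝ × ℝ) × ℝ) × ℝ => Γ !₂[p.2, p.1.1.1, p.1.1.2] :=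
      hΓ.comp (measurable_vel_swap.comp
        ((measurable_fst.comp measurable_fst).prodMk measurable_snd))
    have h3 : Measurable fun p : (ℝ × ℝ) × ℝ => g !₂[p.2, p.1.1, p.1.2] -
        ∫ s in Ioc 0 p.2, Γ !₂[s, p.1.1, p.1.2] :=
      h1.sub (measurable_setIntegral_Ioc h2 measurable_snd)
    exact (h3.stronglyMeasurable.integral_prod_right'
      (ν := volume.restrict (Ioo (0 : ℝ) 1))).measurable
  · filter_upwards [ae_slice_sub_eq hg hΓ h, hfin] with q hq hqf
    exact ae_enorm_sub_integral_le (φ := fun t => g !₂[t, q.1, q.2])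
      (G := fun t => Γ !₂[t, q.1, q.2]) (hg.comp (measurable_vel_slice q))
      (hΓ.comp (measurable_vel_slice q)) ha hqf hq

theorem measurePreserving_vel_mk :
    MeasurePreserving (fun p : ℝ × ℝ × ℝ => (!₂[p.1, p.2.1, p.2.2] : Vel)) := by
  have h : (fun p : ℝ × ℝ × ℝ => (!₂[p.1, p.2.1, p.2.2] : Vel)) = velCoord.symm :=
    funext fun p => (velCoord_symm_apply p).symm
  rw [h]
  exact measurePreserving_velCoord.symm

theorem eLpNorm_slab_le {Γ : Vel → ℝ} (hΓ : Measurable Γ) (p : ℝ≥0∞) :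
    eLpNorm (fun z : ℝ × ℝ × ℝ => Γ !₂[z.1, z.2.1, z.2.2]) p
      ((volume.restrict (Ioo (0 : ℝ) 1)).prod (volume : Measure (ℝ × ℝ))) ≤
      eLpNorm Γ p (volume.restrict halfPos) := by
  have h1 := measurePreserving_vel_mk.restrict_preimage isOpen_halfPos.measurableSet
  rw [← eLpNorm_comp_measurePreserving hΓ.aestronglyMeasurable h1]
  refine eLpNorm_mono_measure _ ?_
  have h2 : (volume.restrict (Ioo (0 : ℝ) 1)).prod (volume : Measure (ℝ × ℝ)) =
      (volume : Measure (ℝ × ℝ × ℝ)).restrict (Ioo (0 : ℝ) 1 ×ˢ univ) := by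
    rw [Measure.volume_eq_prod ℝ (ℝ × ℝ), ← Measure.prod_restrict, Measure.restrict_univ]
  rw [h2]
  refine Measure.restrict_mono (fun z hz => ?_) le_rfl
  change 0 < (!₂[z.1, z.2.1, z.2.2] : Vel) 0
  simpa using hz.1.1

theorem integrable_gauss_two {κ : ℝ} (hκ : 0 < κ) :
    Integrable fun q : ℝ × ℝ => Real.exp (-(κ * (q.1 ^ 2 + q.2 ^ 2))) := by
  refine ((integrable_exp_neg_mul_sq hκ).mul_prod (integrable_exp_neg_mul_sq hκ)).congr
    (Eventually.of_forall fun q => ?_)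
  simp only
  rw [← Real.exp_add]
  congr 1
  ring

theorem lintegral_slab_le {Γ : Vel → ℝ} (hΓ : Measurable Γ) (p q : ℝ≥0∞)
    [ENNReal.HolderConjugate p q] (a κ : ℝ) :
    ∫⁻ y : ℝ × ℝ, ENNReal.ofReal (Real.exp (-(κ * (y.1 ^ 2 + y.2 ^ 2)))) * traceMajorant a Γ y ≤
      eLpNorm Γ p (volume.restrict halfPos) *
        eLpNorm (fun z : ℝ × ℝ × ℝ => z.1 ^ (-a) * Real.exp (-(κ * (z.2.1 ^ 2 + z.2.2 ^ 2)))) q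
          ((volume.restrict (Ioo (0 : ℝ) 1)).prod (volume : Measure (ℝ × ℝ))) := by
  set μ := (volume.restrict (Ioo (0 : ℝ) 1)).prod (volume : Measure (ℝ × ℝ)) with hμ
  have h1 : Measurable fun z : ℝ × ℝ × ℝ => Γ !₂[z.1, z.2.1, z.2.2] := hΓ.comp measurable_vel_mk
  refine le_trans (le_of_eq ?_) ((lintegral_enorm_mul_le (μ := μ)
    (g := fun z : ℝ × ℝ × ℝ => z.1 ^ (-a) * Real.exp (-(κ * (z.2.1 ^ 2 + z.2.2 ^ 2))))
    h1.aestronglyMeasurable (by fun_prop) p q).trans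
      (mul_le_mul_left (eLpNorm_slab_le hΓ p) _))
  rw [hμ, lintegral_prod_symm' _ (by fun_prop)]
  refine lintegral_congr fun y => ?_
  have h2 : Measurable fun t : ℝ => Γ !₂[t, y.1, y.2] := hΓ.comp (measurable_vel_slice y)
  rw [traceMajorant, ← lintegral_const_mul _ (by fun_prop)]
  refine setLIntegral_congr_fun measurableSet_Ioo fun s hs => ?_
  simp only
  rw [Real.enorm_eq_ofReal (mul_nonneg (Real.rpow_nonneg hs.1.le _) (Real.exp_nonneg _)),
    ENNReal.ofReal_mul (Real.rpow_nonneg hs.1.le _)]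
  ring

/-- Hölder's inequality on the slab 0 < t < 1. Since p > 1, the conjugate exponent r is finite, and
a = 1/(2r) gives a r = 1/2 < 1, so the r-th power of s^{-a} is integrable at 0. The Gaussian takes
care of the unbounded tangential directions. -/
theorem exists_lintegral_traceMajorant_le {p : ℝ≥0∞} (hp : 1 < p) {κ : ℝ} (hκ : 0 < κ) :
    ∃ a : ℝ, 0 < a ∧ ∃ C : ℝ≥0, ∀ Γ : Vel → ℝ, Measurable Γ →
      ∫⁻ y : ℝ × ℝ, ENNReal.ofReal (Real.exp (-(κ * (y.1 ^ 2 + y.2 ^ 2)))) *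
        traceMajorant a Γ y ≤ C * eLpNorm Γ p (volume.restrict halfPos) := by
  set q := ENNReal.conjExponent p with hq
  have hpq : p.HolderConjugate q := ENNReal.HolderConjugate.conjExponent hp.le
  have hq1 : 1 ≤ q := by rw [hq, ENNReal.conjExponent]; exact le_self_add
  have hqt : q ≠ ⊤ := by
    rw [hq, ENNReal.conjExponent]
    simp only [ne_eq, ENNReal.add_eq_top, ENNReal.one_ne_top, ENNReal.inv_eq_top, false_or]
    exact (tsub_pos_of_lt hp).ne'
  set r := q.toReal with hr
  have hr1 : 1 ≤ r := by
    have := ENNReal.toReal_mono hqt hq1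
    simpa using this
  have hr0 : 0 < r := by linarith
  set a := 1 / (2 * r) with ha
  have har : a * r = 1 / 2 := by rw [ha]; field_simp
  have ha0 : 0 < a := by positivity
  refine ⟨a, ha0, ?_⟩
  have hL : MemLp (fun z : ℝ × ℝ × ℝ => z.1 ^ (-a) * Real.exp (-(κ * (z.2.1 ^ 2 + z.2.2 ^ 2)))) q
      ((volume.restrict (Ioo (0 : ℝ) 1)).prod (volume : Measure (ℝ × ℝ))) := by
    rw [← integrable_norm_rpow_iff (by fun_prop) (by positivity) hqt]
    have i1 : Integrable (fun s : ℝ => s ^ (-(1 / 2) : ℝ)) (volume.restrict (Ioo (0 : ℝ) 1)) := by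
      have := intervalIntegral.intervalIntegrable_rpow' (a := 0) (b := 1) (r := -(1 / 2))
        (by norm_num)
      rw [intervalIntegrable_iff_integrableOn_Ioo_of_le zero_le_one] at this
      exact this
    refine (i1.mul_prod (integrable_gauss_two (κ := κ * r) (by positivity))).congr ?_
    filter_upwards [Measure.quasiMeasurePreserving_fst.ae (ae_restrict_mem measurableSet_Ioo)]
      with z hz
    have hz0 : 0 < z.1 := hz.1
    rw [Real.norm_of_nonneg (by positivity), Real.mul_rpow (by positivity) (by positivity),
      ← Real.rpow_mul hz0.le, ← Real.exp_mul, neg_mul, har]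
    congr 2
    ring
  refine ⟨(eLpNorm (fun z : ℝ × ℝ × ℝ => z.1 ^ (-a) *
    Real.exp (-(κ * (z.2.1 ^ 2 + z.2.2 ^ 2)))) q
      ((volume.restrict (Ioo (0 : ℝ) 1)).prod (volume : Measure (ℝ × ℝ)))).toNNReal,
    fun Γ hΓ => ?_⟩
  rw [ENNReal.coe_toNNReal hL.2.ne, mul_comm]
  exact lintegral_slab_le hΓ p q a κ

/-! ### The logarithmic singularity -/

/-- The half space `t > 0` in the coordinates `(t, q)`. -/
noncomputable def halfMeasure : Measure (ℝ × ℝ × ℝ) :=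
  (volume.restrict (Ioi (0 : ℝ))).prod (volume : Measure (ℝ × ℝ))

/-- The slab `0 < t < 1` in the coordinates `(t, q)`. -/
noncomputable def slabMeasure : Measure (ℝ × ℝ × ℝ) :=
  (volume.restrict (Ioo (0 : ℝ) 1)).prod (volume : Measure (ℝ × ℝ))

theorem slabMeasure_le : slabMeasure ≤ halfMeasure :=
  Measure.prod_mono (Measure.restrict_mono Ioo_subset_Ioi_self le_rfl) le_rfl

theorem ae_halfMeasure : ∀ᵐ p ∂halfMeasure, 0 < p.1 :=
  Measure.quasiMeasurePreserving_fst.ae (ae_restrict_mem measurableSet_Ioi)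

theorem ae_slabMeasure : ∀ᵐ p ∂slabMeasure, p.1 ∈ Ioo (0 : ℝ) 1 :=
  Measure.quasiMeasurePreserving_fst.ae (ae_restrict_mem measurableSet_Ioo)

theorem ae_halfMeasure_of_ae_slabMeasure {P : ℝ × ℝ × ℝ → Prop} (h : ∀ᵐ p ∂slabMeasure, P p) :
    ∀ᵐ p ∂halfMeasure, p.1 < 1 → P p := by
  have h1 : slabMeasure = halfMeasure.restrict (Iio (1 : ℝ) ×ˢ univ) := by
    rw [slabMeasure, halfMeasure, ← Measure.prod_restrict, Measure.restrict_univ,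
      Measure.restrict_restrict measurableSet_Iio]
    congr 2
    ext t; simp [and_comm]
  rw [h1, ae_restrict_iff' (measurableSet_Iio.prod MeasurableSet.univ)] at h
  filter_upwards [h] with p hp hp1 using hp ⟨hp1, mem_univ _⟩

/-- A Gaussian weight in the tangential variables. -/
noncomputable def tanWeight (q : ℝ × ℝ) : ℝ := Real.exp (-(1 / 8 * (q.1 ^ 2 + q.2 ^ 2)))

theorem tanWeight_pos (q : ℝ × ℝ) : 0 < tanWeight q := Real.exp_pos _

theorem measurable_tanWeight : Measurable tanWeight := by unfold tanWeight; fun_prop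

/-- `h` has the boundary value `h₀` at a Hölder rate, with weighted bounds. -/
structure HasHolderTrace (δ : ℝ) (h : ℝ × ℝ × ℝ → ℝ) (h₀ : ℝ × ℝ → ℝ) (X : ℝ × ℝ → ℝ≥0∞)
    (N : ℝ≥0∞) : Prop where
  measurable : Measurable h
  measurable_trace : Measurable h₀
  measurable_bound : Measurable X
  near : ∀ᵐ p ∂slabMeasure, ‖h p - h₀ p.2‖ₑ ≤ ENNReal.ofReal (p.1 ^ δ) * X p.2
  bound_le : ∫⁻ q, ENNReal.ofReal (tanWeight q) * X q ≤ N
  le : ∫⁻ p, ENNReal.ofReal (Real.exp (-(p.1 ^ 2 / 8)) * tanWeight p.2) * ‖h p‖ₑ ∂halfMeasure ≤ N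

/-- On the slab |h₀| ≤ |h| + X, and integrating over the unit interval in t leaves the integral of
|h₀| unchanged. There e^{-t²/8} ≥ 1/2, so the two contributions are at most 2N and N. -/
theorem HasHolderTrace.trace_le {δ : ℝ} {h : ℝ × ℝ × ℝ → ℝ} {h₀ : ℝ × ℝ → ℝ} {X : ℝ × ℝ → ℝ≥0∞}
    {N : ℝ≥0∞} (H : HasHolderTrace δ h h₀ X N) (hδ : 0 < δ) :
    ∫⁻ q, ENNReal.ofReal (tanWeight q) * ‖h₀ q‖ₑ ≤ 3 * N := by
  have m1 := H.measurable
  have m2 := H.measurable_trace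
  have m3 := H.measurable_bound
  have mw := measurable_tanWeight
  have e1 : ∫⁻ p, ENNReal.ofReal (tanWeight p.2) * ‖h₀ p.2‖ₑ ∂slabMeasure =
      ∫⁻ q, ENNReal.ofReal (tanWeight q) * ‖h₀ q‖ₑ := by
    have := lintegral_prod_mul (μ := volume.restrict (Ioo (0 : ℝ) 1))
      (ν := (volume : Measure (ℝ × ℝ))) (f := fun _ => 1)
      (g := fun q => ENNReal.ofReal (tanWeight q) * ‖h₀ q‖ₑ) (by fun_prop) (by fun_prop)
    simpa [slabMeasure] using this
  have e2 : ∫⁻ p, ENNReal.ofReal (tanWeight p.2) * X p.2 ∂slabMeasure =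
      ∫⁻ q, ENNReal.ofReal (tanWeight q) * X q := by
    have := lintegral_prod_mul (μ := volume.restrict (Ioo (0 : ℝ) 1))
      (ν := (volume : Measure (ℝ × ℝ))) (f := fun _ => 1)
      (g := fun q => ENNReal.ofReal (tanWeight q) * X q) (by fun_prop) (by fun_prop)
    simpa [slabMeasure] using this
  rw [← e1]
  calc ∫⁻ p, ENNReal.ofReal (tanWeight p.2) * ‖h₀ p.2‖ₑ ∂slabMeasure
      ≤ ∫⁻ p, (2 * (ENNReal.ofReal (Real.exp (-(p.1 ^ 2 / 8)) * tanWeight p.2) * ‖h p‖ₑ) +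
        ENNReal.ofReal (tanWeight p.2) * X p.2) ∂slabMeasure := by
        refine lintegral_mono_ae ?_
        filter_upwards [H.near, ae_slabMeasure] with p hp hp1
        have a1 : ‖h₀ p.2‖ₑ ≤ ‖h p‖ₑ + X p.2 := by
          have : ‖h₀ p.2‖ₑ ≤ ‖h p‖ₑ + ‖h p - h₀ p.2‖ₑ := by
            have := enorm_sub_le (a := h p) (b := h p - h₀ p.2)
            rwa [sub_sub_cancel] at this
          refine this.trans (add_le_add le_rfl (hp.trans ?_))
          refine mul_le_of_le_one_left zero_le (ENNReal.ofReal_le_one.2 ?_)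
          exact Real.rpow_le_one hp1.1.le hp1.2.le hδ.le
        have a2 : ENNReal.ofReal (tanWeight p.2) ≤
            2 * ENNReal.ofReal (Real.exp (-(p.1 ^ 2 / 8)) * tanWeight p.2) := by
          rw [← ENNReal.ofReal_ofNat, ← ENNReal.ofReal_mul (by norm_num)]
          refine ENNReal.ofReal_le_ofReal ?_
          have := Real.add_one_le_exp (-(p.1 ^ 2 / 8))
          have hw := tanWeight_pos p.2
          have : 1 ≤ 2 * Real.exp (-(p.1 ^ 2 / 8)) := by nlinarith [hp1.1, hp1.2]
          nlinarith
        calc ENNReal.ofReal (tanWeight p.2) * ‖h₀ p.2‖ₑ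
            ≤ ENNReal.ofReal (tanWeight p.2) * (‖h p‖ₑ + X p.2) := by gcongr
          _ = ENNReal.ofReal (tanWeight p.2) * ‖h p‖ₑ + ENNReal.ofReal (tanWeight p.2) * X p.2 :=
            mul_add _ _ _
          _ ≤ _ := by
            rw [← mul_assoc]
            gcongr
    _ = 2 * ∫⁻ p, ENNReal.ofReal (Real.exp (-(p.1 ^ 2 / 8)) * tanWeight p.2) * ‖h p‖ₑ ∂slabMeasure +
        ∫⁻ q, ENNReal.ofReal (tanWeight q) * X q := by
        rw [lintegral_add_left (by fun_prop), lintegral_const_mul _ (by fun_prop), e2]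
    _ ≤ 2 * N + N := by
        gcongr
        · exact (lintegral_mono' slabMeasure_le le_rfl).trans H.le
        · exact H.bound_le
    _ = 3 * N := by ring

/-- The majorant of the difference between `(1/t) exp (-(ν/t) x - t²/2)` and `1_{t>x} (1/t)`. -/
noncomputable def cutMajorant (x t : ℝ) : ℝ := if x < t then x * t ^ (-2 : ℝ) + 1 else 1 / x

theorem measurable_cutMajorant (x : ℝ) : Measurable (cutMajorant x) :=
  Measurable.ite (measurableSet_lt measurable_const measurable_id) (by fun_prop) measurable_const

theorem cutMajorant_nonneg {x t : ℝ} (hx : 0 < x) (ht : 0 < t) : 0 ≤ cutMajorant x t := by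
  unfold cutMajorant; split_ifs <;> positivity

/-- Each of the three pieces, x t⁻² on t > x, the constant 1/x on t ≤ x, and 1 on the unit interval,
has integral at most 1. The bound is uniform in x. -/
theorem lintegral_cutMajorant_le {x : ℝ} (hx : 0 < x) :
    ∫⁻ t in Ioo (0 : ℝ) 1, ENNReal.ofReal (cutMajorant x t) ≤ 3 := by
  have e1 : ∫⁻ t in Ioi x, ENNReal.ofReal (x * t ^ (-2 : ℝ)) = 1 := by
    have hi : IntegrableOn (fun t : ℝ => x * t ^ (-2 : ℝ)) (Ioi x) :=
      (integrableOn_Ioi_rpow_of_lt (by norm_num) hx).const_mul x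
    rw [← ofReal_integral_eq_lintegral_ofReal hi, integral_const_mul,
      integral_Ioi_rpow_of_lt (by norm_num) hx]
    · norm_num
      rw [Real.rpow_neg_one, mul_inv_cancel₀ hx.ne']
    · filter_upwards [ae_restrict_mem measurableSet_Ioi] with t ht
      have : 0 < t := hx.trans ht
      positivity
  have e2 : ∫⁻ t in Ioc 0 x, ENNReal.ofReal (1 / x) = 1 := by
    rw [setLIntegral_const, Real.volume_Ioc, ← ENNReal.ofReal_mul (by positivity)]
    simp [hx.ne']
  calc ∫⁻ t in Ioo (0 : ℝ) 1, ENNReal.ofReal (cutMajorant x t)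
      ≤ ∫⁻ t in Ioo (0 : ℝ) 1, ((Ioi x).indicator (fun t => ENNReal.ofReal (x * t ^ (-2 : ℝ))) t +
        (Ioc 0 x).indicator (fun _ => ENNReal.ofReal (1 / x)) t + 1) := by
        refine setLIntegral_mono' measurableSet_Ioo fun t ht => ?_
        unfold cutMajorant
        have ht0 := ht.1
        by_cases hxt : x < t
        · rw [if_pos hxt, indicator_of_mem (show t ∈ Ioi x from hxt),
            ENNReal.ofReal_add (by positivity) zero_le_one, ENNReal.ofReal_one]
          gcongr
          exact le_self_add
        · rw [if_neg hxt, indicator_of_mem (show t ∈ Ioc 0 x from ⟨ht.1, not_lt.1 hxt⟩)]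
          exact le_add_self.trans le_self_add
    _ ≤ (∫⁻ t, (Ioi x).indicator (fun t => ENNReal.ofReal (x * t ^ (-2 : ℝ))) t) +
        (∫⁻ t, (Ioc 0 x).indicator (fun _ => ENNReal.ofReal (1 / x)) t) +
        ∫⁻ t in Ioo (0 : ℝ) 1, 1 := by
        have hm1 : Measurable ((Ioi x).indicator (fun t => ENNReal.ofReal (x * t ^ (-2 : ℝ)))) :=
          Measurable.indicator (by fun_prop) measurableSet_Ioi
        have hm2 : Measurable ((Ioc 0 x).indicator (fun _ : ℝ => ENNReal.ofReal (1 / x))) :=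
          measurable_const.indicator measurableSet_Ioc
        rw [lintegral_add_right _ measurable_const, lintegral_add_left hm1]
        gcongr <;> exact Measure.restrict_le_self
    _ = 3 := by
        rw [lintegral_indicator measurableSet_Ioi, lintegral_indicator measurableSet_Ioc, e1, e2]
        simp
        norm_num

/-- For t > x, 1 - e^{-y} ≤ y with y = t²/2 + nx/t, and division by t gives t/2 + n x t⁻². For t ≤
x, e^{-s} ≤ 1/s with s = nx/t cancels the factor 1/t. -/
theorem abs_kernel_sub_le {ν₀ n x t : ℝ} (h0 : 0 < ν₀) (hn : ν₀ ≤ n) (hx : 0 < x) (ht : 0 < t)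
    (ht1 : t < 1) :
    |Real.exp (-(t ^ 2 / 2)) * (1 / t) * Real.exp (-(n / t) * x) -
      (Ioo x 1).indicator (fun t => 1 / t) t| ≤ (n + 1 + 1 / ν₀) * cutMajorant x t := by
  have hn0 : 0 < n := h0.trans_le hn
  have hν : 0 < 1 / ν₀ := by positivity
  unfold cutMajorant
  by_cases hxt : x < t
  · rw [if_pos hxt, indicator_of_mem (show t ∈ Ioo x 1 from ⟨hxt, ht1⟩), mul_right_comm,
      ← Real.exp_add]
    set y := t ^ 2 / 2 + n / t * x with hy
    have hy0 : 0 ≤ y := by positivity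
    have e0 : -(t ^ 2 / 2) + -(n / t) * x = -y := by rw [hy]; ring
    have e1 := Real.add_one_le_exp (-y)
    have e2 : Real.exp (-y) ≤ 1 := Real.exp_le_one_iff.2 (by linarith)
    rw [e0, show Real.exp (-y) * (1 / t) - 1 / t = -((1 - Real.exp (-y)) * (1 / t)) by ring,
      abs_neg, abs_of_nonneg (mul_nonneg (by linarith) (by positivity))]
    calc (1 - Real.exp (-y)) * (1 / t) ≤ y * (1 / t) := by gcongr; linarith
      _ = t / 2 + n * (x * t ^ (-2 : ℝ)) := by
        rw [hy, Real.rpow_neg ht.le, Real.rpow_two]; field_simp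
      _ ≤ 1 + n * (x * t ^ (-2 : ℝ)) := by gcongr; linarith
      _ ≤ (n + 1 + 1 / ν₀) * (x * t ^ (-2 : ℝ) + 1) := by
        have : 0 ≤ x * t ^ (-2 : ℝ) := by positivity
        nlinarith
  · rw [if_neg hxt, indicator_of_notMem (fun h => hxt h.1), sub_zero, abs_of_nonneg (by positivity)]
    have e1 : Real.exp (-(t ^ 2 / 2)) ≤ 1 := Real.exp_le_one_iff.2 (by
      have := sq_nonneg t; linarith)
    have e2 : 1 / t * Real.exp (-(n / t) * x) ≤ 1 / ν₀ * (1 / x) := by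
      have e3 : Real.exp (-(n / t) * x) ≤ 1 / (n / t * x) := by
        rw [neg_mul, Real.exp_neg, ← one_div]
        have := Real.add_one_le_exp (n / t * x)
        gcongr
        linarith
      calc 1 / t * Real.exp (-(n / t) * x) ≤ 1 / t * (1 / (n / t * x)) := by gcongr
        _ = 1 / n * (1 / x) := by field_simp
        _ ≤ 1 / ν₀ * (1 / x) := by gcongr
    calc Real.exp (-(t ^ 2 / 2)) * (1 / t) * Real.exp (-(n / t) * x)
        ≤ 1 * (1 / t * Real.exp (-(n / t) * x)) := by rw [mul_assoc]; gcongr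
      _ ≤ 1 / ν₀ * (1 / x) := by rw [one_mul]; exact e2
      _ ≤ (n + 1 + 1 / ν₀) * (1 / x) := by gcongr; linarith

/-- A bound that degenerates as x → 0; it is used only for absolute convergence at fixed x. -/
theorem one_div_mul_exp_le {ν₀ n x t : ℝ} (h0 : 0 < ν₀) (hn : ν₀ ≤ n) (hx : 0 < x) (ht : 0 < t) :
    1 / t * Real.exp (-(n / t) * x) ≤ 1 / (ν₀ * x) := by
  have hn0 : 0 < n := h0.trans_le hn
  have e3 : Real.exp (-(n / t) * x) ≤ 1 / (n / t * x) := by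
    rw [neg_mul, Real.exp_neg, ← one_div]
    have := Real.add_one_le_exp (n / t * x)
    gcongr
    linarith
  calc 1 / t * Real.exp (-(n / t) * x) ≤ 1 / t * (1 / (n / t * x)) := by gcongr
    _ = 1 / (n * x) := by field_simp
    _ ≤ 1 / (ν₀ * x) := by gcongr

theorem tangential_le (q : ℝ × ℝ) :
    2 + |q.1| + |q.2| ≤ 6 * Real.exp (1 / 8 * (q.1 ^ 2 + q.2 ^ 2)) := by
  have e := Real.add_one_le_exp (1 / 8 * (q.1 ^ 2 + q.2 ^ 2))
  have e1 : |q.1| ≤ 2 + q.1 ^ 2 / 8 := by rw [← sq_abs]; nlinarith [sq_nonneg (|q.1| - 4)]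
  have e2 : |q.2| ≤ 2 + q.2 ^ 2 / 8 := by rw [← sq_abs]; nlinarith [sq_nonneg (|q.2| - 4)]
  nlinarith [sq_nonneg q.1, sq_nonneg q.2]

/-- The logarithm is ∫ₓ¹ dt/t, obtained by replacing the kernel by 1_{x<t<1}/t and h by its trace.
Of the two factors `tanWeight` in the bound on P, one absorbs the linear growth of n in q and the
other is the weight in the norms of h, h₀ and X. -/
theorem exists_log_singularity_le {ν₀ ν₁ δ : ℝ} (h0 : 0 < ν₀) (h1 : 0 ≤ ν₁) (hδ : 0 < δ) :
    ∃ C : ℝ≥0, ∀ (n h : ℝ × ℝ × ℝ → ℝ) (h₀ : ℝ × ℝ → ℝ) (X : ℝ × ℝ → ℝ≥0∞) (N : ℝ≥0∞)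
      (P : ℝ × ℝ → ℝ) (A x : ℝ), HasHolderTrace δ h h₀ X N → N < ⊤ → Measurable n →
      (∀ p, ν₀ ≤ n p) → (∀ p : ℝ × ℝ × ℝ, p.1 ∈ Ioo (0 : ℝ) 1 → n p ≤ ν₁ * (2 + |p.2.1| + |p.2.2|)) →
      Measurable P → 0 ≤ A → (∀ q, |P q| ≤ A * (tanWeight q * tanWeight q)) → 0 < x → x ≤ 1 →
      Integrable (fun q => P q * h₀ q) ∧
      Integrable (fun p => P p.2 * (Real.exp (-(p.1 ^ 2 / 2)) * (1 / p.1) *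
        Real.exp (-(n p / p.1) * x)) * h p) halfMeasure ∧
      ‖(∫ p, P p.2 * (Real.exp (-(p.1 ^ 2 / 2)) * (1 / p.1) *
        Real.exp (-(n p / p.1) * x)) * h p ∂halfMeasure) - -Real.log x * ∫ q, P q * h₀ q‖ₑ ≤
        C * ENNReal.ofReal A * N := by
  set C₁ : ℝ := 6 * ν₁ + 1 + 1 / ν₀ with hC₁
  have hC₁0 : 0 ≤ C₁ := by positivity
  -- The summands belong to t ≥ 1, to the Hölder remainder with ∫₀¹ t^{δ-1} dt = 1/δ, and to the
  -- kernel comparison, where 9 = 3 · 3 combines `lintegral_cutMajorant_le` with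
  -- `HasHolderTrace.trace_le`.
  refine ⟨1 + Real.toNNReal (1 / δ) + Real.toNNReal C₁ * 9, ?_⟩
  intro n h h₀ X N P A x H hN hn hn0 hn1 hP hA hPA hx hx1
  have m1 := H.measurable
  have m2 := H.measurable_trace
  have m3 := H.measurable_bound
  have mw := measurable_tanWeight
  have mc := measurable_cutMajorant x
  have hw1 : ∀ q, tanWeight q ≤ 1 := fun q => Real.exp_le_one_iff.2 (by
    have := sq_nonneg q.1; have := sq_nonneg q.2; linarith)
  set ρ : ℝ × ℝ × ℝ → ℝ := fun p => Real.exp (-(p.1 ^ 2 / 2)) * (1 / p.1) *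
        Real.exp (-(n p / p.1) * x) with hρ
  have hρm : Measurable ρ := by simp only [hρ]; fun_prop
  have i0 : Integrable (fun q => P q * h₀ q) := by
    refine ⟨by fun_prop, lt_of_le_of_lt (b := ENNReal.ofReal A * (3 * N)) ?_
      (ENNReal.mul_lt_top ENNReal.ofReal_lt_top (ENNReal.mul_lt_top (by simp) hN))⟩
    refine le_trans ?_ (mul_le_mul_right (H.trace_le hδ) _)
    rw [← lintegral_const_mul _ (by fun_prop)]
    refine lintegral_mono fun q => ?_
    simp only
    rw [enorm_mul, ← mul_assoc, ← ENNReal.ofReal_mul hA, Real.enorm_eq_ofReal_abs (P q)]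
    gcongr
    refine (hPA q).trans ?_
    have := tanWeight_pos q
    gcongr
    exact mul_le_of_le_one_left this.le (hw1 q)
  have i1 : Integrable (fun p => P p.2 * ρ p * h p) halfMeasure := by
    refine ⟨by fun_prop, lt_of_le_of_lt (b := ENNReal.ofReal (A * (1 / (ν₀ * x))) * N) ?_
      (ENNReal.mul_lt_top ENNReal.ofReal_lt_top hN)⟩
    refine le_trans ?_ (mul_le_mul_right H.le _)
    rw [← lintegral_const_mul _ (by fun_prop)]
    refine lintegral_mono_ae ?_
    filter_upwards [ae_halfMeasure] with p hp
    have hw := tanWeight_pos p.2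
    rw [enorm_mul, ← mul_assoc (ENNReal.ofReal _) (ENNReal.ofReal _),
      ← ENNReal.ofReal_mul (by positivity), Real.enorm_eq_ofReal_abs (P p.2 * ρ p)]
    gcongr
    have e1 := one_div_mul_exp_le h0 (hn0 p) hx hp
    have e2 : ρ p ≤ Real.exp (-(p.1 ^ 2 / 8)) * (1 / (ν₀ * x)) := by
      simp only [hρ]
      rw [mul_assoc]
      gcongr
      norm_num
    have e3 : 0 ≤ ρ p := by simp only [hρ]; positivity
    rw [abs_mul, abs_of_nonneg e3]
    calc |P p.2| * ρ p ≤ A * (tanWeight p.2 * tanWeight p.2) *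
          (Real.exp (-(p.1 ^ 2 / 8)) * (1 / (ν₀ * x))) := by
          gcongr
          exact hPA _
      _ ≤ A * (1 * tanWeight p.2) * (Real.exp (-(p.1 ^ 2 / 8)) * (1 / (ν₀ * x))) := by
          gcongr
          exact hw1 _
      _ = _ := by ring
  refine ⟨i0, i1, ?_⟩
  set J : ℝ → ℝ := (Ioo x 1).indicator (fun t => 1 / t) with hJ
  have hJm : Measurable J := Measurable.indicator (by fun_prop) measurableSet_Ioo
  have hJi : Integrable J (volume.restrict (Ioi (0 : ℝ))) ∧
      ∫ t in Ioi (0 : ℝ), J t = -Real.log x := by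
    have hsub : Ioo x 1 ⊆ Ioi (0 : ℝ) := fun t ht => hx.trans ht.1
    have hii : IntervalIntegrable (fun t : ℝ => 1 / t) volume x 1 :=
      intervalIntegral.intervalIntegrable_one_div (fun t ht => by
        rw [uIcc_of_le hx1] at ht; exact (hx.trans_le ht.1).ne') continuousOn_id
    rw [intervalIntegrable_iff_integrableOn_Ioo_of_le hx1] at hii
    constructor
    · rw [hJ, integrable_indicator_iff measurableSet_Ioo]
      exact hii.mono_measure Measure.restrict_le_self
    · rw [hJ, setIntegral_indicator measurableSet_Ioo, inter_eq_self_of_subset_right hsub,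
        ← integral_Ioc_eq_integral_Ioo, ← intervalIntegral.integral_of_le hx1,
        integral_one_div_of_pos hx one_pos, Real.log_div one_ne_zero hx.ne']
      simp
  have i2 : Integrable (fun p : ℝ × ℝ × ℝ => J p.1 * (P p.2 * h₀ p.2)) halfMeasure :=
    hJi.1.mul_prod i0
  have e2 : ∫ p, J p.1 * (P p.2 * h₀ p.2) ∂halfMeasure = -Real.log x * ∫ q, P q * h₀ q := by
    rw [halfMeasure, integral_prod_mul J (fun q => P q * h₀ q), hJi.2]
  rw [← e2, ← integral_sub i1 i2]
  refine (enorm_integral_le_lintegral_enorm _).trans ?_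
  set K2 : ℝ → ℝ≥0∞ := (Ioo (0 : ℝ) 1).indicator (fun t => ENNReal.ofReal (t ^ (δ - 1))) with hK2
  set K3 : ℝ → ℝ≥0∞ := (Ioo (0 : ℝ) 1).indicator (fun t => ENNReal.ofReal (cutMajorant x t))
    with hK3
  have hK2m : Measurable K2 := Measurable.indicator (by fun_prop) measurableSet_Ioo
  have hK3m : Measurable K3 := Measurable.indicator (by fun_prop) measurableSet_Ioo
  set E1 : ℝ × ℝ × ℝ → ℝ≥0∞ := fun p =>
    ENNReal.ofReal (Real.exp (-(p.1 ^ 2 / 8)) * tanWeight p.2) * ‖h p‖ₑ with hE1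
  set E2 : ℝ × ℝ × ℝ → ℝ≥0∞ := fun p => K2 p.1 * (ENNReal.ofReal (tanWeight p.2) * X p.2) with hE2
  set E3 : ℝ × ℝ × ℝ → ℝ≥0∞ := fun p => K3 p.1 * (ENNReal.ofReal (tanWeight p.2) * ‖h₀ p.2‖ₑ)
    with hE3
  have hpt : ∀ᵐ p ∂halfMeasure, ‖P p.2 * ρ p * h p - J p.1 * (P p.2 * h₀ p.2)‖ₑ ≤
      ENNReal.ofReal A * (E1 p + E2 p + ENNReal.ofReal C₁ * E3 p) := by
    filter_upwards [ae_halfMeasure, ae_halfMeasure_of_ae_slabMeasure H.near] with p hp hnear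
    have hw := tanWeight_pos p.2
    have e3 : 0 ≤ ρ p := by simp only [hρ]; positivity
    have hnp := h0.trans_le (hn0 p)
    have hexp : Real.exp (-(n p / p.1) * x) ≤ 1 := Real.exp_le_one_iff.2 (by
      have : 0 ≤ n p / p.1 * x := by positivity
      linarith)
    by_cases hp1 : p.1 < 1
    · have hI : p.1 ∈ Ioo (0 : ℝ) 1 := ⟨hp, hp1⟩
      have hd := hnear hp1
      -- The full kernel ρ multiplies h - h₀, where ρ ≤ 1/t is enough; the kernel difference
      -- multiplies only the trace, so its integral factors into one over t and one over q.
      have hsplit : P p.2 * ρ p * h p - J p.1 * (P p.2 * h₀ p.2) =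
          (P p.2 * ρ p) * (h p - h₀ p.2) + (P p.2 * (ρ p - J p.1)) * h₀ p.2 := by ring
      rw [hsplit]
      have b1 : ‖(P p.2 * ρ p) * (h p - h₀ p.2)‖ₑ ≤ ENNReal.ofReal A * E2 p := by
        rw [enorm_mul]
        have c1 : ‖P p.2 * ρ p‖ₑ ≤ ENNReal.ofReal (A * (tanWeight p.2 * (1 / p.1))) := by
          rw [Real.enorm_eq_ofReal_abs, abs_mul, abs_of_nonneg e3]
          refine ENNReal.ofReal_le_ofReal ?_
          have c2 : ρ p ≤ 1 / p.1 := by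
            simp only [hρ]
            have : Real.exp (-(p.1 ^ 2 / 2)) ≤ 1 := Real.exp_le_one_iff.2 (by
              have := sq_nonneg p.1; linarith)
            calc _ ≤ 1 * (1 / p.1) * 1 := by gcongr
              _ = 1 / p.1 := by ring
          calc |P p.2| * ρ p ≤ A * (tanWeight p.2 * tanWeight p.2) * (1 / p.1) := by
                gcongr
                exact hPA _
            _ ≤ A * (tanWeight p.2 * 1) * (1 / p.1) := by
                gcongr
                exact hw1 _
            _ = _ := by ring
        calc ‖P p.2 * ρ p‖ₑ * ‖h p - h₀ p.2‖ₑ ≤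
              ENNReal.ofReal (A * (tanWeight p.2 * (1 / p.1))) *
                (ENNReal.ofReal (p.1 ^ δ) * X p.2) := mul_le_mul' c1 hd
          _ = ENNReal.ofReal A * E2 p := by
            simp only [hE2, hK2]
            rw [indicator_of_mem hI, Real.rpow_sub hp, Real.rpow_one, ENNReal.ofReal_mul hA,
              ENNReal.ofReal_mul hw.le, show p.1 ^ δ / p.1 = 1 / p.1 * p.1 ^ δ by ring,
              ENNReal.ofReal_mul (by positivity)]
            ring
      have b2 : ‖(P p.2 * (ρ p - J p.1)) * h₀ p.2‖ₑ ≤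
          ENNReal.ofReal A * (ENNReal.ofReal C₁ * E3 p) := by
        have hcm := cutMajorant_nonneg hx hp
        have c1 : ‖P p.2 * (ρ p - J p.1)‖ₑ ≤
            ENNReal.ofReal (A * (C₁ * (cutMajorant x p.1 * tanWeight p.2))) := by
          rw [Real.enorm_eq_ofReal_abs, abs_mul]
          refine ENNReal.ofReal_le_ofReal ?_
          have c2 : |ρ p - J p.1| ≤ (n p + 1 + 1 / ν₀) * cutMajorant x p.1 :=
            abs_kernel_sub_le h0 (hn0 p) hx hp hp1
          have c3 : tanWeight p.2 * (n p + 1 + 1 / ν₀) ≤ C₁ := by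
            have d1 := tangential_le p.2
            have d2 := hn1 p hI
            have d3 : tanWeight p.2 * Real.exp (1 / 8 * (p.2.1 ^ 2 + p.2.2 ^ 2)) = 1 := by
              rw [tanWeight, ← Real.exp_add]; simp
            have d4 : tanWeight p.2 * n p ≤ 6 * ν₁ := by
              calc tanWeight p.2 * n p ≤ tanWeight p.2 *
                    (ν₁ * (6 * Real.exp (1 / 8 * (p.2.1 ^ 2 + p.2.2 ^ 2)))) := by
                    gcongr
                    exact d2.trans (by gcongr)
                _ = 6 * ν₁ * (tanWeight p.2 * Real.exp (1 / 8 * (p.2.1 ^ 2 + p.2.2 ^ 2))) := by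
                    ring
                _ = 6 * ν₁ := by rw [d3, mul_one]
            have d5 : tanWeight p.2 * (1 + 1 / ν₀) ≤ 1 + 1 / ν₀ :=
              mul_le_of_le_one_left (by positivity) (hw1 _)
            rw [hC₁]
            linarith
          calc |P p.2| * |ρ p - J p.1| ≤ A * (tanWeight p.2 * tanWeight p.2) *
                ((n p + 1 + 1 / ν₀) * cutMajorant x p.1) := by
                gcongr
                exact hPA _
            _ = A * ((tanWeight p.2 * (n p + 1 + 1 / ν₀)) * (cutMajorant x p.1 * tanWeight p.2)) := by
                ring
            _ ≤ _ := by gcongr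
        rw [enorm_mul]
        calc ‖P p.2 * (ρ p - J p.1)‖ₑ * ‖h₀ p.2‖ₑ ≤
              ENNReal.ofReal (A * (C₁ * (cutMajorant x p.1 * tanWeight p.2))) * ‖h₀ p.2‖ₑ := by
              gcongr
          _ = _ := by
            simp only [hE3, hK3]
            rw [indicator_of_mem hI, ENNReal.ofReal_mul hA, ENNReal.ofReal_mul hC₁0,
              ENNReal.ofReal_mul hcm]
            ring
      calc _ ≤ ENNReal.ofReal A * E2 p + ENNReal.ofReal A * (ENNReal.ofReal C₁ * E3 p) :=
            (enorm_add_le _ _).trans (add_le_add b1 b2)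
        _ ≤ _ := by
            rw [← mul_add]
            gcongr
            exact le_add_self
    · have hJ0 : J p.1 = 0 := indicator_of_notMem (fun h => hp1 h.2) _
      rw [hJ0, zero_mul, sub_zero]
      have hp1' := not_lt.1 hp1
      have c1 : ‖P p.2 * ρ p‖ₑ ≤
          ENNReal.ofReal (A * (Real.exp (-(p.1 ^ 2 / 8)) * tanWeight p.2)) := by
        rw [Real.enorm_eq_ofReal_abs, abs_mul, abs_of_nonneg e3]
        refine ENNReal.ofReal_le_ofReal ?_
        have c2 : ρ p ≤ Real.exp (-(p.1 ^ 2 / 8)) := by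
          simp only [hρ]
          have d1 : Real.exp (-(p.1 ^ 2 / 2)) ≤ Real.exp (-(p.1 ^ 2 / 8)) := by
            gcongr; norm_num
          have d2 : 1 / p.1 ≤ 1 := by rw [div_le_one hp]; exact hp1'
          calc _ ≤ Real.exp (-(p.1 ^ 2 / 8)) * 1 * 1 := by gcongr
            _ = _ := by ring
        calc |P p.2| * ρ p ≤ A * (tanWeight p.2 * tanWeight p.2) * Real.exp (-(p.1 ^ 2 / 8)) := by
              gcongr
              exact hPA _
          _ ≤ A * (tanWeight p.2 * 1) * Real.exp (-(p.1 ^ 2 / 8)) := by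
              gcongr
              exact hw1 _
          _ = _ := by ring
      rw [enorm_mul]
      calc ‖P p.2 * ρ p‖ₑ * ‖h p‖ₑ ≤
            ENNReal.ofReal (A * (Real.exp (-(p.1 ^ 2 / 8)) * tanWeight p.2)) * ‖h p‖ₑ := by gcongr
        _ = ENNReal.ofReal A * E1 p := by rw [ENNReal.ofReal_mul hA, mul_assoc]
        _ ≤ _ := by
          gcongr
          rw [add_assoc]
          exact le_self_add
  have I1 : ∫⁻ p, E1 p ∂halfMeasure ≤ N := H.le
  have I2 : ∫⁻ p, E2 p ∂halfMeasure ≤ ENNReal.ofReal (1 / δ) * N := by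
    rw [halfMeasure, lintegral_prod_mul (f := K2)
      (g := fun q => ENNReal.ofReal (tanWeight q) * X q) (by fun_prop) (by fun_prop)]
    refine mul_le_mul' ?_ H.bound_le
    rw [hK2, lintegral_indicator measurableSet_Ioo, Measure.restrict_restrict measurableSet_Ioo,
      inter_eq_self_of_subset_left Ioo_subset_Ioi_self]
    have hi : IntegrableOn (fun t : ℝ => t ^ (δ - 1)) (Ioo 0 1) := by
      have := intervalIntegral.intervalIntegrable_rpow' (a := 0) (b := 1) (r := δ - 1)
        (by linarith)
      rwa [intervalIntegrable_iff_integrableOn_Ioo_of_le zero_le_one] at this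
    rw [← ofReal_integral_eq_lintegral_ofReal hi]
    · rw [← integral_Ioc_eq_integral_Ioo, ← intervalIntegral.integral_of_le zero_le_one,
        integral_rpow (Or.inl (by linarith))]
      simp [hδ.ne']
    · filter_upwards [ae_restrict_mem measurableSet_Ioo] with t ht
      exact Real.rpow_nonneg ht.1.le _
  have I3 : ∫⁻ p, E3 p ∂halfMeasure ≤ 3 * (3 * N) := by
    rw [halfMeasure, lintegral_prod_mul (f := K3)
      (g := fun q => ENNReal.ofReal (tanWeight q) * ‖h₀ q‖ₑ) (by fun_prop) (by fun_prop)]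
    refine mul_le_mul' ?_ (H.trace_le hδ)
    rw [hK3, lintegral_indicator measurableSet_Ioo, Measure.restrict_restrict measurableSet_Ioo,
      inter_eq_self_of_subset_left Ioo_subset_Ioi_self]
    exact lintegral_cutMajorant_le hx
  refine (lintegral_mono_ae hpt).trans ?_
  rw [lintegral_const_mul _ (by fun_prop), lintegral_add_right _ (by fun_prop),
    lintegral_add_right _ (by fun_prop), lintegral_const_mul _ (by fun_prop)]
  calc ENNReal.ofReal A * (_ + _ + ENNReal.ofReal C₁ * _)
      ≤ ENNReal.ofReal A * (N + ENNReal.ofReal (1 / δ) * N + ENNReal.ofReal C₁ * (3 * (3 * N))) := by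
        gcongr
    _ = _ := by
        push_cast [ENNReal.ofReal]
        ring

/-! ### Moments -/

/-- The factor of `momentConst` that belongs to one coordinate. -/
noncomputable def momentFactor (n : ℕ) : ℝ :=
  (2 * (n : ℝ)) ^ ((n : ℝ) / 2) * Real.exp (-(n : ℝ) / 2)

theorem momentFactor_zero : momentFactor 0 = 1 := by simp [momentFactor]

theorem momentConst_eq (α : Fin 3 → ℕ) :
    momentConst α = momentFactor (α 0) * momentFactor (α 1) * momentFactor (α 2) := by
  have h : Real.exp (-(∑ i, (α i : ℝ)) / 2) = Real.exp (-(α 0 : ℝ) / 2) *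
      Real.exp (-(α 1 : ℝ) / 2) * Real.exp (-(α 2 : ℝ) / 2) := by
    rw [← Real.exp_add, ← Real.exp_add, Fin.sum_univ_three]
    congr 1
    ring
  rw [momentConst, h, Fin.prod_univ_three, momentFactor, momentFactor, momentFactor]
  ring

theorem momentFactor_nonneg (n : ℕ) : 0 ≤ momentFactor n := by unfold momentFactor; positivity

theorem momentConst_nonneg (α : Fin 3 → ℕ) : 0 ≤ momentConst α := by
  unfold momentConst; positivity

/-- The right side is the maximum of the left, attained at t² = 2n. With y = t²/(2n) the bound is y
≤ e^{y-1} raised to the power n/2. -/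
theorem abs_pow_mul_exp_le (n : ℕ) (t : ℝ) :
    |t| ^ n * Real.exp (-(t ^ 2 / 4)) ≤ momentFactor n := by
  rcases n.eq_zero_or_pos with rfl | hn
  · rw [momentFactor_zero, pow_zero, one_mul, Real.exp_le_one_iff]
    have := sq_nonneg t
    linarith
  have hn' : (0 : ℝ) < n := by exact_mod_cast hn
  set y := t ^ 2 / (2 * n) with hy
  have hy0 : 0 ≤ y := by positivity
  have e1 : |t| ^ n = (2 * (n : ℝ)) ^ ((n : ℝ) / 2) * y ^ ((n : ℝ) / 2) := by
    rw [← Real.mul_rpow (by positivity) hy0, hy, mul_div_cancel₀ _ (by positivity), ← sq_abs,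
      ← Real.rpow_natCast (|t|) 2, ← Real.rpow_mul (abs_nonneg t)]
    rw [show ((2 : ℕ) : ℝ) * ((n : ℝ) / 2) = n by push_cast; ring, Real.rpow_natCast]
  have e2 : y ^ ((n : ℝ) / 2) ≤ Real.exp (t ^ 2 / 4 - n / 2) := by
    have h1 : y ≤ Real.exp (y - 1) := by
      have := Real.add_one_le_exp (y - 1)
      linarith
    calc y ^ ((n : ℝ) / 2) ≤ (Real.exp (y - 1)) ^ ((n : ℝ) / 2) :=
          Real.rpow_le_rpow hy0 h1 (by positivity)
      _ = Real.exp (t ^ 2 / 4 - n / 2) := by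
          rw [← Real.exp_mul]
          congr 1
          rw [hy]
          field_simp
          ring
  rw [e1, momentFactor, mul_assoc]
  gcongr
  calc y ^ ((n : ℝ) / 2) * Real.exp (-(t ^ 2 / 4))
      ≤ Real.exp (t ^ 2 / 4 - n / 2) * Real.exp (-(t ^ 2 / 4)) := by gcongr
    _ = _ := by
      rw [← Real.exp_add]
      congr 1
      ring

/-- For t ≥ 1 the factor 1/t is at most 1. For t ≤ 1 the left side is at most 1, and `momentFactor
n` ≥ e^{-1/4} ≥ 3/4 by evaluation at t = 1; this accounts for the 2. -/
theorem pow_mul_one_div_mul_exp_le {n : ℕ} (hn : n ≠ 0) {t : ℝ} (ht : 0 < t) :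
    t ^ n * (1 / t) * Real.exp (-(t ^ 2 / 4)) ≤ 2 * momentFactor n := by
  have h0 := momentFactor_nonneg n
  have h1 := abs_pow_mul_exp_le n t
  rw [abs_of_pos ht] at h1
  rcases le_total 1 t with h | h
  · have : 1 / t ≤ 1 := by rw [div_le_one ht]; exact h
    calc t ^ n * (1 / t) * Real.exp (-(t ^ 2 / 4)) ≤ t ^ n * 1 * Real.exp (-(t ^ 2 / 4)) := by
          gcongr
      _ ≤ 2 * momentFactor n := by rw [mul_one]; linarith
  · have h2 := abs_pow_mul_exp_le n 1
    rw [abs_one, one_pow, one_mul] at h2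
    have h3 := Real.add_one_le_exp (-((1 : ℝ) ^ 2 / 4))
    have h4 : t ^ n * (1 / t) ≤ 1 := by
      obtain ⟨m, rfl⟩ := Nat.exists_eq_succ_of_ne_zero hn
      rw [pow_succ, mul_assoc, mul_one_div_cancel ht.ne', mul_one]
      exact pow_le_one₀ ht.le h
    have h5 : Real.exp (-(t ^ 2 / 4)) ≤ 1 := Real.exp_le_one_iff.2 (by
      have := sq_nonneg t; linarith)
    calc t ^ n * (1 / t) * Real.exp (-(t ^ 2 / 4)) ≤ 1 * 1 := by gcongr
      _ ≤ 2 * momentFactor n := by norm_num at h3 h2 ⊢; linarith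

theorem momentWeight_mk (α : Fin 3 → ℕ) (t y z : ℝ) :
    momentWeight α !₂[t, y, z] = Real.pi ^ (-(3 / 4) : ℝ) * (t ^ α 0 * y ^ α 1 * z ^ α 2) *
      Real.exp (-(t ^ 2 + y ^ 2 + z ^ 2) / 2) := by
  rw [momentWeight, norm_sq_vel, Fin.prod_univ_three]
  simp

theorem pi_rpow_le_one : Real.pi ^ (-(3 / 4) : ℝ) ≤ 1 :=
  Real.rpow_le_one_of_one_le_of_nonpos (by linarith [Real.pi_gt_three]) (by norm_num)

/-- The part of the moment weight that depends on the tangential variables. -/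
theorem tangential_moment_le (α : Fin 3 → ℕ) (q : ℝ × ℝ) :
    |q.1| ^ α 1 * |q.2| ^ α 2 * Real.exp (-(q.1 ^ 2 + q.2 ^ 2) / 2) ≤
      momentFactor (α 1) * momentFactor (α 2) * (tanWeight q * tanWeight q) := by
  have h1 := abs_pow_mul_exp_le (α 1) q.1
  have h2 := abs_pow_mul_exp_le (α 2) q.2
  have e : Real.exp (-(q.1 ^ 2 + q.2 ^ 2) / 2) = Real.exp (-(q.1 ^ 2 / 4)) *
      Real.exp (-(q.2 ^ 2 / 4)) * (tanWeight q * tanWeight q) := by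
    rw [tanWeight, ← Real.exp_add, ← Real.exp_add, ← Real.exp_add]
    congr 1
    ring
  have hw := tanWeight_pos q
  calc |q.1| ^ α 1 * |q.2| ^ α 2 * Real.exp (-(q.1 ^ 2 + q.2 ^ 2) / 2)
      = (|q.1| ^ α 1 * Real.exp (-(q.1 ^ 2 / 4))) * (|q.2| ^ α 2 * Real.exp (-(q.2 ^ 2 / 4))) *
        (tanWeight q * tanWeight q) := by rw [e]; ring
    _ ≤ _ := by
      have := momentFactor_nonneg (α 1)
      gcongr

theorem abs_momentWeight_mk_le (α : Fin 3 → ℕ) (t : ℝ) (q : ℝ × ℝ) :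
    |momentWeight α !₂[t, q.1, q.2]| ≤ |t| ^ α 0 * Real.exp (-(t ^ 2 / 2)) *
      (momentFactor (α 1) * momentFactor (α 2) * (tanWeight q * tanWeight q)) := by
  have h := tangential_moment_le α q
  have e : Real.exp (-(t ^ 2 + q.1 ^ 2 + q.2 ^ 2) / 2) = Real.exp (-(t ^ 2 / 2)) *
      Real.exp (-(q.1 ^ 2 + q.2 ^ 2) / 2) := by
    rw [← Real.exp_add]
    congr 1
    ring
  rw [momentWeight_mk, abs_mul, abs_mul, abs_mul, abs_mul, abs_pow, abs_pow, abs_pow,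
    abs_of_pos (Real.exp_pos _), abs_of_pos (Real.rpow_pos_of_pos Real.pi_pos _), e]
  calc Real.pi ^ (-(3 / 4) : ℝ) * (|t| ^ α 0 * |q.1| ^ α 1 * |q.2| ^ α 2) *
        (Real.exp (-(t ^ 2 / 2)) * Real.exp (-(q.1 ^ 2 + q.2 ^ 2) / 2))
      ≤ 1 * (|t| ^ α 0 * |q.1| ^ α 1 * |q.2| ^ α 2) *
        (Real.exp (-(t ^ 2 / 2)) * Real.exp (-(q.1 ^ 2 + q.2 ^ 2) / 2)) := by
        gcongr
        exact pi_rpow_le_one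
    _ = |t| ^ α 0 * Real.exp (-(t ^ 2 / 2)) *
        (|q.1| ^ α 1 * |q.2| ^ α 2 * Real.exp (-(q.1 ^ 2 + q.2 ^ 2) / 2)) := by ring
    _ ≤ _ := by gcongr

theorem measurable_momentWeight (α : Fin 3 → ℕ) : Measurable (momentWeight α) := by
  unfold momentWeight
  fun_prop

theorem measurable_vel_tan (t : ℝ) : Measurable fun q : ℝ × ℝ => (!₂[t, q.1, q.2] : Vel) :=
  measurable_vel_mk.comp (measurable_const.prodMk measurable_id)

/-- If `α 0 = 0`, the weight factors into e^{-t²/2} and its boundary value, and the logarithmic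
expansion applies. Otherwise the boundary value is 0 and the power of t cancels 1/t, so the integral
is bounded without any use of the trace. -/
theorem exists_moment_estimate {ν₀ ν₁ δ : ℝ} (h0 : 0 < ν₀) (h1 : 0 ≤ ν₁) (hδ : 0 < δ) :
    ∃ C : ℝ≥0, ∀ (n h : ℝ × ℝ × ℝ → ℝ) (h₀ : ℝ × ℝ → ℝ) (X : ℝ × ℝ → ℝ≥0∞) (N : ℝ≥0∞)
      (α : Fin 3 → ℕ) (x : ℝ), HasHolderTrace δ h h₀ X N → N < ⊤ → Measurable n →
      (∀ p, ν₀ ≤ n p) → (∀ p : ℝ × ℝ × ℝ, p.1 ∈ Ioo (0 : ℝ) 1 → n p ≤ ν₁ * (2 + |p.2.1| + |p.2.2|)) →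
      0 < x → x ≤ 1 →
      Integrable (fun q : ℝ × ℝ => momentWeight α !₂[0, q.1, q.2] * h₀ q) ∧
      Integrable (fun p : ℝ × ℝ × ℝ => momentWeight α !₂[p.1, p.2.1, p.2.2] * (1 / p.1) *
        Real.exp (-(n p / p.1) * x) * h p) halfMeasure ∧
      ‖(∫ p : ℝ × ℝ × ℝ, momentWeight α !₂[p.1, p.2.1, p.2.2] * (1 / p.1) *
        Real.exp (-(n p / p.1) * x) * h p ∂halfMeasure) -
        -Real.log x * ∫ q : ℝ × ℝ, momentWeight α !₂[0, q.1, q.2] * h₀ q‖ₑ ≤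
        C * ENNReal.ofReal (momentConst α) * N := by
  obtain ⟨C, hC⟩ := exists_log_singularity_le h0 h1 hδ
  refine ⟨C + 2, fun n h h₀ X N α x H hN hn hn0 hn1 hx hx1 => ?_⟩
  have mP : Measurable fun p : ℝ × ℝ × ℝ => momentWeight α !₂[p.1, p.2.1, p.2.2] :=
    (measurable_momentWeight α).comp measurable_vel_mk
  by_cases hα : α 0 = 0
  · have hP : Measurable fun q : ℝ × ℝ => momentWeight α !₂[0, q.1, q.2] :=
      (measurable_momentWeight α).comp (measurable_vel_tan 0)
    obtain ⟨a1, a2, a3⟩ := hC n h h₀ X N (fun q => momentWeight α !₂[0, q.1, q.2]) (momentConst α)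
      x H hN hn hn0 hn1 hP (momentConst_nonneg α) (fun q => by
        have := abs_momentWeight_mk_le α 0 q
        rw [hα] at this
        rw [momentConst_eq, hα, momentFactor_zero]
        simpa using this) hx hx1
    have e : ∀ p : ℝ × ℝ × ℝ, momentWeight α !₂[0, p.2.1, p.2.2] * (Real.exp (-(p.1 ^ 2 / 2)) *
        (1 / p.1) * Real.exp (-(n p / p.1) * x)) * h p = momentWeight α !₂[p.1, p.2.1, p.2.2] *
        (1 / p.1) * Real.exp (-(n p / p.1) * x) * h p := by
      intro p
      have e1 : momentWeight α !₂[p.1, p.2.1, p.2.2] =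
          momentWeight α !₂[0, p.2.1, p.2.2] * Real.exp (-(p.1 ^ 2 / 2)) := by
        rw [momentWeight_mk, momentWeight_mk, hα, mul_assoc _ (Real.exp _) (Real.exp _),
          ← Real.exp_add]
        simp only [pow_zero]
        congr 2
        ring
      rw [e1]
      ring
    simp only [e] at a2 a3
    refine ⟨a1, a2, a3.trans ?_⟩
    gcongr
    exact le_self_add
  · have hz : ∀ q : ℝ × ℝ, momentWeight α !₂[0, q.1, q.2] = 0 := fun q => by
      rw [momentWeight_mk, zero_pow hα]; simp
    have m1 := H.measurable
    have mw := measurable_tanWeight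
    have hle : ∫⁻ p : ℝ × ℝ × ℝ, ‖momentWeight α !₂[p.1, p.2.1, p.2.2] * (1 / p.1) *
        Real.exp (-(n p / p.1) * x) * h p‖ₑ ∂halfMeasure ≤
        ENNReal.ofReal (2 * momentConst α) * N := by
      refine le_trans ?_ (mul_le_mul_right H.le _)
      rw [← lintegral_const_mul _ (by fun_prop)]
      refine lintegral_mono_ae ?_
      filter_upwards [ae_halfMeasure] with p hp
      have hA := momentConst_nonneg α
      have hw := tanWeight_pos p.2
      have hnp := h0.trans_le (hn0 p)
      have hw1 : tanWeight p.2 ≤ 1 := Real.exp_le_one_iff.2 (by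
        have := sq_nonneg p.2.1; have := sq_nonneg p.2.2; linarith)
      have hexp : Real.exp (-(n p / p.1) * x) ≤ 1 := Real.exp_le_one_iff.2 (by
        have : 0 ≤ n p / p.1 * x := by positivity
        linarith)
      rw [enorm_mul, ← mul_assoc (ENNReal.ofReal _) (ENNReal.ofReal _),
        ← ENNReal.ofReal_mul (by positivity),
        Real.enorm_eq_ofReal_abs (momentWeight α !₂[p.1, p.2.1, p.2.2] * (1 / p.1) * _)]
      refine mul_le_mul' (ENNReal.ofReal_le_ofReal ?_) le_rfl
      rw [abs_mul, abs_mul, abs_of_pos (Real.exp_pos _), abs_of_pos (one_div_pos.2 hp)]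
      have b1 := abs_momentWeight_mk_le α p.1 p.2
      have b2 := pow_mul_one_div_mul_exp_le hα hp
      have b3 := momentFactor_nonneg (α 1)
      have b4 := momentFactor_nonneg (α 2)
      have b5 : Real.exp (-(p.1 ^ 2 / 2)) = Real.exp (-(p.1 ^ 2 / 4)) * Real.exp (-(p.1 ^ 2 / 4)) := by
        rw [← Real.exp_add]; congr 1; ring
      have b6 : Real.exp (-(p.1 ^ 2 / 4)) ≤ Real.exp (-(p.1 ^ 2 / 8)) := by gcongr; norm_num
      rw [abs_of_pos hp] at b1
      calc |momentWeight α !₂[p.1, p.2.1, p.2.2]| * (1 / p.1) * Real.exp (-(n p / p.1) * x)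
          ≤ (p.1 ^ α 0 * Real.exp (-(p.1 ^ 2 / 2)) * (momentFactor (α 1) * momentFactor (α 2) *
            (tanWeight p.2 * tanWeight p.2))) * (1 / p.1) * 1 := by gcongr
        _ = (p.1 ^ α 0 * (1 / p.1) * Real.exp (-(p.1 ^ 2 / 4))) * Real.exp (-(p.1 ^ 2 / 4)) *
            (momentFactor (α 1) * momentFactor (α 2)) * (tanWeight p.2 * tanWeight p.2) := by
            rw [b5]; ring
        _ ≤ (2 * momentFactor (α 0)) * Real.exp (-(p.1 ^ 2 / 8)) *
            (momentFactor (α 1) * momentFactor (α 2)) * (1 * tanWeight p.2) := by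
            have := momentFactor_nonneg (α 0)
            gcongr
        _ = _ := by rw [momentConst_eq]; ring
    refine ⟨by simp [hz], ⟨by fun_prop, hle.trans_lt (ENNReal.mul_lt_top ENNReal.ofReal_lt_top hN)⟩,
      ?_⟩
    simp only [hz, zero_mul, integral_zero, mul_zero, sub_zero]
    refine (enorm_integral_le_lintegral_enorm _).trans (hle.trans ?_)
    rw [ENNReal.ofReal_mul zero_le_two, ENNReal.ofReal_ofNat]
    gcongr
    push_cast
    exact le_add_self

/-! ### The trace of the linearized collision operator -/

theorem norm_sq_vel_mk (t y z : ℝ) : ‖(!₂[t, y, z] : Vel)‖ ^ 2 = t ^ 2 + y ^ 2 + z ^ 2 := by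
  rw [norm_sq_vel]; simp

theorem exp_mul_tanWeight (t : ℝ) (q : ℝ × ℝ) :
    Real.exp (-(t ^ 2 / 8)) * tanWeight q = Real.exp (-(‖(!₂[t, q.1, q.2] : Vel)‖ ^ 2 / 8)) := by
  rw [norm_sq_vel_mk, tanWeight, ← Real.exp_add]
  congr 1
  ring

theorem lintegral_halfMeasure_le (F : Vel → ℝ≥0∞) :
    ∫⁻ p : ℝ × ℝ × ℝ, F !₂[p.1, p.2.1, p.2.2] ∂halfMeasure ≤ ∫⁻ ζ, F ζ := by
  rw [lintegral_velCoord]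
  refine lintegral_mono' ?_ le_rfl
  rw [Measure.volume_eq_prod]
  exact Measure.prod_mono Measure.restrict_le_self le_rfl

theorem integrable_exp_norm_sq {κ : ℝ} (hκ : 0 < κ) :
    Integrable fun ζ : Vel => Real.exp (-(κ * ‖ζ‖ ^ 2)) := by
  simpa using integrable_norm_rpow_mul_exp (a := 0) le_rfl hκ

theorem exists_lintegral_gauss_mul_le : ∃ C : ℝ≥0, ∀ f : Vel → ℝ, Measurable f →
    ∫⁻ ζ, ENNReal.ofReal (Real.exp (-(1 / 16 * ‖ζ‖ ^ 2))) * ‖f ζ‖ₑ ≤ C * eLpNorm f 2 volume := by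
  have hg : MemLp (fun ζ : Vel => Real.exp (-(1 / 16 * ‖ζ‖ ^ 2))) 2 volume := by
    rw [memLp_two_iff_integrable_sq (by fun_prop)]
    refine (integrable_exp_norm_sq (κ := 1 / 8) (by norm_num)).congr
      (Eventually.of_forall fun ζ => ?_)
    simp only
    rw [← Real.exp_nat_mul]
    congr 1
    push_cast
    ring
  refine ⟨(eLpNorm (fun ζ : Vel => Real.exp (-(1 / 16 * ‖ζ‖ ^ 2))) 2 volume).toNNReal,
    fun f hf => ?_⟩
  rw [ENNReal.coe_toNNReal hg.2.ne]
  refine le_trans (lintegral_mono fun ζ => ?_)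
    (lintegral_enorm_mul_le hg.1 hf.aestronglyMeasurable 2 2)
  rw [Real.enorm_eq_ofReal (Real.exp_nonneg _)]

theorem norm_vel_mk_le {t : ℝ} (ht : t ∈ Ioo (0 : ℝ) 1) (q : ℝ × ℝ) :
    ‖(!₂[t, q.1, q.2] : Vel)‖ ≤ 1 + |q.1| + |q.2| := by
  have h := norm_sq_vel_mk t q.1 q.2
  have h1 := abs_nonneg q.1
  have h2 := abs_nonneg q.2
  refine abs_le_of_sq_le_sq' ?_ (by positivity) |>.2
  rw [h, ← sq_abs q.1, ← sq_abs q.2]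
  nlinarith [ht.1, ht.2, mul_nonneg h1 h2]

theorem IsFrequency.const_nonneg {γ : ℝ} {ν : Vel → ℝ} {ν₀ ν₁ : ℝ} (h : IsFrequency γ ν ν₀ ν₁) :
    0 ≤ ν₁ := by
  have h1 := h.lower 0
  have h2 := h.upper 0
  have h3 := h.pos
  simp only [norm_zero, add_zero, mul_one] at h2
  linarith

theorem IsFrequency.le_tangential {γ : ℝ} {ν : Vel → ℝ} {ν₀ ν₁ : ℝ} (h : IsFrequency γ ν ν₀ ν₁)
    {p : ℝ × ℝ × ℝ} (hp : p.1 ∈ Ioo (0 : ℝ) 1) :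
    ν !₂[p.1, p.2.1, p.2.2] ≤ ν₁ * (2 + |p.2.1| + |p.2.2|) := by
  have h1 := norm_vel_mk_le hp p.2
  have h2 := h.const_nonneg
  exact (h.upper _).trans (mul_le_mul_of_nonneg_left (by linarith) h2)

theorem tangential_le' (q : ℝ × ℝ) :
    2 + |q.1| + |q.2| ≤ 10 * Real.exp (1 / 16 * (q.1 ^ 2 + q.2 ^ 2)) := by
  have e := Real.add_one_le_exp (1 / 16 * (q.1 ^ 2 + q.2 ^ 2))
  have e1 : |q.1| ≤ 4 + q.1 ^ 2 / 16 := by rw [← sq_abs]; nlinarith [sq_nonneg (|q.1| - 8)]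
  have e2 : |q.2| ≤ 4 + q.2 ^ 2 / 16 := by rw [← sq_abs]; nlinarith [sq_nonneg (|q.2| - 8)]
  nlinarith [sq_nonneg q.1, sq_nonneg q.2]

theorem tanWeight_mul_exp (q : ℝ × ℝ) :
    tanWeight q * Real.exp (1 / 16 * (q.1 ^ 2 + q.2 ^ 2)) =
      Real.exp (-(1 / 16 * (q.1 ^ 2 + q.2 ^ 2))) := by
  rw [tanWeight, ← Real.exp_add]
  congr 1
  ring

theorem tanWeight_le (q : ℝ × ℝ) : tanWeight q ≤ Real.exp (-(1 / 16 * (q.1 ^ 2 + q.2 ^ 2))) := by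
  rw [tanWeight, Real.exp_le_exp]
  have := sq_nonneg q.1
  have := sq_nonneg q.2
  linarith

/-- Functions with a weak derivative in `L^p` have a trace at a Hölder rate. -/
theorem exists_function_trace {p : ℝ≥0∞} (hp : 1 < p) :
    ∃ a : ℝ, 0 < a ∧ ∃ C : ℝ≥0, ∀ f Γ : Vel → ℝ, Measurable f → Measurable Γ →
      eLpNorm f 2 volume < ⊤ → eLpNorm Γ p (volume.restrict halfPos) < ⊤ →
      (∀ h : ℝ, 0 ≤ h → ∀ᵐ ζ : Vel, ζ ∈ halfPos →
        f (ζ + h • axisVec) - f ζ = ∫ s in Ioc 0 h, Γ (ζ + s • axisVec)) →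
      ∃ g₀ : ℝ × ℝ → ℝ, HasHolderTrace a (fun p => f !₂[p.1, p.2.1, p.2.2]) g₀
          (traceMajorant a Γ)
          (C * (eLpNorm f 2 volume + eLpNorm Γ p (volume.restrict halfPos))) ∧
        ∫⁻ q : ℝ × ℝ, ENNReal.ofReal (Real.exp (-(1 / 16 * (q.1 ^ 2 + q.2 ^ 2)))) *
          traceMajorant a Γ q ≤
          C * (eLpNorm f 2 volume + eLpNorm Γ p (volume.restrict halfPos)) := by
  obtain ⟨a, ha, C₁, hC₁⟩ := exists_lintegral_traceMajorant_le hp (κ := 1 / 16) (by norm_num)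
  obtain ⟨C₂, hC₂⟩ := exists_lintegral_gauss_mul_le
  refine ⟨a, ha, C₁ + C₂, fun f Γ hf hΓ hf2 hΓp htr => ?_⟩
  have hm := measurable_traceMajorant a hΓ
  have hfm : Measurable fun p : ℝ × ℝ × ℝ => f !₂[p.1, p.2.1, p.2.2] := hf.comp measurable_vel_mk
  have hw := hC₁ Γ hΓ
  have hfin : ∀ᵐ q : ℝ × ℝ, traceMajorant a Γ q < ⊤ := by
    have h1 := ae_lt_top (by fun_prop)
      (hw.trans_lt (ENNReal.mul_lt_top ENNReal.coe_lt_top hΓp)).ne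
    filter_upwards [h1] with q hq
    by_contra hn
    rw [not_lt, top_le_iff] at hn
    rw [hn, ENNReal.mul_top (by simpa using Real.exp_pos _)] at hq
    exact lt_irrefl _ hq
  obtain ⟨g₀, hg₀, hnear⟩ := exists_trace hf hΓ ha.le hfin htr
  have hle1 : ∫⁻ q : ℝ × ℝ, ENNReal.ofReal (Real.exp (-(1 / 16 * (q.1 ^ 2 + q.2 ^ 2)))) *
          traceMajorant a Γ q ≤
          (C₁ + C₂ : ℝ≥0) * (eLpNorm f 2 volume + eLpNorm Γ p (volume.restrict halfPos)) := by
    refine hw.trans ?_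
    push_cast
    exact mul_le_mul' le_self_add le_add_self
  refine ⟨g₀, ⟨hfm, hg₀, hm, ?_, ?_, ?_⟩, hle1⟩
  · have hset : MeasurableSet {p : ℝ × ℝ × ℝ | ‖f !₂[p.1, p.2.1, p.2.2] - g₀ p.2‖ₑ ≤
        ENNReal.ofReal (p.1 ^ a) * traceMajorant a Γ p.2} :=
      measurableSet_le (by fun_prop) (by fun_prop)
    rw [slabMeasure, Measure.ae_prod_iff_ae_ae hset, Measure.ae_ae_comm hset]
    filter_upwards [hnear] with q hq
    exact (ae_restrict_iff' measurableSet_Ioo).2 hq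
  · refine le_trans (lintegral_mono fun q => ?_) hle1
    gcongr
    exact tanWeight_le q
  · have h1 := lintegral_halfMeasure_le
      (fun ζ => ENNReal.ofReal (Real.exp (-(‖ζ‖ ^ 2 / 8))) * ‖f ζ‖ₑ)
    simp only [exp_mul_tanWeight]
    refine h1.trans (le_trans (lintegral_mono fun ζ => ?_) ((hC₂ f hf).trans ?_))
    · dsimp only
      gcongr
      have := sq_nonneg ‖ζ‖
      linarith
    · push_cast
      exact mul_le_mul' le_add_self le_self_add

/-- The trace of L(f) is K f(0, q) - ν(0, q) g₀(q), with g₀ the trace of f. The bound X collects the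
moduli of K f, of f multiplied by ν, and of ν multiplied by g₀. -/
theorem exists_collision_trace {γ : ℝ} {β : ℝ → ℝ} (hB : IsCutoffPowerLaw γ β) {p : ℝ≥0∞}
    (hp : 1 < p) : ∃ δ : ℝ, 0 < δ ∧ ∃ C : ℝ≥0, ∀ f Γ : Vel → ℝ, Measurable f → Measurable Γ →
      eLpNorm f 2 volume < ⊤ → eLpNorm Γ p (volume.restrict halfPos) < ⊤ →
      (∀ h : ℝ, 0 ≤ h → ∀ᵐ ζ : Vel, ζ ∈ halfPos →
        f (ζ + h • axisVec) - f ζ = ∫ s in Ioc 0 h, Γ (ζ + s • axisVec)) →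
      ∃ h₀ X, HasHolderTrace δ (fun p => linCollision γ β f !₂[p.1, p.2.1, p.2.2]) h₀ X
        (C * (eLpNorm f 2 volume + eLpNorm Γ p (volume.restrict halfPos))) := by
  obtain ⟨ν₀, ν₁, hν⟩ := hB.exists_isFrequency
  obtain ⟨a, ha, C₁, hC₁⟩ := exists_function_trace hp
  obtain ⟨C₂, hC₂⟩ := exists_lintegral_gauss_mul_le
  -- The smallest of the available exponents: a from the trace of f, γ from ν, and 1/8 as required
  -- for a square-integrable gain majorant.
  set δ := min (min a γ) (1 / 8) with hδ
  have hδ0 : 0 < δ := lt_min (lt_min ha hB.gamma_pos) (by norm_num)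
  have hδa : δ ≤ a := (min_le_left _ _).trans (min_le_left _ _)
  have hδγ : δ ≤ γ := (min_le_left _ _).trans (min_le_right _ _)
  obtain ⟨K, hK0, hK⟩ := exists_integralOp_bounds hB hδ0 (min_le_right _ _) hδγ
  have hν1 := hν.const_nonneg
  have hG2 := (integrable_gauss_two (κ := 1 / 16) (by norm_num)).lintegral_lt_top
  have hG3 := (integrable_exp_norm_sq (κ := 1 / 16) (by norm_num)).lintegral_lt_top
  set G₂ := ∫⁻ q : ℝ × ℝ, ENNReal.ofReal (Real.exp (-(1 / 16 * (q.1 ^ 2 + q.2 ^ 2)))) with hG₂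
  set G₃ := ∫⁻ ζ : Vel, ENNReal.ofReal (Real.exp (-(1 / 16 * ‖ζ‖ ^ 2))) with hG₃
  refine ⟨δ, hδ0, (Real.toNNReal (4 * K) * G₂.toNNReal + Real.toNNReal (10 * ν₁) * C₁ +
    Real.toNNReal ν₁ * (3 * C₁)) + (Real.toNNReal K * G₃.toNNReal + Real.toNNReal (6 * ν₁) * C₂),
    fun f Γ hf hΓ hf2 hΓp htr => ?_⟩
  obtain ⟨g₀, H, hmaj⟩ := hC₁ f Γ hf hΓ hf2 hΓp htr
  obtain ⟨hk1, hk2⟩ := hK f hf hf2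
  have hg₀ := H.measurable_trace
  have htm := H.measurable_bound
  have hkm := measurable_integralOp hB hf
  have hνm := hν.measurable
  have mw := measurable_tanWeight
  set M := eLpNorm f 2 volume + eLpNorm Γ p (volume.restrict halfPos) with hM
  set N := (eLpNorm f 2 volume).toReal with hN
  have hN0 : 0 ≤ N := ENNReal.toReal_nonneg
  have hNM : ENNReal.ofReal N ≤ M := by
    rw [hN, ENNReal.ofReal_toReal hf2.ne]; exact le_self_add
  have hkm2 : Measurable fun q : ℝ × ℝ => integralOp γ β f !₂[0, q.1, q.2] :=
    hkm.comp (measurable_vel_tan 0)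
  have hνm2 : Measurable fun q : ℝ × ℝ => collisionFreq γ β !₂[0, q.1, q.2] :=
    hνm.comp (measurable_vel_tan 0)
  have hlm : Measurable fun ζ => integralOp γ β f ζ - collisionFreq γ β ζ * f ζ := by fun_prop
  simp only [fun p : ℝ × ℝ × ℝ => linCollision_eq hB hf hf2 !₂[p.1, p.2.1, p.2.2]]
  refine ⟨fun q => integralOp γ β f !₂[0, q.1, q.2] - collisionFreq γ β !₂[0, q.1, q.2] * g₀ q,
    fun q => ENNReal.ofReal (4 * K * N * Real.exp (1 / 16 * (q.1 ^ 2 + q.2 ^ 2))) +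
      ENNReal.ofReal (ν₁ * (2 + |q.1| + |q.2|)) * traceMajorant a Γ q +
      ENNReal.ofReal ν₁ * ‖g₀ q‖ₑ, hlm.comp measurable_vel_mk, by fun_prop, by fun_prop, ?_, ?_, ?_⟩
  · filter_upwards [H.near, ae_slabMeasure] with p hnear hp
    set ζ : Vel := !₂[p.1, p.2.1, p.2.2] with hζ
    set ζ₀ : Vel := !₂[0, p.2.1, p.2.2] with hζ₀
    have hadd : ζ = ζ₀ + p.1 • (EuclideanSpace.single 0 1 : Vel) := by
      have := vel_mk_add_smul_axisVec 0 p.1 p.2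
      rw [zero_add] at this
      exact this.symm
    have hsub : ‖ζ - ζ₀‖ = p.1 := by
      rw [hadd, add_sub_cancel_left, norm_single_zero, abs_of_pos hp.1]
    have hpow : ∀ b : ℝ, δ ≤ b → p.1 ^ b ≤ p.1 ^ δ := fun b hb =>
      Real.rpow_le_rpow_of_exponent_ge hp.1 hp.2.le hb
    have hδp : 0 ≤ p.1 ^ δ := Real.rpow_nonneg hp.1.le _
    set E := Real.exp (1 / 16 * (p.2.1 ^ 2 + p.2.2 ^ 2)) with hE
    have hE0 : 0 ≤ E := Real.exp_nonneg _
    have b1 : ‖integralOp γ β f ζ - integralOp γ β f ζ₀‖ₑ ≤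
        ENNReal.ofReal (p.1 ^ δ) * ENNReal.ofReal (4 * K * N * E) := by
      rw [Real.enorm_eq_ofReal_abs, ← ENNReal.ofReal_mul hδp]
      refine ENNReal.ofReal_le_ofReal ?_
      have h1 := hk2 ζ₀ p.1 hp.1 hp.2.le
      rw [← hadd] at h1
      have h2 : Real.exp (‖ζ₀‖ ^ 2 / 16) = E := by
        rw [hζ₀, norm_sq_vel_mk, hE]
        congr 1
        ring
      have h3 : Real.exp (‖ζ‖ ^ 2 / 16) ≤ 3 * E := by
        rw [hζ, norm_sq_vel_mk, hE]
        have h4 : Real.exp (p.1 ^ 2 / 16) ≤ 3 := by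
          have h5 := Real.exp_one_lt_d9
          have h6 : Real.exp (p.1 ^ 2 / 16) ≤ Real.exp 1 := by
            rw [Real.exp_le_exp]
            nlinarith [hp.1, hp.2]
          linarith
        calc Real.exp ((p.1 ^ 2 + p.2.1 ^ 2 + p.2.2 ^ 2) / 16)
            = Real.exp (p.1 ^ 2 / 16) * Real.exp (1 / 16 * (p.2.1 ^ 2 + p.2.2 ^ 2)) := by
              rw [← Real.exp_add]; congr 1; ring
          _ ≤ _ := by gcongr
      rw [h2] at h1
      calc _ ≤ K * (p.1 ^ δ * (E + Real.exp (‖ζ‖ ^ 2 / 16))) * N := h1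
        _ ≤ K * (p.1 ^ δ * (E + 3 * E)) * N := by gcongr
        _ = _ := by ring
    have b2 : ‖collisionFreq γ β ζ * (f ζ - g₀ p.2)‖ₑ ≤ ENNReal.ofReal (p.1 ^ δ) *
        (ENNReal.ofReal (ν₁ * (2 + |p.2.1| + |p.2.2|)) * traceMajorant a Γ p.2) := by
      rw [enorm_mul, mul_left_comm (ENNReal.ofReal (p.1 ^ δ)),
        Real.enorm_eq_ofReal (hν.pos.le.trans (hν.lower ζ))]
      refine mul_le_mul' (ENNReal.ofReal_le_ofReal (hν.le_tangential hp)) (hnear.trans ?_)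
      exact mul_le_mul' (ENNReal.ofReal_le_ofReal (hpow a hδa)) le_rfl
    have b3 : ‖(collisionFreq γ β ζ - collisionFreq γ β ζ₀) * g₀ p.2‖ₑ ≤
        ENNReal.ofReal (p.1 ^ δ) * (ENNReal.ofReal ν₁ * ‖g₀ p.2‖ₑ) := by
      rw [enorm_mul, ← mul_assoc, ← ENNReal.ofReal_mul hδp, Real.enorm_eq_ofReal_abs (_ - _)]
      refine mul_le_mul' (ENNReal.ofReal_le_ofReal ?_) le_rfl
      refine (hν.holder ζ₀ ζ).trans ?_
      rw [hsub, mul_comm]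
      exact mul_le_mul_of_nonneg_right (hpow γ hδγ) hν1
    have hsplit : integralOp γ β f ζ - collisionFreq γ β ζ * f ζ -
        (integralOp γ β f ζ₀ - collisionFreq γ β ζ₀ * g₀ p.2) =
        (integralOp γ β f ζ - integralOp γ β f ζ₀) - collisionFreq γ β ζ * (f ζ - g₀ p.2) -
        (collisionFreq γ β ζ - collisionFreq γ β ζ₀) * g₀ p.2 := by ring
    rw [hsplit, mul_add, mul_add]
    exact enorm_sub_le.trans (add_le_add (enorm_sub_le.trans (add_le_add b1 b2)) b3)
  · have htr := H.trace_le ha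
    calc _ ≤ ∫⁻ q : ℝ × ℝ, (ENNReal.ofReal (4 * K * N) *
          ENNReal.ofReal (Real.exp (-(1 / 16 * (q.1 ^ 2 + q.2 ^ 2)))) +
          ENNReal.ofReal (10 * ν₁) * (ENNReal.ofReal (Real.exp (-(1 / 16 * (q.1 ^ 2 + q.2 ^ 2)))) *
            traceMajorant a Γ q) +
          ENNReal.ofReal ν₁ * (ENNReal.ofReal (tanWeight q) * ‖g₀ q‖ₑ)) := by
          refine lintegral_mono fun q => ?_
          have hw := tanWeight_pos q
          have e1 := tanWeight_mul_exp q
          dsimp only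
          rw [mul_add, mul_add]
          refine add_le_add (add_le_add (le_of_eq ?_) ?_) (le_of_eq (mul_left_comm _ _ _))
          · rw [← ENNReal.ofReal_mul hw.le, ← ENNReal.ofReal_mul (by positivity), ← e1]
            congr 1
            ring
          · rw [← mul_assoc, ← mul_assoc, ← ENNReal.ofReal_mul hw.le,
              ← ENNReal.ofReal_mul (by positivity), ← e1]
            refine mul_le_mul' (ENNReal.ofReal_le_ofReal ?_) le_rfl
            have e2 := tangential_le' q
            calc tanWeight q * (ν₁ * (2 + |q.1| + |q.2|)) ≤ tanWeight q * (ν₁ *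
                  (10 * Real.exp (1 / 16 * (q.1 ^ 2 + q.2 ^ 2)))) := by gcongr
              _ = _ := by ring
      _ = ENNReal.ofReal (4 * K * N) * G₂ + ENNReal.ofReal (10 * ν₁) *
          (∫⁻ q : ℝ × ℝ, ENNReal.ofReal (Real.exp (-(1 / 16 * (q.1 ^ 2 + q.2 ^ 2)))) *
            traceMajorant a Γ q) +
          ENNReal.ofReal ν₁ * ∫⁻ q, ENNReal.ofReal (tanWeight q) * ‖g₀ q‖ₑ := by
          rw [lintegral_add_right _ (by fun_prop), lintegral_add_right _ (by fun_prop),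
            lintegral_const_mul _ (by fun_prop), lintegral_const_mul _ (by fun_prop),
            lintegral_const_mul _ (by fun_prop)]
      _ ≤ (ENNReal.ofReal (4 * K) * M) * G₂ + ENNReal.ofReal (10 * ν₁) * (C₁ * M) +
          ENNReal.ofReal ν₁ * (3 * (C₁ * M)) := by
          rw [ENNReal.ofReal_mul (by positivity)]
          gcongr
      _ = (Real.toNNReal (4 * K) * G₂.toNNReal + Real.toNNReal (10 * ν₁) * C₁ +
            Real.toNNReal ν₁ * (3 * C₁) : ℝ≥0) * M := by
          push_cast
          rw [ENNReal.coe_toNNReal hG2.ne, ENNReal.ofReal, ENNReal.ofReal, ENNReal.ofReal]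
          ring
      _ ≤ _ := by
          rw [ENNReal.coe_add _ (Real.toNNReal K * _ + _)]
          gcongr
          exact le_self_add
  · have h1 := lintegral_halfMeasure_le (fun ζ => ENNReal.ofReal (Real.exp (-(‖ζ‖ ^ 2 / 8))) *
      ‖integralOp γ β f ζ - collisionFreq γ β ζ * f ζ‖ₑ)
    simp only [exp_mul_tanWeight]
    refine h1.trans ?_
    calc _ ≤ ∫⁻ ζ : Vel, (ENNReal.ofReal (K * N) *
          ENNReal.ofReal (Real.exp (-(1 / 16 * ‖ζ‖ ^ 2))) + ENNReal.ofReal (6 * ν₁) *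
          (ENNReal.ofReal (Real.exp (-(1 / 16 * ‖ζ‖ ^ 2))) * ‖f ζ‖ₑ)) := by
          refine lintegral_mono fun ζ => ?_
          have e1 : Real.exp (-(‖ζ‖ ^ 2 / 8)) * Real.exp (‖ζ‖ ^ 2 / 16) =
              Real.exp (-(1 / 16 * ‖ζ‖ ^ 2)) := by
            rw [← Real.exp_add]; congr 1; ring
          have e2 : 1 + ‖ζ‖ ≤ 6 * Real.exp (‖ζ‖ ^ 2 / 16) := by
            have := one_add_rpow_le_exp zero_le_one le_rfl ζ
            rwa [Real.rpow_one] at this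
          dsimp only
          refine (mul_le_mul_right (enorm_sub_le (a := integralOp γ β f ζ)) _).trans ?_
          rw [mul_add]
          refine add_le_add ?_ ?_
          · rw [Real.enorm_eq_ofReal_abs, ← ENNReal.ofReal_mul (Real.exp_nonneg _),
              ← ENNReal.ofReal_mul (by positivity), ← e1]
            refine ENNReal.ofReal_le_ofReal ?_
            calc Real.exp (-(‖ζ‖ ^ 2 / 8)) * |integralOp γ β f ζ| ≤ Real.exp (-(‖ζ‖ ^ 2 / 8)) *
                  (K * Real.exp (‖ζ‖ ^ 2 / 16) * N) := by
                  gcongr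
                  exact hk1 ζ
              _ = _ := by ring
          · rw [enorm_mul, ← mul_assoc, ← mul_assoc,
              Real.enorm_eq_ofReal (hν.pos.le.trans (hν.lower ζ)),
              ← ENNReal.ofReal_mul (Real.exp_nonneg _), ← ENNReal.ofReal_mul (by positivity), ← e1]
            refine mul_le_mul' (ENNReal.ofReal_le_ofReal ?_) le_rfl
            calc Real.exp (-(‖ζ‖ ^ 2 / 8)) * collisionFreq γ β ζ ≤ Real.exp (-(‖ζ‖ ^ 2 / 8)) *
                  (ν₁ * (6 * Real.exp (‖ζ‖ ^ 2 / 16))) := by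
                  gcongr
                  exact (hν.upper ζ).trans (by gcongr)
              _ = _ := by ring
      _ = ENNReal.ofReal (K * N) * G₃ + ENNReal.ofReal (6 * ν₁) *
          ∫⁻ ζ : Vel, ENNReal.ofReal (Real.exp (-(1 / 16 * ‖ζ‖ ^ 2))) * ‖f ζ‖ₑ := by
          rw [lintegral_add_right _ (by fun_prop), lintegral_const_mul _ (by fun_prop),
            lintegral_const_mul _ (by fun_prop)]
      _ ≤ (ENNReal.ofReal K * M) * G₃ + ENNReal.ofReal (6 * ν₁) * (C₂ * M) := by
          rw [ENNReal.ofReal_mul hK0]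
          gcongr
          exact (hC₂ f hf).trans (by gcongr; exact le_self_add)
      _ = (Real.toNNReal K * G₃.toNNReal + Real.toNNReal (6 * ν₁) * C₂ : ℝ≥0) * M := by
          push_cast
          rw [ENNReal.coe_toNNReal hG3.ne, ENNReal.ofReal, ENNReal.ofReal]
          ring
      _ ≤ _ := by
          rw [ENNReal.coe_add (_ + _ + _)]
          gcongr
          exact le_add_self

/-! ### Boundary values -/

/-- A right neighbourhood of 0 has positive measure and so meets every conull set. Nontriviality
makes essential limits unique, so that `limUnder` returns the trace. -/
instance essZeroRight_neBot : NeBot essZeroRight := by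
  rw [essZeroRight, inf_neBot_iff]
  intro s hs t ht
  obtain ⟨u, hu, hus⟩ := mem_nhdsGT_iff_exists_Ioo_subset.1 hs
  have hu0 : (0 : ℝ) < u := hu
  by_contra hn
  rw [not_nonempty_iff_eq_empty] at hn
  have h1 : Ioo 0 u ⊆ tᶜ := fun y hy hyt => by
    have : y ∈ s ∩ t := ⟨hus hy, hyt⟩
    rw [hn] at this
    exact this
  have h2 : volume (Ioo (0 : ℝ) u) = 0 := measure_mono_null h1 (mem_ae_iff.1 ht)
  rw [Real.volume_Ioo, ENNReal.ofReal_eq_zero] at h2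
  linarith

/-- The weighted bound makes X finite almost everywhere, and on such a line the Hölder rate forces
convergence outside a null set of t. -/
theorem HasHolderTrace.ae_tendsto {δ : ℝ} {h : ℝ × ℝ × ℝ → ℝ} {h₀ : ℝ × ℝ → ℝ}
    {X : ℝ × ℝ → ℝ≥0∞} {N : ℝ≥0∞} (H : HasHolderTrace δ h h₀ X N) (hδ : 0 < δ) (hN : N < ⊤) :
    ∀ᵐ q, Tendsto (fun t : ℝ => h (t, q)) essZeroRight (𝓝 (h₀ q)) := by
  have hX := H.measurable_bound
  have mw := measurable_tanWeight
  have h1 : ∀ᵐ z ∂((volume : Measure (ℝ × ℝ)).prod (volume.restrict (Ioo (0 : ℝ) 1))),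
      ‖h (z.2, z.1) - h₀ z.1‖ₑ ≤ ENNReal.ofReal (z.2 ^ δ) * X z.1 :=
    Measure.measurePreserving_swap.quasiMeasurePreserving.ae H.near
  have h2 : ∀ᵐ q, X q < ⊤ := by
    filter_upwards [ae_lt_top (by fun_prop) (H.bound_le.trans_lt hN).ne] with q hq
    by_contra hn
    rw [not_lt, top_le_iff] at hn
    rw [hn, ENNReal.mul_top (by simpa using tanWeight_pos q)] at hq
    exact lt_irrefl _ hq
  filter_upwards [Measure.ae_ae_of_ae_prod h1, h2] with q hq hXq
  rw [ae_restrict_iff' measurableSet_Ioo] at hq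
  rw [tendsto_iff_norm_sub_tendsto_zero]
  have hlim : Tendsto (fun t : ℝ => t ^ δ * (X q).toReal) essZeroRight (𝓝 0) := by
    have h3 : Tendsto (fun t : ℝ => t ^ δ * (X q).toReal) (𝓝 0) (𝓝 (0 ^ δ * (X q).toReal)) :=
      ((Real.continuousAt_rpow_const 0 δ (Or.inr hδ.le)).mul continuousAt_const)
    rw [Real.zero_rpow hδ.ne', zero_mul] at h3
    exact h3.mono_left (inf_le_left.trans nhdsWithin_le_nhds)
  refine squeeze_zero' (Eventually.of_forall fun _ => norm_nonneg _) ?_ hlim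
  have h4 : ∀ᶠ t in essZeroRight, t ∈ Ioo (0 : ℝ) 1 :=
    (show essZeroRight ≤ 𝓝[>] (0 : ℝ) from inf_le_left) (Ioo_mem_nhdsGT one_pos)
  have h5 : ∀ᶠ t in essZeroRight, t ∈ Ioo (0 : ℝ) 1 →
      ‖h (t, q) - h₀ q‖ₑ ≤ ENNReal.ofReal (t ^ δ) * X q :=
    (show essZeroRight ≤ ae volume from inf_le_right) hq
  filter_upwards [h4, h5] with t ht ht'
  have h6 := ENNReal.toReal_mono (ENNReal.mul_lt_top ENNReal.ofReal_lt_top hXq).ne (ht' ht)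
  rwa [ENNReal.toReal_mul, ENNReal.toReal_ofReal (Real.rpow_nonneg ht.1.le _), toReal_enorm] at h6

theorem measurableEmbedding_vel_mk :
    MeasurableEmbedding fun p : ℝ × ℝ × ℝ => (!₂[p.1, p.2.1, p.2.2] : Vel) := by
  have h : (fun p : ℝ × ℝ × ℝ => (!₂[p.1, p.2.1, p.2.2] : Vel)) = velCoord.symm :=
    funext fun p => (velCoord_symm_apply p).symm
  rw [h]
  exact velCoord.symm.measurableEmbedding

theorem measurePreserving_halfMeasure :
    MeasurePreserving (fun p : ℝ × ℝ × ℝ => (!₂[p.1, p.2.1, p.2.2] : Vel)) halfMeasure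
      (volume.restrict halfPos) := by
  have h1 := measurePreserving_vel_mk.restrict_preimage isOpen_halfPos.measurableSet
  have h2 : halfMeasure = volume.restrict
      ((fun p : ℝ × ℝ × ℝ => (!₂[p.1, p.2.1, p.2.2] : Vel)) ⁻¹' halfPos) := by
    have h3 : (fun p : ℝ × ℝ × ℝ => (!₂[p.1, p.2.1, p.2.2] : Vel)) ⁻¹' halfPos =
        Ioi (0 : ℝ) ×ˢ univ := by
      ext p
      simp [halfPos]
    rw [h3, halfMeasure, Measure.volume_eq_prod ℝ (ℝ × ℝ), ← Measure.prod_restrict,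
      Measure.restrict_univ]
  rwa [← h2] at h1

/-- The lower bound on ν makes ‖·‖_* dominate the L² norm, with factor ν₀^{-1/2}. -/
theorem IsFrequency.eLpNorm_le_starNorm {γ : ℝ} {β : ℝ → ℝ} {ν₀ ν₁ : ℝ}
    (h : IsFrequency γ (collisionFreq γ β) ν₀ ν₁) (f : Vel → ℝ) :
    eLpNorm f 2 volume ≤ ENNReal.ofReal (1 / ν₀) ^ (1 / 2 : ℝ) * starNorm γ β f := by
  have h0 := h.pos
  rw [eLpNorm_eq_lintegral_rpow_enorm_toReal two_ne_zero ENNReal.ofNat_ne_top, starNorm,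
    ← ENNReal.mul_rpow_of_nonneg _ _ (by norm_num), ENNReal.toReal_ofNat]
  refine ENNReal.rpow_le_rpow ?_ (by norm_num)
  rw [← lintegral_const_mul' _ _ ENNReal.ofReal_ne_top]
  refine lintegral_mono fun ζ => ?_
  rw [← ENNReal.ofReal_mul (by positivity), Real.enorm_eq_ofReal_abs,
    ENNReal.ofReal_rpow_of_nonneg (abs_nonneg _) zero_le_two, Real.rpow_two, sq_abs]
  refine ENNReal.ofReal_le_ofReal ?_
  calc f ζ ^ 2 = 1 / ν₀ * (f ζ ^ 2 * ν₀) := by field_simp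
    _ ≤ _ := by
      have := h.lower ζ
      gcongr

theorem LocallyIntegrableOn.congr_halfPos {u v : Vel → ℝ} (hu : LocallyIntegrableOn u halfPos)
    (h : u =ᵐ[volume.restrict halfPos] v) : LocallyIntegrableOn v halfPos := by
  rw [locallyIntegrableOn_iff isOpen_halfPos.isLocallyClosed] at hu ⊢
  intro K hK hKc
  exact (hu K hK hKc).congr_fun_ae (ae_mono (Measure.restrict_mono hK le_rfl) h)

theorem LocallyIntegrableOn.coord_halfPos {G : Vel → Vel} (hG : LocallyIntegrableOn G halfPos)
    (i : Fin 3) : LocallyIntegrableOn (fun ζ => G ζ i) halfPos := by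
  rw [locallyIntegrableOn_iff isOpen_halfPos.isLocallyClosed] at hG ⊢
  intro K hK hKc
  exact (EuclideanSpace.proj i : Vel →L[ℝ] ℝ).integrable_comp (hG K hK hKc)

end CutoffBoltzmann

/-! ### Assembly of the lemma -/

theorem lemma3p1 (γ : ℝ) (β : ℝ → ℝ) (hB : CutoffBoltzmann.IsCutoffPowerLaw γ β) :
    ∃ x₀ : ℝ, 0 < x₀ ∧ ∀ p : ℝ≥0∞, 1 < p → ∃ C : ℝ≥0,
      ∀ (l : ℝ) (_ : 0 < l) (f : ℝ → CutoffBoltzmann.Vel → ℝ)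
        (G : CutoffBoltzmann.Vel → CutoffBoltzmann.Vel),
        CutoffBoltzmann.MemLstar γ β (f 0) →
        CutoffBoltzmann.IsWeakGradientOn CutoffBoltzmann.halfPos (f 0) G →
        MemLp G p (volume.restrict CutoffBoltzmann.halfPos) →
        -- the limit `L(f)(0, 0⁺, ζ₂, ζ₃)` exists for almost every `(ζ₂, ζ₃)`
        (∀ᵐ q : ℝ × ℝ,
          Tendsto (fun t : ℝ => CutoffBoltzmann.linCollision γ β (f 0) !₂[t, q.1, q.2])
            CutoffBoltzmann.essZeroRight
            (𝓝 (CutoffBoltzmann.boundaryValue (CutoffBoltzmann.linCollision γ β (f 0)) q))) ∧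
        ∀ α : Fin 3 → ℕ,
          Integrable (fun q : ℝ × ℝ => CutoffBoltzmann.momentWeight α !₂[0, q.1, q.2]
            * CutoffBoltzmann.boundaryValue (CutoffBoltzmann.linCollision γ β (f 0)) q) ∧
          ∀ x : ℝ, 0 < x → x ≤ x₀ →
            IntegrableOn (fun ζ : CutoffBoltzmann.Vel => CutoffBoltzmann.momentWeight α ζ * (1 / |ζ 0|)
              * Real.exp (-(CutoffBoltzmann.collisionFreq γ β ζ / |ζ 0|) * x)
              * CutoffBoltzmann.linCollision γ β (f 0) ζ) CutoffBoltzmann.halfPos ∧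
            ENNReal.ofReal
              |(∫ ζ in CutoffBoltzmann.halfPos, CutoffBoltzmann.momentWeight α ζ * (1 / |ζ 0|)
                  * Real.exp (-(CutoffBoltzmann.collisionFreq γ β ζ / |ζ 0|) * x)
                  * CutoffBoltzmann.linCollision γ β (f 0) ζ)
                - (-Real.log x) * ∫ q : ℝ × ℝ, CutoffBoltzmann.momentWeight α !₂[0, q.1, q.2]
                    * CutoffBoltzmann.boundaryValue (CutoffBoltzmann.linCollision γ β (f 0)) q|
              ≤ C * ENNReal.ofReal (CutoffBoltzmann.momentConst α)
                * CutoffBoltzmann.bracket' γ β p l f G := by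
  open CutoffBoltzmann in
  obtain ⟨ν₀, ν₁, hν⟩ := hB.exists_isFrequency
  -- x₀ = 1: the kernel is compared with 1/t on (x, 1), so any x ≤ 1 is admissible.
  refine ⟨1, one_pos, fun p hp => ?_⟩
  obtain ⟨δ, hδ, C₁, hC₁⟩ := exists_collision_trace hB hp
  obtain ⟨C₂, hC₂⟩ := exists_moment_estimate hν.pos hν.const_nonneg hδ
  set c : ℝ≥0∞ := ENNReal.ofReal (1 / ν₀) ^ (1 / 2 : ℝ) with hc
  have hct : c ≠ ⊤ := ENNReal.rpow_ne_top_of_nonneg (by norm_num) ENNReal.ofReal_ne_top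
  refine ⟨C₂ * C₁ * (c.toNNReal + 1), fun l hl f G hf hG hGp => ?_⟩
  obtain ⟨hfloc, hGloc, hweak⟩ := hG
  -- The trace theory needs a Borel function, so f(0, ·) and the first component of its gradient are
  -- replaced by measurable representatives. L(f) changes only on a null set, which on almost every
  -- line is invisible to the essential limit.
  set fm := hf.1.mk with hfm
  have hfmm : Measurable fm := hf.1.stronglyMeasurable_mk.measurable
  have hfe : f 0 =ᵐ[volume] fm := hf.1.ae_eq_mk
  have hfe' : f 0 =ᵐ[volume.restrict halfPos] fm := ae_restrict_of_ae hfe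
  have hΓs : AEStronglyMeasurable (fun ζ => (G ζ 0 : ℝ)) (volume.restrict halfPos) :=
    (EuclideanSpace.proj 0 : Vel →L[ℝ] ℝ).continuous.comp_aestronglyMeasurable
      hGp.1
  set Γ : Vel → ℝ := hΓs.mk with hΓ
  have hΓm : Measurable Γ := hΓs.stronglyMeasurable_mk.measurable
  have hΓe : (fun ζ => G ζ 0) =ᵐ[volume.restrict halfPos] Γ := hΓs.ae_eq_mk
  have hw : ∀ φ : Vel → ℝ, ContDiff ℝ ((⊤ : ℕ∞) : WithTop ℕ∞) φ → HasCompactSupport φ →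
      tsupport φ ⊆ halfPos → ∫ ζ in halfPos, fm ζ * fderiv ℝ φ ζ axisVec =
        -∫ ζ in halfPos, Γ ζ * φ ζ := by
    intro φ h1 h2 h3
    have h4 := hweak φ h1 h2 h3 0
    have e1 : ∫ ζ in halfPos, fm ζ * fderiv ℝ φ ζ axisVec =
        ∫ ζ in halfPos, f 0 ζ * fderiv ℝ φ ζ (EuclideanSpace.single 0 1) :=
      integral_congr_ae (hfe'.mono fun ζ hζ => by simp only; rw [hζ, axisVec])
    have e2 : ∫ ζ in halfPos, Γ ζ * φ ζ = ∫ ζ in halfPos, G ζ 0 * φ ζ :=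
      integral_congr_ae (hΓe.mono fun ζ hζ => by simp only; rw [← hζ])
    rw [e1, e2]
    exact h4
  have htr := fun h (h0 : (0 : ℝ) ≤ h) => ae_translate_sub_eq hfmm hΓm
    (LocallyIntegrableOn.congr_halfPos hfloc hfe')
    (LocallyIntegrableOn.congr_halfPos (LocallyIntegrableOn.coord_halfPos hGloc 0) hΓe) hw h0
  have hf2le : eLpNorm fm 2 volume ≤ c * starNorm γ β (f 0) := by
    rw [← eLpNorm_congr_ae hfe]
    exact hν.eLpNorm_le_starNorm (f 0)
  have hf2 : eLpNorm fm 2 volume < ⊤ :=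
    hf2le.trans_lt (ENNReal.mul_lt_top hct.lt_top hf.2)
  have hΓle : eLpNorm Γ p (volume.restrict halfPos) ≤ eLpNorm G p (volume.restrict halfPos) := by
    rw [← eLpNorm_congr_ae hΓe]
    exact eLpNorm_mono fun ζ => PiLp.norm_apply_le (G ζ) 0
  have hΓp : eLpNorm Γ p (volume.restrict halfPos) < ⊤ := hΓle.trans_lt hGp.2
  obtain ⟨h₀, X, H⟩ := hC₁ fm Γ hfmm hΓm hf2 hΓp htr
  set N : ℝ≥0∞ := C₁ * (eLpNorm fm 2 volume + eLpNorm Γ p (volume.restrict halfPos)) with hN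
  have hNt : N < ⊤ := ENNReal.mul_lt_top ENNReal.coe_lt_top (ENNReal.add_lt_top.2 ⟨hf2, hΓp⟩)
  have hL : ∀ᵐ ζ, linCollision γ β (f 0) ζ = linCollision γ β fm ζ :=
    hfe.mono fun ζ h => linCollision_congr hfe h
  have hLs : ∀ᵐ q : ℝ × ℝ, ∀ᵐ t : ℝ, linCollision γ β (f 0) !₂[t, q.1, q.2] =
      linCollision γ β fm !₂[t, q.1, q.2] := by
    have h1 := measurePreserving_vel_mk.quasiMeasurePreserving.ae hL
    have h2 : ∀ᵐ z : (ℝ × ℝ) × ℝ, linCollision γ β (f 0) !₂[z.2, z.1.1, z.1.2] =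
        linCollision γ β fm !₂[z.2, z.1.1, z.1.2] :=
      (Measure.measurePreserving_swap (μ := (volume : Measure (ℝ × ℝ)))
        (ν := (volume : Measure ℝ))).quasiMeasurePreserving.ae h1
    exact Measure.ae_ae_of_ae_prod h2
  have hlim : ∀ᵐ q : ℝ × ℝ, Tendsto (fun t : ℝ => linCollision γ β (f 0) !₂[t, q.1, q.2])
      essZeroRight (𝓝 (h₀ q)) := by
    filter_upwards [H.ae_tendsto hδ hNt, hLs] with q h1 h2
    refine h1.congr' ?_
    have h3 := (show essZeroRight ≤ ae volume from inf_le_right) h2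
    filter_upwards [h3] with t ht using ht.symm
  have hbv : ∀ᵐ q : ℝ × ℝ, boundaryValue (linCollision γ β (f 0)) q = h₀ q :=
    hlim.mono fun q hq => hq.limUnder_eq
  refine ⟨?_, fun α => ?_⟩
  · filter_upwards [hlim, hbv] with q h1 h2
    rwa [h2]
  have hkey := fun x (hx : (0 : ℝ) < x) (hx1 : x ≤ 1) =>
    hC₂ (fun p => collisionFreq γ β !₂[p.1, p.2.1, p.2.2]) _ h₀ X N α x H hNt
      (hν.measurable.comp measurable_vel_mk) (fun p => hν.lower _)
      (fun p hp => hν.le_tangential hp) hx hx1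
  have hbv' : (fun q : ℝ × ℝ => momentWeight α !₂[0, q.1, q.2] * h₀ q) =ᵐ[volume]
      fun q : ℝ × ℝ => momentWeight α !₂[0, q.1, q.2] *
        boundaryValue (linCollision γ β (f 0)) q := hbv.mono fun q hq => by simp only; rw [hq]
  -- Integrability of the boundary term does not involve x; the value 1 merely serves to extract it.
  refine ⟨(hkey 1 one_pos le_rfl).1.congr hbv', fun x hx hx1 => ?_⟩
  obtain ⟨-, k2, k3⟩ := hkey x hx hx1
  have hcoord : (fun p : ℝ × ℝ × ℝ => momentWeight α !₂[p.1, p.2.1, p.2.2] * (1 / p.1) *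
      Real.exp (-(collisionFreq γ β !₂[p.1, p.2.1, p.2.2] / p.1) * x) *
      linCollision γ β fm !₂[p.1, p.2.1, p.2.2]) =ᵐ[halfMeasure]
      (fun ζ : Vel => momentWeight α ζ * (1 / |ζ 0|) *
        Real.exp (-(collisionFreq γ β ζ / |ζ 0|) * x) * linCollision γ β (f 0) ζ) ∘
        fun p : ℝ × ℝ × ℝ => !₂[p.1, p.2.1, p.2.2] := by
    filter_upwards [ae_halfMeasure, measurePreserving_halfMeasure.quasiMeasurePreserving.ae
      (ae_restrict_of_ae hL)] with p hp hp2
    have h1 : |(!₂[p.1, p.2.1, p.2.2] : Vel) 0| = p.1 := by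
      simpa using abs_of_pos hp
    rw [Function.comp_apply, hp2, h1]
  refine ⟨(measurePreserving_halfMeasure.integrable_comp_emb measurableEmbedding_vel_mk).1
    (k2.congr hcoord), ?_⟩
  have e1 := measurePreserving_halfMeasure.integral_comp measurableEmbedding_vel_mk
    (fun ζ : Vel => momentWeight α ζ * (1 / |ζ 0|) *
        Real.exp (-(collisionFreq γ β ζ / |ζ 0|) * x) * linCollision γ β (f 0) ζ)
  have e2 := integral_congr_ae hcoord
  simp only [Function.comp_def] at e2
  rw [e2, e1, integral_congr_ae hbv'] at k3
  rw [← Real.enorm_eq_ofReal_abs]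
  refine k3.trans ?_
  have hb1 : starNorm γ β (f 0) ≤ bracket' γ β p l f G := by
    have : starNorm γ β (f 0) ≤ ⨆ x ∈ Icc 0 l, starNorm γ β (f x) :=
      le_iSup₂ (f := fun x (_ : x ∈ Icc 0 l) => starNorm γ β (f x)) 0 ⟨le_rfl, hl.le⟩
    rw [bracket', add_assoc, add_assoc]
    exact this.trans (le_add_self.trans le_self_add)
  have hb2 : eLpNorm G p (volume.restrict halfPos) ≤ bracket' γ β p l f G := by
    rw [bracket']
    exact le_add_self
  calc (C₂ : ℝ≥0∞) * ENNReal.ofReal (momentConst α) * N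
      ≤ C₂ * ENNReal.ofReal (momentConst α) *
        (C₁ * (c * bracket' γ β p l f G + bracket' γ β p l f G)) := by
        rw [hN]
        gcongr
        · exact hf2le.trans (by gcongr)
        · exact hΓle.trans hb2
    _ = _ := by
        push_cast
        rw [ENNReal.coe_toNNReal hct]
        ring
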